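/- **Setting.** Let $n,m\ge 0$ be integers, $T>0$, and let $(\Omega,\mathcal F,\mathbb P)$ be a complete probability space carrying an $n$-dimensional standard Wiener process $W$ and a random vector $x_0$ in $\mathbb R^n$ that is independent of $W$ and satisfies $\mathbb E|x_0|^2<\infty$. Put $\mathcal F_t=\sigma(x_0,W_s: s\le t)$ and let $L^2_{\mathcal F}(0,T;\mathbb R^k)$ be the space of $\mathbb R^k$-valued processes that are square integrable on $[0,T]\times\Omega$ (with respect to $dt\otimes d\mathbb P$) and adapted to $(\mathcal F_t)$. Let $A,\bar A,S,Q,\bar Q$ ($n\times n$), $B$ ($n\times m$) and $R$ ($m\times m$) be bounded measurable deterministic real matrix-valued functions on $[0,T]$, such that $Q_t,\bar Q_t$ are symmetric nonnegative definite and, for some $\delta>0$, $R_t$ is symmetric with $R_t\ge\delta I$ for all $t\in[0,T]$. Let $\sigma\in L^2(0,T;\mathbb R^{n\times n})$ be deterministic and let $z:[0,T]\to\mathbb R^n$ be a given continuous deterministic path. Write $M^*$ for the transpose of $M$; $Q_T,\bar Q_T,S_T,z_T$ are values at time $T$. For $v\in L^2_{\mathcal F}(0,T;\mathbb R^m)$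 (an admissible control) let $x$ be the state process, i.e. the continuous solution, adapted up to null sets, of $$dx_t=(A_tx_t+B_tv_t+\bar A_tz_t)\,dt+\sigma_t\,dW_t,\qquad x(0)=x_0,$$ and let $$J(v)=\mathbb E\Big[\tfrac12\int_0^T x_t^*Q_tx_t+v_t^*R_tv_t+(x_t-S_tz_t)^*\bar Q_t(x_t-S_tz_t)\,dt\Big]+\mathbb E\Big[\tfrac12x_T^*Q_Tx_T+\tfrac12(x_T-S_Tz_T)^*\bar Q_T(x_T-S_Tz_T)\Big].$$ **Theorem.** For every admissible $v$ the state process exists and is unique up to indistinguishability, and $J(v)$ is finite. There is an optimal control $u\in L^2_{\mathcal F}(0,T;\mathbb R^m)$, i.e. $J(u)\le J(v)$ for all admissible $v$, and it is unique up to $dt\otimes d\mathbb P$-null sets. Moreover there exist a process $y$ (with continuous paths, adapted up to null sets), a (not necessarily adapted) process $\omega$ with continuous paths, and $p\in L^2_{\mathcal F}(0,T;\mathbb R^n)$ satisfying $$\left\{\begin{aligned} dy_t&=(A_ty_t-B_tR_t^{-1}B_t^*p_t+\bar A_tz_t)\,dt+\sigma_t\,dW_t,\qquad y_0=x_0,\\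 -\frac{d\omega_t}{dt}&=A_t^*\omega_t+(Q_t+\bar Q_t)y_t-(\bar Q_tS_t)z_t,\\ \omega_T&=(Q_T+\bar Q_T)y_T-(\bar Q_TS_T)z_T,\\ p_t&=\mathbb E[\omega_t\mid\mathcal F_t]\ \text{ for every } t\in[0,T], \end{aligned}\right.$$ where $\omega_t$ is integrable for every $t$ and the two differential equations are understood in integrated form, almost surely for all $t\in[0,T]$; and for every such triple $(y,\omega,p)$, $y$ is the state process of $u$ and $u=-R^{-1}B^*p$ holds $dt\otimes d\mathbb P$-almost everywhere. -/

import Mathlib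

open MeasureTheory ProbabilityTheory Set Filter Topology
open scoped NNReal ENNReal Matrix

noncomputable section

namespace LQ

/-- Deterministic data of the linear-quadratic control problem on the time interval `[0, T]`, with
state space `ℝⁿ` and control space `ℝᵐ`. The terminal weights are the values `Q T`, `Qbar T`, `S T`
of the weight functions at time `T`, and `z` is the given deterministic path. -/
structure Data (n m : ℕ) where
  T : ℝ
  A : ℝ → Matrix (Fin n) (Fin n) ℝ
  B : ℝ → Matrix (Fin n) (Fin m) ℝ
  Abar : ℝ → Matrix (Fin n) (Fin n) ℝ
  σ : ℝ → Matrix (Fin n) (Fin n) ℝ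
  Q : ℝ → Matrix (Fin n) (Fin n) ℝ
  Qbar : ℝ → Matrix (Fin n) (Fin n) ℝ
  R : ℝ → Matrix (Fin m) (Fin m) ℝ
  S : ℝ → Matrix (Fin n) (Fin n) ℝ
  z : ℝ → Fin n → ℝ

/-- A (Lebesgue) measurable bounded matrix-valued function on `[0, T]`. -/
structure IsBoundedCoeff {k l : ℕ} (T : ℝ) (M : ℝ → Matrix (Fin k) (Fin l) ℝ) : Prop where
  aemeasurable : ∀ i j, AEMeasurable (fun t => M t i j) (volume.restrict (Icc 0 T))
  bounded : ∃ C : ℝ, ∀ t ∈ Icc 0 T, ∀ i j, |M t i j| ≤ C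

/-- Standing assumptions on the deterministic data. (`Matrix.PosSemidef` includes symmetry.) -/
structure Data.Standing {n m : ℕ} (D : Data n m) : Prop where
  T_pos : 0 < D.T
  A_bdd : IsBoundedCoeff D.T D.A
  B_bdd : IsBoundedCoeff D.T D.B
  Abar_bdd : IsBoundedCoeff D.T D.Abar
  Q_bdd : IsBoundedCoeff D.T D.Q
  Qbar_bdd : IsBoundedCoeff D.T D.Qbar
  R_bdd : IsBoundedCoeff D.T D.R
  S_bdd : IsBoundedCoeff D.T D.S
  σ_memLp : ∀ i j, MemLp (fun t => D.σ t i j) 2 (volume.restrict (Icc 0 D.T))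
  Q_nonneg : ∀ t ∈ Icc 0 D.T, (D.Q t).PosSemidef
  Qbar_nonneg : ∀ t ∈ Icc 0 D.T, (D.Qbar t).PosSemidef
  R_coercive : ∃ δ : ℝ, 0 < δ ∧ ∀ t ∈ Icc 0 D.T,
    (D.R t - δ • (1 : Matrix (Fin m) (Fin m) ℝ)).PosSemidef
  z_cont : ContinuousOn D.z (Icc 0 D.T)

section Probability

variable {n m : ℕ} {Ω : Type*} [mΩ : MeasurableSpace Ω]

/-- An `n`-dimensional standard Wiener process: its components are independent real Brownian
motions. -/
structure IsWienerProcess (W : ℝ≥0 → Ω → Fin n → ℝ) (P : Measure Ω) : Prop where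
  measurable : ∀ t, Measurable (W t)
  brownian : ∀ i, IsBrownianReal (fun t ω => W t ω i) P
  indep : iIndepFun (fun (i : Fin n) (ω : Ω) (t : ℝ≥0) => W t ω i) P

/-- The σ-algebra `ℱ_t = σ(x₀, W_s : s ≤ t)`. -/
@[reducible] def history (x₀ : Ω → Fin n → ℝ) (W : ℝ≥0 → Ω → Fin n → ℝ) (t : ℝ) : MeasurableSpace Ω :=
  MeasurableSpace.comap x₀ inferInstance ⊔
    ⨆ (s : ℝ≥0) (_ : (s : ℝ) ≤ t), MeasurableSpace.comap (W s) inferInstance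

/-- `v ∈ L²_ℱ(0, T; ℝᵏ)`: a square integrable process on `[0, T] × Ω` adapted to `ℱ`. -/
structure MemL2F {k : ℕ} (T : ℝ) (x₀ : Ω → Fin n → ℝ) (W : ℝ≥0 → Ω → Fin n → ℝ) (P : Measure Ω)
    (v : ℝ → Ω → Fin k → ℝ) : Prop where
  adapted : ∀ t ∈ Icc 0 T, StronglyMeasurable[history x₀ W t] (v t)
  memLp : MemLp (Function.uncurry v) 2 ((volume.restrict (Icc 0 T)).prod P)

/-- Data of a deterministic matrix-valued step function, equal to `c k` on `(τ k, τ (k+1)]` for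
`k < N` and to `0` elsewhere. -/
structure StepFn (n : ℕ) where
  N : ℕ
  τ : ℕ → ℝ≥0
  mono : Monotone τ
  c : ℕ → Matrix (Fin n) (Fin n) ℝ

/-- The value at time `s` of a step function. -/
def StepFn.eval (φ : StepFn n) (s : ℝ) : Matrix (Fin n) (Fin n) ℝ :=
  ∑ k ∈ Finset.range φ.N, (Ioc (φ.τ k : ℝ) (φ.τ (k + 1) : ℝ)).indicator (fun _ => φ.c k) s

/-- The elementary integral `∫₀ᵗ φ dW` of a step function. -/
def StepFn.integral (φ : StepFn n) (W : ℝ≥0 → Ω → Fin n → ℝ) (t : ℝ≥0) (ω : Ω) : Fin n → ℝ :=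
  ∑ k ∈ Finset.range φ.N, φ.c k *ᵥ (W (min (φ.τ (k + 1)) t) ω - W (min (φ.τ k) t) ω)

/-- `M_t` is (a version of) the Wiener integral `∫₀ᵗ σ dW` for every `t ∈ [0, T]`: it is the limit
in `L²(Ω)` of the elementary integrals of step functions which converge to `σ` in `L²(0, T)`. -/
def IsWienerIntegral (T : ℝ) (σ : ℝ → Matrix (Fin n) (Fin n) ℝ) (W : ℝ≥0 → Ω → Fin n → ℝ)
    (P : Measure Ω) (M : ℝ → Ω → Fin n → ℝ) : Prop :=
  (∀ t ∈ Icc 0 T, AEStronglyMeasurable (M t) P) ∧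
  ∃ φ : ℕ → StepFn n,
    (∀ i j, Tendsto
      (fun k => eLpNorm (fun s => (φ k).eval s i j - σ s i j) 2 (volume.restrict (Icc 0 T)))
      atTop (𝓝 0)) ∧
    ∀ t ∈ Icc 0 T, Tendsto
      (fun k => eLpNorm (fun ω => (φ k).integral W t.toNNReal ω - M t ω) 2 P) atTop (𝓝 0)

variable (D : Data n m) (x₀ : Ω → Fin n → ℝ) (W : ℝ≥0 → Ω → Fin n → ℝ) (P : Measure Ω)

/-- `x` is the state process controlled by `v`, that is, a solution with continuous paths, adapted
to `ℱ` up to null sets, of `dx = (A x + B v + Abar z) dt + σ dW`, `x(0) = x₀`. -/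
structure IsState (v : ℝ → Ω → Fin m → ℝ) (x : ℝ → Ω → Fin n → ℝ) : Prop where
  adapted : ∀ t ∈ Icc 0 D.T, AEStronglyMeasurable[history x₀ W t] (x t) P
  cont : ∀ᵐ ω ∂P, ContinuousOn (fun t => x t ω) (Icc 0 D.T)
  eqn : ∃ M : ℝ → Ω → Fin n → ℝ, IsWienerIntegral D.T D.σ W P M ∧
    ∀ᵐ ω ∂P, ∀ t ∈ Icc 0 D.T,
      x t ω = x₀ ω + (∫ s in (0 : ℝ)..t, (D.A s *ᵥ x s ω + D.B s *ᵥ v s ω + D.Abar s *ᵥ D.z s))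
        + M t ω

/-- The running cost at time `t`, state `x`, control `v`. -/
def runningCost (t : ℝ) (x : Fin n → ℝ) (v : Fin m → ℝ) : ℝ :=
  (1 / 2) * (x ⬝ᵥ (D.Q t *ᵥ x) + v ⬝ᵥ (D.R t *ᵥ v)
    + (x - D.S t *ᵥ D.z t) ⬝ᵥ (D.Qbar t *ᵥ (x - D.S t *ᵥ D.z t)))

/-- The terminal cost at state `x`. -/
def terminalCost (x : Fin n → ℝ) : ℝ :=
  (1 / 2) * (x ⬝ᵥ (D.Q D.T *ᵥ x))
    + (1 / 2) * ((x - D.S D.T *ᵥ D.z D.T) ⬝ᵥ (D.Qbar D.T *ᵥ (x - D.S D.T *ᵥ D.z D.T)))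

/-- The cost of the control `v` with state process `x`. -/
def cost (v : ℝ → Ω → Fin m → ℝ) (x : ℝ → Ω → Fin n → ℝ) : ℝ :=
  (∫ ω, (∫ t in (0 : ℝ)..D.T, runningCost D t (x t ω) (v t ω)) ∂P)
    + ∫ ω, terminalCost D (x D.T ω) ∂P

/-- The cost of the control `v` with state process `x` is a finite, genuine expectation. -/
def CostFinite (v : ℝ → Ω → Fin m → ℝ) (x : ℝ → Ω → Fin n → ℝ) : Prop :=
  Integrable (fun q : ℝ × Ω => runningCost D q.1 (x q.1 q.2) (v q.1 q.2))
      ((volume.restrict (Icc 0 D.T)).prod P) ∧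
    Integrable (fun ω => terminalCost D (x D.T ω)) P

/-- `u` is an optimal control: it is admissible and minimizes the cost among all admissible
controls. -/
def IsOptimal (u : ℝ → Ω → Fin m → ℝ) : Prop :=
  MemL2F D.T x₀ W P u ∧ ∃ y, IsState D x₀ W P u y ∧
    ∀ v x, MemL2F D.T x₀ W P v → IsState D x₀ W P v x → cost D P u y ≤ cost D P v x

/-- The process `-R⁻¹ B* p`. -/
def feedback (p : ℝ → Ω → Fin n → ℝ) (t : ℝ) (ω : Ω) : Fin m → ℝ :=
  -((D.R t)⁻¹ *ᵥ ((D.B t)ᵀ *ᵥ p t ω))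

/-- `w` solves pathwise the backward adjoint equation
`-dw/dt = A* w + (Q + Qbar) y - Qbar S z`, `w_T = (Q_T + Qbar_T) y_T - Qbar_T S_T z_T`. -/
structure IsAdjoint (y w : ℝ → Ω → Fin n → ℝ) : Prop where
  cont : ∀ᵐ ω ∂P, ContinuousOn (fun t => w t ω) (Icc 0 D.T)
  eqn : ∀ᵐ ω ∂P, ∀ t ∈ Icc 0 D.T,
    w t ω = ((D.Q D.T + D.Qbar D.T) *ᵥ y D.T ω - (D.Qbar D.T * D.S D.T) *ᵥ D.z D.T)
      + ∫ s in t..D.T, ((D.A s)ᵀ *ᵥ w s ω + (D.Q s + D.Qbar s) *ᵥ y s ω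
          - (D.Qbar s * D.S s) *ᵥ D.z s)

/-- The stochastic maximum principle relation for `(y, p)` with adjoint process `w`. -/
structure IsMaxPrinciple (y w p : ℝ → Ω → Fin n → ℝ) : Prop where
  p_mem : MemL2F D.T x₀ W P p
  state : IsState D x₀ W P (feedback D p) y
  adjoint : IsAdjoint D P y w
  integrable : ∀ t ∈ Icc 0 D.T, Integrable (w t) P
  condExp : ∀ t ∈ Icc 0 D.T, p t =ᵐ[P] P[w t | history x₀ W t]

end Probability

end LQ

end

/-!
The cost is a coercive quadratic functional on the Hilbert space `L²_ℱ(0, T; ℝᵐ)`, so it has exactly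
one minimizer, and the maximum principle is the vanishing of its gradient there.

*State.* The noise is additive, so after subtraction of a continuous version `M` of `∫ σ dW` the state
equation becomes, path by path, a linear differential equation with bounded measurable coefficients.
`exists_linear_solution` solves such equations by the Peano-Baker series, and variation of constants
(`IsFundamental.eq_duhamel`) gives existence, uniqueness and `L²` bounds of the state at once
(`LQ.IsFrame.ae_eq_stateMap`, `LQ.IsFrame.isState_stateMap`). The process `M` is constructed in
`LQ.exists_continuous_wienerIntegral` from the isometry for step functions and Doob's maximal
inequality; that it does not depend on the approximating step functions is
`LQ.IsWienerIntegral.ae_eq`.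

*Cost.* The difference `ξ` of the states of `v` and `u` is linear in `h = v - u`. Integration by parts
between `ξ` and the adjoint process `w` of `u` turns all terms which are linear in `ξ` into terms
which are linear in `h`, and gives the exact expansion (`LQ.IsFrame.cost_eq_add`)
`J v = J u + E ∫ h · (R u + B* w) dt + q h / 2` with a quadratic form `q h ≥ δ E ∫ |h|² dt`.
The parallelogram identity which follows makes minimizing sequences Cauchy, whence a minimizer
(`LQ.IsFrame.exists_minimizer`).

*Maximum principle.* The direction `h` is adapted, so `w` may be replaced by its conditional
expectations `p` in the linear term (`LQ.IsFrame.firstVariation_eq_of_condExp`). Then `R u + B* p` is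
itself an admissible direction, so it vanishes at a minimizer, which means `u = -R⁻¹ B* p`.
Conversely the linear term vanishes for every solution of the system, and the expansion shows that
`-R⁻¹ B* p` is optimal and agrees with every optimal control.

A delicate point is that `p` has to be a version of `E[w_t | ℱ_t]` at every time which is jointly
measurable and strictly adapted to a filtration that is neither right-continuous nor complete. By
variation of constants `w_t` is a deterministic matrix applied to the sum of a fixed random vector `η`
and a continuous adapted process, so only the martingale `E[η | ℱ_t]` matters. Its second moment is
monotone in time, so it has at most countably many jumps, and at all other times the martingale is
the limit of its values at dyadic times from the left (`ae_tendsto_condExp_dyadicFloor`).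
-/

/-! ### Absolutely continuous functions in integrated form -/

/-- `F` is absolutely continuous on `[0, T]` with almost everywhere derivative `f`, in integrated
form. -/
structure IsPrimitive (T : ℝ) (F f : ℝ → ℝ) : Prop where
  integrableOn : IntegrableOn f (Icc 0 T)
  eq_add_integral : ∀ t ∈ Icc 0 T, F t = F 0 + ∫ s in (0 : ℝ)..t, f s

namespace IsPrimitive

variable {T : ℝ} {F G f g : ℝ → ℝ}

lemma intervalIntegrable (h : IsPrimitive T F f) {t : ℝ} (ht : t ∈ Icc 0 T) :
    IntervalIntegrable f volume 0 t :=
  (intervalIntegrable_iff_integrableOn_Icc_of_le ht.1).2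
    (h.integrableOn.mono_set (Icc_subset_Icc le_rfl ht.2))

lemma of_integral (hf : IntegrableOn f (Icc 0 T)) (c : ℝ) :
    IsPrimitive T (fun t => c + ∫ s in (0 : ℝ)..t, f s) f :=
  ⟨hf, fun t _ => by simp⟩

lemma congr (h : IsPrimitive T F f) (hT : 0 ≤ T) (hFG : ∀ t ∈ Icc 0 T, F t = G t)
    (hfg : ∀ t ∈ Icc 0 T, f t = g t) : IsPrimitive T G g := by
  refine ⟨h.integrableOn.congr_fun hfg measurableSet_Icc, fun t ht => ?_⟩
  rw [← hFG t ht, ← hFG 0 ⟨le_rfl, hT⟩, h.eq_add_integral t ht]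
  congr 1
  refine intervalIntegral.integral_congr fun s hs => hfg s ?_
  rw [uIcc_of_le ht.1] at hs
  exact ⟨hs.1, hs.2.trans ht.2⟩

lemma continuousOn (h : IsPrimitive T F f) : ContinuousOn F (Icc 0 T) := by
  rcases lt_or_ge T 0 with hT | hT
  · simp [Icc_eq_empty_of_lt hT]
  have h1 : ContinuousOn (fun t => F 0 + ∫ s in (0 : ℝ)..t, f s) (Icc 0 T) := by
    refine continuousOn_const.add ?_
    have := intervalIntegral.continuousOn_primitive_interval (μ := volume) (f := f) (a := 0)
      (b := T) (by rw [uIcc_of_le hT]; exact h.integrableOn)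
    rwa [uIcc_of_le hT] at this
  exact h1.congr h.eq_add_integral

lemma add (hF : IsPrimitive T F f) (hG : IsPrimitive T G g) :
    IsPrimitive T (fun t => F t + G t) (fun t => f t + g t) := by
  refine ⟨hF.integrableOn.add hG.integrableOn, fun t ht => ?_⟩
  rw [intervalIntegral.integral_add (hF.intervalIntegrable ht) (hG.intervalIntegrable ht),
    hF.eq_add_integral t ht, hG.eq_add_integral t ht]
  ring

lemma neg (hF : IsPrimitive T F f) : IsPrimitive T (fun t => -F t) (fun t => -f t) := by
  refine ⟨hF.integrableOn.neg, fun t ht => ?_⟩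
  rw [intervalIntegral.integral_neg, hF.eq_add_integral t ht]
  ring

lemma sum {ι : Type*} (s : Finset ι) {F f : ι → ℝ → ℝ} (h : ∀ i ∈ s, IsPrimitive T (F i) (f i)) :
    IsPrimitive T (fun t => ∑ i ∈ s, F i t) (fun t => ∑ i ∈ s, f i t) := by
  refine ⟨integrable_finsetSum _ fun i hi => (h i hi).integrableOn, fun t ht => ?_⟩
  rw [intervalIntegral.integral_finsetSum fun i hi => (h i hi).intervalIntegrable ht,
    ← Finset.sum_add_distrib]
  exact Finset.sum_congr rfl fun i hi => (h i hi).eq_add_integral t ht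

lemma absolutelyContinuousOnInterval (hF : IsPrimitive T F f) {t : ℝ} (ht : t ∈ Icc 0 T) :
    AbsolutelyContinuousOnInterval (fun x => F 0 + ∫ s in (0 : ℝ)..x, f s) 0 t := by
  have h1 := (hF.intervalIntegrable ht).absolutelyContinuousOnInterval_intervalIntegral
    (c := 0) (by simp)
  have h2 : AbsolutelyContinuousOnInterval (fun _ : ℝ => F 0) 0 t :=
    LipschitzOnWith.absolutelyContinuousOnInterval (K := 0) (by
      intro x _ y _; simp)
  exact h2.add h1

/-- The product rule, by integration by parts for absolutely continuous functions. -/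
lemma mul (hF : IsPrimitive T F f) (hG : IsPrimitive T G g) :
    IsPrimitive T (fun t => F t * G t) (fun t => f t * G t + F t * g t) := by
  have hi1 : IntegrableOn (fun t => f t * G t) (Icc 0 T) :=
    hF.integrableOn.mul_continuousOn hG.continuousOn isCompact_Icc
  have hi2 : IntegrableOn (fun t => F t * g t) (Icc 0 T) :=
    hG.integrableOn.continuousOn_mul hF.continuousOn isCompact_Icc
  refine ⟨hi1.add hi2, fun t ht => ?_⟩
  have h0 : (0 : ℝ) ∈ Icc 0 T := ⟨le_rfl, ht.1.trans ht.2⟩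
  have key := (hF.absolutelyContinuousOnInterval ht).integral_deriv_mul_eq_sub
    (hG.absolutelyContinuousOnInterval ht)
  have hFd := (hF.intervalIntegrable ht).ae_hasDerivAt_integral
  have hGd := (hG.intervalIntegrable ht).ae_hasDerivAt_integral
  simp only [← hF.eq_add_integral t ht, ← hG.eq_add_integral t ht,
    intervalIntegral.integral_same, add_zero] at key
  rw [← sub_eq_iff_eq_add', ← key]
  refine intervalIntegral.integral_congr_ae ?_
  filter_upwards [hFd, hGd] with s hs1 hs2 hs
  have hs' := uIoc_subset_uIcc hs
  have d1 := ((hs1 hs' 0 (by simp)).const_add (F 0)).deriv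
  have d2 := ((hs2 hs' 0 (by simp)).const_add (G 0)).deriv
  rw [uIcc_of_le ht.1] at hs'
  have hsT : s ∈ Icc 0 T := ⟨hs'.1, hs'.2.trans ht.2⟩
  rw [d1, d2, ← hF.eq_add_integral s hsT, ← hG.eq_add_integral s hsT]

end IsPrimitive

/-! ### Linear differential equations with bounded measurable coefficients -/

namespace LQ.IsBoundedCoeff

variable {k l m : ℕ} {T : ℝ} {M N : ℝ → Matrix (Fin k) (Fin l) ℝ}

lemma exists_pos_bound (h : IsBoundedCoeff T M) :
    ∃ C : ℝ, 0 < C ∧ ∀ t ∈ Icc 0 T, ∀ i j, |M t i j| ≤ C := by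
  obtain ⟨C, hC⟩ := h.bounded
  exact ⟨max C 1, by positivity, fun t ht i j => (hC t ht i j).trans (le_max_left _ _)⟩

lemma transpose (h : IsBoundedCoeff T M) : IsBoundedCoeff T (fun t => (M t)ᵀ) :=
  ⟨fun i j => h.aemeasurable j i, h.bounded.imp fun _ hC t ht i j => hC t ht j i⟩

lemma neg (h : IsBoundedCoeff T M) : IsBoundedCoeff T (fun t => -M t) :=
  ⟨fun i j => (h.aemeasurable i j).neg, h.bounded.imp fun _ hC t ht i j => by
    simpa using hC t ht i j⟩

lemma add (hM : IsBoundedCoeff T M) (hN : IsBoundedCoeff T N) :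
    IsBoundedCoeff T (fun t => M t + N t) := by
  refine ⟨fun i j => (hM.aemeasurable i j).add (hN.aemeasurable i j), ?_⟩
  obtain ⟨C, hC⟩ := hM.bounded
  obtain ⟨K, hK⟩ := hN.bounded
  exact ⟨C + K, fun t ht i j => (abs_add_le _ _).trans (add_le_add (hC t ht i j) (hK t ht i j))⟩

lemma mul {N : ℝ → Matrix (Fin l) (Fin m) ℝ} (hM : IsBoundedCoeff T M) (hN : IsBoundedCoeff T N) :
    IsBoundedCoeff T (fun t => M t * N t) := by
  constructor
  · intro i j
    simp only [Matrix.mul_apply]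
    exact Finset.aemeasurable_fun_sum _ fun r _ => (hM.aemeasurable i r).mul (hN.aemeasurable r j)
  · obtain ⟨C, hC0, hC⟩ := hM.exists_pos_bound
    obtain ⟨K, hK⟩ := hN.bounded
    refine ⟨∑ _r : Fin l, C * K, fun t ht i j => ?_⟩
    rw [Matrix.mul_apply]
    refine (Finset.abs_sum_le_sum_abs _ _).trans (Finset.sum_le_sum fun r _ => ?_)
    rw [abs_mul]
    exact mul_le_mul (hC t ht i r) (hK t ht r j) (abs_nonneg _) hC0.le

lemma of_continuousOn (h : ∀ i j, ContinuousOn (fun t => M t i j) (Icc 0 T)) :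
    IsBoundedCoeff T M := by
  constructor
  · exact fun i j => (h i j).aemeasurable measurableSet_Icc
  · have : ∀ i j, ∃ C : ℝ, 0 ≤ C ∧ ∀ t ∈ Icc 0 T, |M t i j| ≤ C := fun i j => by
      obtain ⟨C, hC⟩ := isCompact_Icc.exists_bound_of_continuousOn (h i j)
      exact ⟨max C 0, le_max_right _ _, fun t ht => (hC t ht).trans (le_max_left _ _)⟩
    choose C hC0 hC using this
    refine ⟨∑ i, ∑ j, C i j, fun t ht i j => (hC i j t ht).trans ?_⟩
    exact (Finset.single_le_sum (fun j _ => hC0 i j) (Finset.mem_univ j)).trans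
      (Finset.single_le_sum (f := fun i => ∑ j, C i j)
        (fun i _ => Finset.sum_nonneg fun j _ => hC0 i j) (Finset.mem_univ i))

/-- A bounded coefficient maps integrable vector functions to integrable ones. -/
lemma integrableOn_mulVec (h : IsBoundedCoeff T M) {f : ℝ → Fin l → ℝ}
    (hf : ∀ j, IntegrableOn (fun t => f t j) (Icc 0 T)) (i : Fin k) :
    IntegrableOn (fun t => (M t *ᵥ f t) i) (Icc 0 T) := by
  obtain ⟨C, -, hC⟩ := h.exists_pos_bound
  simp only [Matrix.mulVec, dotProduct]
  refine integrable_finsetSum _ fun j _ => ?_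
  refine (hf j).bdd_mul (h.aemeasurable i j).aestronglyMeasurable (c := C) ?_
  filter_upwards [ae_restrict_mem measurableSet_Icc] with t ht using hC t ht i j

end LQ.IsBoundedCoeff

/-- The Peano–Baker iterates of the linear equation `ζ' = A ζ`, `ζ 0 = e`: their sum is the
solution. -/
noncomputable def peanoBaker {n : ℕ} (A : ℝ → Matrix (Fin n) (Fin n) ℝ) (e : Fin n → ℝ) :
    ℕ → ℝ → Fin n → ℝ
  | 0 => fun _ => e
  | k + 1 => fun t i => ∫ s in (0 : ℝ)..t, (A s *ᵥ peanoBaker A e k s) i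

section LinearODE

variable {n : ℕ} {T : ℝ} {A : ℝ → Matrix (Fin n) (Fin n) ℝ}

lemma continuousOn_peanoBaker (hA : LQ.IsBoundedCoeff T A) (e : Fin n → ℝ) (k : ℕ)
    (i : Fin n) : ContinuousOn (fun t => peanoBaker A e k t i) (Icc 0 T) := by
  induction k generalizing i with
  | zero => exact continuousOn_const
  | succ k ih =>
    have h := hA.integrableOn_mulVec (f := peanoBaker A e k)
      (fun j => (ih j).integrableOn_Icc) i
    simpa [peanoBaker] using (IsPrimitive.of_integral h 0).continuousOn

lemma integrableOn_mulVec_peanoBaker (hA : LQ.IsBoundedCoeff T A) (e : Fin n → ℝ)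
    (k : ℕ) (i : Fin n) : IntegrableOn (fun t => (A t *ᵥ peanoBaker A e k t) i) (Icc 0 T) :=
  hA.integrableOn_mulVec (fun j => (continuousOn_peanoBaker hA e k j).integrableOn_Icc) i

lemma abs_mulVec_le {k l : ℕ} (M : Matrix (Fin k) (Fin l) ℝ) (x : Fin l → ℝ) {C K : ℝ}
    (hC : 0 ≤ C) (hM : ∀ i j, |M i j| ≤ C) (hx : ∀ j, |x j| ≤ K) (i : Fin k) :
    |(M *ᵥ x) i| ≤ l * C * K := by
  simp only [Matrix.mulVec, dotProduct]
  refine (Finset.abs_sum_le_sum_abs _ _).trans ?_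
  calc ∑ j, |M i j * x j| ≤ ∑ _j : Fin l, C * K := Finset.sum_le_sum fun j _ => by
        rw [abs_mul]; exact mul_le_mul (hM i j) (hx j) (abs_nonneg _) hC
    _ = l * C * K := by simp [mul_assoc]

lemma abs_peanoBaker_le {C E : ℝ} {e : Fin n → ℝ}
    (hC0 : 0 ≤ C) (hC : ∀ t ∈ Icc 0 T, ∀ i j, |A t i j| ≤ C) (hE : ∀ i, |e i| ≤ E) (k : ℕ) :
    ∀ t ∈ Icc 0 T, ∀ i, |peanoBaker A e k t i| ≤ E * ((n * C * t) ^ k / k.factorial) := by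
  induction k with
  | zero => intro t _ i; simpa [peanoBaker] using hE i
  | succ k ih =>
    intro t ht i
    have hbd : ∀ s ∈ Icc 0 T, |(A s *ᵥ peanoBaker A e k s) i|
        ≤ n * C * (E * ((n * C * s) ^ k / k.factorial)) := fun s hs =>
      abs_mulVec_le _ _ hC0 (hC s hs) (ih s hs) i
    have hgi : IntervalIntegrable (fun s : ℝ => n * C * (E * ((n * C * s) ^ k / k.factorial)))
        volume 0 t := Continuous.intervalIntegrable (by fun_prop) _ _
    calc |peanoBaker A e (k + 1) t i|
        ≤ ∫ s in (0 : ℝ)..t, n * C * (E * ((n * C * s) ^ k / k.factorial)) := by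
          rw [← Real.norm_eq_abs, peanoBaker]
          refine intervalIntegral.norm_integral_le_of_norm_le
            ht.1 (Eventually.of_forall ?_) hgi
          intro s hs
          exact hbd s ⟨hs.1.le, hs.2.trans ht.2⟩
      _ = E * ((n * C * t) ^ (k + 1) / (k + 1).factorial) := by
          simp only [mul_pow, intervalIntegral.integral_const_mul, mul_div_assoc,
            intervalIntegral.integral_div, integral_pow, Nat.factorial_succ, Nat.cast_mul]
          have : (k.factorial : ℝ) ≠ 0 := by positivity
          push_cast
          field_simp
          simp [pow_succ]
          ring

/-- Existence for linear equations with bounded measurable coefficients. -/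
lemma exists_linear_solution (hT : 0 ≤ T) (hA : LQ.IsBoundedCoeff T A) (e : Fin n → ℝ) :
    ∃ ζ : ℝ → Fin n → ℝ, ζ 0 = e ∧
      ∀ i, IsPrimitive T (fun t => ζ t i) (fun t => (A t *ᵥ ζ t) i) := by
  obtain ⟨C, hC0, hC⟩ := hA.exists_pos_bound
  have hE : ∀ i, |e i| ≤ ∑ i, |e i| := fun i =>
    Finset.single_le_sum (f := fun i => |e i|) (fun j _ => abs_nonneg _) (Finset.mem_univ i)
  set E := ∑ i, |e i|
  have hE0 : 0 ≤ E := Finset.sum_nonneg fun i _ => abs_nonneg _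
  have hsummable : Summable fun k : ℕ => E * ((n * C * T) ^ k / k.factorial) :=
    (Real.summable_pow_div_factorial _).mul_left _
  have hbd : ∀ k, ∀ t ∈ Icc 0 T, ∀ i,
      |peanoBaker A e k t i| ≤ E * ((n * C * T) ^ k / k.factorial) := fun k t ht i => by
    refine (abs_peanoBaker_le hC0.le hC hE k t ht i).trans ?_
    have := ht.1
    have := ht.2
    gcongr
  have hs : ∀ t ∈ Icc 0 T, ∀ i, Summable fun k => peanoBaker A e k t i := fun t ht i =>
    Summable.of_norm_bounded hsummable fun k => hbd k t ht i
  let ζ : ℝ → Fin n → ℝ := fun t i => ∑' k, peanoBaker A e k t i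
  have hAζ : ∀ t ∈ Icc 0 T, ∀ i,
      HasSum (fun k => (A t *ᵥ peanoBaker A e k t) i) ((A t *ᵥ ζ t) i) := fun t ht i => by
    simp only [Matrix.mulVec, dotProduct]
    exact hasSum_sum fun j _ => (hs t ht j).hasSum.mul_left _
  have hint : ∀ t ∈ Icc 0 T, ∀ i, HasSum (fun k => peanoBaker A e (k + 1) t i)
      (∫ s in (0 : ℝ)..t, (A s *ᵥ ζ s) i) := fun t ht i => by
    have hsub : ∀ s ∈ uIoc 0 t, s ∈ Icc 0 T := fun s hs => by
      rw [uIoc_of_le ht.1] at hs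
      exact ⟨hs.1.le, hs.2.trans ht.2⟩
    refine intervalIntegral.hasSum_integral_of_dominated_convergence
      (fun k _ => n * C * (E * ((n * C * T) ^ k / k.factorial))) (fun k => ?_) (fun k => ?_) ?_ ?_ ?_
    · exact ((integrableOn_mulVec_peanoBaker hA e k i).mono_set hsub).aestronglyMeasurable
    · exact Eventually.of_forall fun s hs =>
        abs_mulVec_le _ _ hC0.le (hC s (hsub s hs)) (hbd k s (hsub s hs)) i
    · exact Eventually.of_forall fun s _ => hsummable.mul_left _
    · simp
    · exact Eventually.of_forall fun s hs => hAζ s (hsub s hs) i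
  have hζ : ∀ t ∈ Icc 0 T, ∀ i, ζ t i = e i + ∫ s in (0 : ℝ)..t, (A s *ᵥ ζ s) i :=
    fun t ht i => by
      have := (hs t ht i).tsum_eq_zero_add
      rw [(hint t ht i).tsum_eq] at this
      exact this
  have h0 : ζ 0 = e := by
    ext i
    simpa using hζ 0 ⟨le_rfl, hT⟩ i
  have hmeas : ∀ i, IntegrableOn (fun t => ζ t i) (Icc 0 T) := fun i => by
    refine Integrable.of_bound (C := ∑' k : ℕ, E * ((n * C * T) ^ k / k.factorial)) ?_ ?_
    · refine aestronglyMeasurable_of_tendsto_ae atTop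
        (f := fun N t => ∑ k ∈ Finset.range N, peanoBaker A e k t i) (fun N => ?_) ?_
      · exact Finset.aestronglyMeasurable_fun_sum _ fun k _ =>
          (continuousOn_peanoBaker hA e k i).aestronglyMeasurable measurableSet_Icc
      · filter_upwards [ae_restrict_mem measurableSet_Icc] with t ht
        exact (hs t ht i).hasSum.tendsto_sum_nat
    · filter_upwards [ae_restrict_mem measurableSet_Icc] with t ht
      exact tsum_of_norm_bounded hsummable.hasSum fun k => hbd k t ht i
  refine ⟨ζ, h0, fun i => ⟨hA.integrableOn_mulVec hmeas i, fun t ht => ?_⟩⟩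
  rw [h0]
  exact hζ t ht i

end LinearODE

/-! ### Fundamental matrices and variation of constants -/

namespace IsPrimitive

variable {k l : ℕ} {T : ℝ}

lemma dotProduct {F G f g : ℝ → Fin l → ℝ}
    (hF : ∀ j, IsPrimitive T (fun t => F t j) (fun t => f t j))
    (hG : ∀ j, IsPrimitive T (fun t => G t j) (fun t => g t j)) :
    IsPrimitive T (fun t => F t ⬝ᵥ G t) (fun t => f t ⬝ᵥ G t + F t ⬝ᵥ g t) := by
  simpa only [_root_.dotProduct, ← Finset.sum_add_distrib] using
    IsPrimitive.sum Finset.univ fun j _ => (hF j).mul (hG j)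

lemma mulVec {M M' : ℝ → Matrix (Fin k) (Fin l) ℝ} {G g : ℝ → Fin l → ℝ}
    (hM : ∀ i j, IsPrimitive T (fun t => M t i j) (fun t => M' t i j))
    (hG : ∀ j, IsPrimitive T (fun t => G t j) (fun t => g t j)) (i : Fin k) :
    IsPrimitive T (fun t => (M t *ᵥ G t) i) (fun t => (M' t *ᵥ G t + M t *ᵥ g t) i) :=
  IsPrimitive.dotProduct (hM i) hG

end IsPrimitive

/-- `Φ` is the fundamental matrix of `ζ' = A ζ` on `[0, T]` normalized at time `0`, and `Ψ` is the
solution of `Ψ' = -Ψ A`, `Ψ 0 = 1`, which turns out to be its inverse. -/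
structure IsFundamental {n : ℕ} (T : ℝ) (A Φ Ψ : ℝ → Matrix (Fin n) (Fin n) ℝ) : Prop where
  fwd_zero : Φ 0 = 1
  inv_zero : Ψ 0 = 1
  fwd : ∀ i j, IsPrimitive T (fun t => Φ t i j) (fun t => (A t * Φ t) i j)
  inv : ∀ i j, IsPrimitive T (fun t => Ψ t i j) (fun t => (-(Ψ t * A t)) i j)

/-- `ζ` solves `ζ' = A ζ + f` on `[0, T]` in integrated form. -/
def IsLinearSolution {n : ℕ} (T : ℝ) (A : ℝ → Matrix (Fin n) (Fin n) ℝ) (f ζ : ℝ → Fin n → ℝ) :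
    Prop :=
  ∀ i, IsPrimitive T (fun t => ζ t i) (fun t => (A t *ᵥ ζ t + f t) i)

/-- The variation of constants formula `Φ t (c + ∫₀ᵗ Ψ f)`. -/
noncomputable def duhamel {n : ℕ} (Φ Ψ : ℝ → Matrix (Fin n) (Fin n) ℝ) (c : Fin n → ℝ)
    (f : ℝ → Fin n → ℝ) (t : ℝ) : Fin n → ℝ :=
  Φ t *ᵥ (c + fun j => ∫ s in (0 : ℝ)..t, (Ψ s *ᵥ f s) j)

section Fundamental

variable {n : ℕ} {T : ℝ} {A : ℝ → Matrix (Fin n) (Fin n) ℝ}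

lemma exists_isFundamental (hT : 0 ≤ T) (hA : LQ.IsBoundedCoeff T A) :
    ∃ Φ Ψ, IsFundamental T A Φ Ψ := by
  choose φ hφ0 hφ using fun j : Fin n => exists_linear_solution hT hA (Pi.single j 1)
  choose ψ hψ0 hψ using fun i : Fin n =>
    exists_linear_solution hT hA.transpose.neg (Pi.single i 1)
  refine ⟨fun t => Matrix.of fun i j => φ j t i, fun t => Matrix.of fun i j => ψ i t j,
    ?_, ?_, fun i j => ?_, fun i j => ?_⟩
  · ext i j
    simp [hφ0, Matrix.one_apply, Pi.single_apply]
  · ext i j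
    simp [hψ0, Matrix.one_apply, Pi.single_apply, eq_comm]
  · exact hφ j i
  · have h := hψ i j
    refine h.congr hT (fun t _ => rfl) fun t _ => ?_
    simp [Matrix.mulVec, dotProduct, Matrix.mul_apply, mul_comm]

namespace IsFundamental

variable {Φ Ψ : ℝ → Matrix (Fin n) (Fin n) ℝ}

lemma fwd_bdd (h : IsFundamental T A Φ Ψ) : LQ.IsBoundedCoeff T Φ :=
  .of_continuousOn fun i j => (h.fwd i j).continuousOn

lemma inv_bdd (h : IsFundamental T A Φ Ψ) : LQ.IsBoundedCoeff T Ψ :=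
  .of_continuousOn fun i j => (h.inv i j).continuousOn

lemma inv_mul_fwd (h : IsFundamental T A Φ Ψ) {t : ℝ} (ht : t ∈ Icc 0 T) : Ψ t * Φ t = 1 := by
  ext i j
  have hp := (IsPrimitive.mulVec h.inv (fun l => h.fwd l j) i).eq_add_integral t ht
  have hz : ∀ s, (-(Ψ s * A s) *ᵥ (fun l => Φ s l j) + Ψ s *ᵥ fun l => (A s * Φ s) l j) = 0 := by
    intro s
    have e : (fun l => (A s * Φ s) l j) = A s *ᵥ fun l => Φ s l j := rfl
    rw [e, Matrix.mulVec_mulVec, Matrix.neg_mulVec, neg_add_cancel]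
  simp only [hz, Pi.zero_apply, intervalIntegral.integral_zero, add_zero] at hp
  refine hp.trans ?_
  simp [h.fwd_zero, h.inv_zero]

lemma fwd_mul_inv (h : IsFundamental T A Φ Ψ) {t : ℝ} (ht : t ∈ Icc 0 T) : Φ t * Ψ t = 1 :=
  mul_eq_one_comm.1 (h.inv_mul_fwd ht)

/-- The fundamental matrix of the adjoint equation `ζ' = -A* ζ`. -/
lemma adjoint (h : IsFundamental T A Φ Ψ) (hT : 0 ≤ T) :
    IsFundamental T (fun t => -(A t)ᵀ) (fun t => (Ψ t)ᵀ) (fun t => (Φ t)ᵀ) := by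
  refine ⟨by simp [h.inv_zero], by simp [h.fwd_zero], fun i j => ?_, fun i j => ?_⟩
  · refine (h.inv j i).congr hT (fun t _ => rfl) fun t _ => ?_
    rw [Matrix.neg_mul, ← Matrix.transpose_mul]
    rfl
  · refine (h.fwd j i).congr hT (fun t _ => rfl) fun t _ => ?_
    rw [Matrix.mul_neg, neg_neg, ← Matrix.transpose_mul]
    rfl

lemma eq_duhamel (h : IsFundamental T A Φ Ψ) {f ζ : ℝ → Fin n → ℝ}
    (hζ : IsLinearSolution T A f ζ) {t : ℝ} (ht : t ∈ Icc 0 T) : ζ t = duhamel Φ Ψ (ζ 0) f t := by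
  have h1 : Ψ t *ᵥ ζ t = ζ 0 + fun j => ∫ s in (0 : ℝ)..t, (Ψ s *ᵥ f s) j := by
    ext i
    have hp := (IsPrimitive.mulVec h.inv hζ i).eq_add_integral t ht
    have hz : ∀ s, -(Ψ s * A s) *ᵥ ζ s + Ψ s *ᵥ (fun j => (A s *ᵥ ζ s + f s) j) = Ψ s *ᵥ f s := by
      intro s
      change -(Ψ s * A s) *ᵥ ζ s + Ψ s *ᵥ (A s *ᵥ ζ s + f s) = _
      rw [Matrix.mulVec_add, Matrix.mulVec_mulVec, Matrix.neg_mulVec, neg_add_cancel_left]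
    simp only [hz, h.inv_zero, Matrix.one_mulVec] at hp
    exact hp
  rw [duhamel, ← h1, Matrix.mulVec_mulVec, h.fwd_mul_inv ht, Matrix.one_mulVec]

lemma duhamel_zero (h : IsFundamental T A Φ Ψ) (c : Fin n → ℝ) (f : ℝ → Fin n → ℝ) :
    duhamel Φ Ψ c f 0 = c := by
  ext i
  simp [duhamel, h.fwd_zero]

lemma isLinearSolution_duhamel (h : IsFundamental T A Φ Ψ) (hT : 0 ≤ T) {f : ℝ → Fin n → ℝ}
    (hf : ∀ j, IntegrableOn (fun t => f t j) (Icc 0 T)) (c : Fin n → ℝ) :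
    IsLinearSolution T A f (duhamel Φ Ψ c f) := by
  intro i
  have hη : ∀ j, IsPrimitive T (fun t => (c + fun j => ∫ s in (0 : ℝ)..t, (Ψ s *ᵥ f s) j) j)
      (fun t => (Ψ t *ᵥ f t) j) := fun j =>
    IsPrimitive.of_integral (h.inv_bdd.integrableOn_mulVec hf j) (c j)
  refine (IsPrimitive.mulVec h.fwd hη i).congr hT (fun t _ => rfl) fun t ht => ?_
  simp only [duhamel]
  rw [Matrix.mulVec_mulVec, h.fwd_mul_inv ht, Matrix.one_mulVec, Matrix.mulVec_mulVec]

end IsFundamental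

end Fundamental

/-! ### Square integrable processes -/

/-- The largest dyadic number of level `N` which is at most `t` (for `t ≥ 0`). -/
noncomputable def dyadicFloor (N : ℕ) (t : ℝ) : ℝ := (⌊(2 : ℝ) ^ N * t⌋₊ : ℝ) / 2 ^ N

lemma dyadicFloor_nonneg (N : ℕ) (t : ℝ) : 0 ≤ dyadicFloor N t := by
  unfold dyadicFloor; positivity

lemma dyadicFloor_le (N : ℕ) {t : ℝ} (ht : 0 ≤ t) : dyadicFloor N t ≤ t := by
  rw [dyadicFloor, div_le_iff₀ (by positivity), mul_comm t]
  exact Nat.floor_le (by positivity)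

lemma dyadicFloor_mem {N : ℕ} {t T : ℝ} (ht : t ∈ Icc 0 T) : dyadicFloor N t ∈ Icc 0 T :=
  ⟨dyadicFloor_nonneg N t, (dyadicFloor_le N ht.1).trans ht.2⟩

lemma lt_dyadicFloor_add (N : ℕ) (t : ℝ) : t - (1 / 2) ^ N < dyadicFloor N t := by
  rw [dyadicFloor, lt_div_iff₀ (by positivity)]
  have h := Nat.lt_floor_add_one ((2 : ℝ) ^ N * t)
  have : (t - (1 / 2) ^ N) * 2 ^ N = 2 ^ N * t - 1 := by
    rw [sub_mul, ← mul_pow]; norm_num; ring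
  linarith

lemma tendsto_dyadicFloor {t : ℝ} (ht : 0 ≤ t) :
    Tendsto (fun N => dyadicFloor N t) atTop (𝓝 t) := by
  refine tendsto_of_tendsto_of_tendsto_of_le_of_le (g := fun N : ℕ => t - (1 / 2 : ℝ) ^ N) ?_
    tendsto_const_nhds (fun N => (lt_dyadicFloor_add N t).le) (fun N => dyadicFloor_le N ht)
  simpa using tendsto_const_nhds.sub
    (tendsto_pow_atTop_nhds_zero_of_lt_one (r := (1 / 2 : ℝ)) (by norm_num) (by norm_num))

lemma monotone_dyadicFloor {t : ℝ} (ht : 0 ≤ t) : Monotone fun N => dyadicFloor N t := by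
  refine monotone_nat_of_le_succ fun N => ?_
  rw [dyadicFloor, dyadicFloor, div_le_div_iff₀ (by positivity) (by positivity), pow_succ]
  have h : 2 * ⌊(2 : ℝ) ^ N * t⌋₊ ≤ ⌊(2 : ℝ) ^ N * 2 * t⌋₊ := by
    refine Nat.le_floor ?_
    push_cast
    have := Nat.floor_le (a := (2 : ℝ) ^ N * t) (by positivity)
    linarith
  have h' : (2 : ℝ) * ⌊(2 : ℝ) ^ N * t⌋₊ ≤ ⌊(2 : ℝ) ^ N * 2 * t⌋₊ := by exact_mod_cast h
  nlinarith [pow_pos (two_pos : (0 : ℝ) < 2) N]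

section Processes

variable {Ω : Type*} {m : MeasurableSpace Ω} [mΩ : MeasurableSpace Ω] {P : Measure Ω} {T : ℝ} {k : ℕ}

/-- The measure `dt ⊗ dP` on `[0, T] × Ω`. -/
noncomputable abbrev timeProd (T : ℝ) (P : Measure Ω) : Measure (ℝ × Ω) :=
  (volume.restrict (Icc 0 T)).prod P

lemma ae_timeProd_fst_mem [SFinite P] : ∀ᵐ q ∂(timeProd T P), q.1 ∈ Icc 0 T :=
  Measure.quasiMeasurePreserving_fst.ae (ae_restrict_mem measurableSet_Icc)

lemma ae_timeProd_of_ae_forall [SFinite P] {p : ℝ → Ω → Prop}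
    (h : ∀ᵐ ω ∂P, ∀ t ∈ Icc 0 T, p t ω) : ∀ᵐ q ∂(timeProd T P), p q.1 q.2 := by
  filter_upwards [ae_timeProd_fst_mem (T := T) (P := P),
    Measure.quasiMeasurePreserving_snd.ae h] with q h1 h2 using h2 q.1 h1

lemma ae_ae_of_timeProd_swap [SFinite P] {p : ℝ → Ω → Prop}
    (h : ∀ᵐ q ∂(timeProd T P), p q.1 q.2) :
    ∀ᵐ ω ∂P, ∀ᵐ t ∂(volume.restrict (Icc 0 T)), p t ω := by
  have h' : ∀ᵐ q ∂(P.prod (volume.restrict (Icc 0 T))), p q.2 q.1 := by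
    have := Measure.measurePreserving_swap (μ := P) (ν := volume.restrict (Icc 0 T))
    exact this.quasiMeasurePreserving.ae h
  exact Measure.ae_ae_of_ae_prod h'

/-- Sampling a process at dyadic times gives a jointly measurable process. -/
lemma measurable_sample {X : ℕ → Ω → Fin k → ℝ} (hX : ∀ r, Measurable (X r)) (N : ℕ) :
    Measurable fun q : ℝ × Ω => X ⌊(2 : ℝ) ^ N * q.1⌋₊ q.2 := by
  have h : Measurable fun q : ℕ × Ω => X q.1 q.2 := measurable_from_prod_countable_right hX
  exact h.comp (by fun_prop : Measurable fun q : ℝ × Ω => (⌊(2 : ℝ) ^ N * q.1⌋₊, q.2))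

/-- A process with continuous paths and measurable marginals is jointly measurable. -/
lemma aestronglyMeasurable_uncurry_of_continuousOn [SFinite P] {X : ℝ → Ω → Fin k → ℝ}
    (hc : ∀ᵐ ω ∂P, ContinuousOn (fun t => X t ω) (Icc 0 T))
    (hm : ∀ t ∈ Icc 0 T, AEStronglyMeasurable (X t) P) :
    AEStronglyMeasurable (Function.uncurry X) (timeProd T P) := by
  classical
  refine aestronglyMeasurable_of_tendsto_ae atTop
    (f := fun N q => X (dyadicFloor N q.1) q.2) (fun N => ?_) ?_
  · let Y : ℕ → Ω → Fin k → ℝ := fun r =>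
      if h : (r : ℝ) / 2 ^ N ∈ Icc 0 T then (hm _ h).mk else 0
    have hY : ∀ r, Measurable (Y r) := fun r => by
      by_cases h : (r : ℝ) / 2 ^ N ∈ Icc 0 T
      · simp only [Y, h, dite_true]; exact (hm _ h).stronglyMeasurable_mk.measurable
      · simp only [Y, h, dite_false]; exact measurable_zero
    refine ⟨_, (measurable_sample hY N).stronglyMeasurable, ?_⟩
    have h1 : ∀ᵐ ω ∂P, ∀ r : ℕ, (r : ℝ) / 2 ^ N ∈ Icc 0 T → X ((r : ℝ) / 2 ^ N) ω = Y r ω := by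
      refine ae_all_iff.2 fun r => ?_
      by_cases h : (r : ℝ) / 2 ^ N ∈ Icc 0 T
      · filter_upwards [(hm _ h).ae_eq_mk] with ω hω _
        simp only [Y, h, dite_true, hω]
      · simp [h]
    filter_upwards [ae_timeProd_fst_mem (T := T) (P := P),
      Measure.quasiMeasurePreserving_snd.ae h1] with q hq h2
    exact h2 _ (dyadicFloor_mem hq)
  · filter_upwards [ae_timeProd_fst_mem (T := T) (P := P),
      Measure.quasiMeasurePreserving_snd.ae hc] with q hq h2
    exact (h2 q.1 hq).tendsto.comp (tendsto_nhdsWithin_iff.2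
      ⟨tendsto_dyadicFloor hq.1, Eventually.of_forall fun N => dyadicFloor_mem hq⟩)

/-- A vector process dominated by a square integrable random variable is square integrable. -/
lemma memLp_uncurry_of_bound [IsProbabilityMeasure P] {X : ℝ → Ω → Fin k → ℝ} {G : Ω → ℝ}
    (hX : AEStronglyMeasurable (Function.uncurry X) (timeProd T P)) (hG : MemLp G 2 P)
    (hb : ∀ᵐ ω ∂P, ∀ t ∈ Icc 0 T, ∀ i, |X t ω i| ≤ G ω) :
    MemLp (Function.uncurry X) 2 (timeProd T P) := by
  refine (hG.comp_snd (volume.restrict (Icc 0 T))).of_le hX ?_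
  have := ae_timeProd_of_ae_forall hb
  filter_upwards [this] with q hq
  refine (pi_norm_le_iff_of_nonneg (norm_nonneg _)).2 fun i => ?_
  exact (hq i).trans (le_abs_self _)

lemma memLp_marginal_of_bound {X : ℝ → Ω → Fin k → ℝ} {G : Ω → ℝ} {t : ℝ} (ht : t ∈ Icc 0 T)
    (hX : AEStronglyMeasurable (X t) P) (hG : MemLp G 2 P)
    (hb : ∀ᵐ ω ∂P, ∀ t ∈ Icc 0 T, ∀ i, |X t ω i| ≤ G ω) : MemLp (X t) 2 P := by
  refine hG.of_le hX ?_
  filter_upwards [hb] with ω h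
  exact (pi_norm_le_iff_of_nonneg (norm_nonneg _)).2 fun i => (h t ht i).trans (le_abs_self _)

/-- Pathwise time integrals of square integrable processes are square integrable, with a bound
which is uniform in the upper limit. -/
lemma memLp_integral_abs [IsProbabilityMeasure P] (hT : 0 < T) {f : ℝ → Ω → ℝ}
    (hf : MemLp (Function.uncurry f) 2 (timeProd T P)) :
    MemLp (fun ω => ∫ s in Icc 0 T, |f s ω|) 2 P := by
  have hint : Integrable (Function.uncurry f) (timeProd T P) := hf.integrable (by norm_num)
  have hsq : Integrable (fun q : ℝ × Ω => f q.1 q.2 ^ 2) (timeProd T P) := hf.integrable_sq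
  have hm : AEStronglyMeasurable (fun ω => ∫ s in Icc 0 T, |f s ω|) P :=
    (Integrable.integral_prod_right (f := fun q : ℝ × Ω => |f q.1 q.2|) hint.abs).aestronglyMeasurable
  rw [memLp_two_iff_integrable_sq hm]
  refine ((hsq.integral_prod_right).const_mul T).mono' (hm.pow 2) ?_
  filter_upwards [hint.prod_left_ae, hsq.prod_left_ae] with ω h1 h2
  have h1' : Integrable (fun s => |f s ω|) (volume.restrict (Icc 0 T)) := h1.abs
  rw [Real.norm_eq_abs, abs_of_nonneg (sq_nonneg _)]
  set G := ∫ s in Icc 0 T, |f s ω|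
  have h3 : 0 ≤ ∫ s in Icc 0 T, (|f s ω| - G / T) ^ 2 := integral_nonneg fun s => sq_nonneg _
  have h4 : ∫ s in Icc 0 T, (|f s ω| - G / T) ^ 2
      = (∫ s in Icc 0 T, f s ω ^ 2) - 2 * (G / T) * G + T * (G / T) ^ 2 := by
    have e : ∀ s, (|f s ω| - G / T) ^ 2 = (f s ω ^ 2 - 2 * (G / T) * |f s ω|) + (G / T) ^ 2 :=
      fun s => by rw [← sq_abs (f s ω)]; ring
    simp only [e]
    rw [integral_add (f := fun s => f s ω ^ 2 - 2 * (G / T) * |f s ω|) (h2.sub (h1'.const_mul _))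
      (integrable_const _), integral_sub h2 (h1'.const_mul _), integral_const_mul, integral_const]
    simp [hT.le, G]
  have h5 : (∫ s in Icc 0 T, f s ω ^ 2) - 2 * (G / T) * G + T * (G / T) ^ 2
      = (∫ s in Icc 0 T, f s ω ^ 2) - G ^ 2 / T := by field_simp; ring
  have h6 : G ^ 2 / T ≤ ∫ s in Icc 0 T, f s ω ^ 2 := by linarith
  rw [div_le_iff₀ hT] at h6
  linarith

lemma abs_intervalIntegral_le {f : ℝ → ℝ} {t : ℝ} (ht : t ∈ Icc 0 T)
    (hf : IntegrableOn f (Icc 0 T)) :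
    |∫ s in (0 : ℝ)..t, f s| ≤ ∫ s in Icc 0 T, |f s| := by
  refine (intervalIntegral.abs_integral_le_integral_abs ht.1).trans ?_
  rw [intervalIntegral.integral_of_le ht.1]
  refine setIntegral_mono_set hf.abs (Eventually.of_forall fun s => abs_nonneg _) ?_
  exact (Ioc_subset_Icc_self.trans (Icc_subset_Icc le_rfl ht.2)).eventuallyLE

/-- A random variable whose conditional expectation vanishes is orthogonal to the measurable ones. -/
lemma integral_mul_eq_zero_of_condExp_eq_zero [IsProbabilityMeasure P]
    (hm : m ≤ mΩ) {Z g : Ω → ℝ} (hZ : MemLp Z 2 P) (hg : MemLp g 2 P)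
    (hgm : AEStronglyMeasurable[m] g P) (h : P[Z | m] =ᵐ[P] 0) : ∫ ω, g ω * Z ω ∂P = 0 := by
  have hint : Integrable (g * Z) P := hg.integrable_mul hZ
  have := condExp_mul_of_aestronglyMeasurable_left hgm hint (hZ.integrable (by norm_num))
  have h2 : ∫ ω, (g * Z) ω ∂P = 0 := by
    rw [← integral_condExp hm, integral_congr_ae this]
    refine (integral_congr_ae (g := fun _ => (0 : ℝ)) ?_).trans (by simp)
    filter_upwards [h] with ω hω
    simp [hω]
  exact h2

lemma condExp_sub_condExp_ae_eq_zero [IsProbabilityMeasure P]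
    (hm : m ≤ mΩ) {Y : Ω → ℝ} (hY : Integrable Y P) : P[Y - P[Y | m] | m] =ᵐ[P] 0 := by
  filter_upwards [condExp_sub hY (integrable_condExp (f := Y) (m := m)) m,
    condExp_condExp_of_le (f := Y) (μ := P) (le_refl m) hm] with ω h1 h2
  rw [h1]
  simp [h2]

/-- The time integral up to `t` of a process adapted to a filtration is measurable at time `t`: it
is orthogonal to whatever is orthogonal to the past. -/
lemma aestronglyMeasurable_integral_of_adapted [IsProbabilityMeasure P] (hT : 0 < T)
    (hm : m ≤ mΩ) {f : ℝ → Ω → ℝ} {t : ℝ} (ht : t ∈ Icc 0 T)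
    (hf : MemLp (Function.uncurry f) 2 (timeProd T P))
    (hfm : ∀ s ∈ Icc 0 t, AEStronglyMeasurable[m] (f s) P) :
    AEStronglyMeasurable[m] (fun ω => ∫ s in (0 : ℝ)..t, f s ω) P := by
  set Y : Ω → ℝ := fun ω => ∫ s in (0 : ℝ)..t, f s ω
  have hft : MemLp (Function.uncurry f) 2 (timeProd t P) :=
    hf.mono_measure (Measure.prod_mono (Measure.restrict_mono (Icc_subset_Icc le_rfl ht.2) le_rfl)
      le_rfl)
  have hYeq : ∀ ω, Y ω = ∫ s in Icc 0 t, f s ω := fun ω => by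
    simp only [Y]
    rw [intervalIntegral.integral_of_le ht.1, integral_Icc_eq_integral_Ioc]
  have hYm : AEStronglyMeasurable Y P := by
    rw [funext hYeq]
    exact (Integrable.integral_prod_right (f := Function.uncurry f)
      (hft.integrable (by norm_num))).aestronglyMeasurable
  have hY : MemLp Y 2 P := by
    refine (memLp_integral_abs hT hf).of_le hYm ?_
    filter_upwards [(hf.integrable (by norm_num)).prod_left_ae] with ω h
    exact (abs_intervalIntegral_le ht h).trans (le_abs_self _)
  have hYi := hY.integrable (q := 2) (by norm_num)
  set Z : Ω → ℝ := Y - P[Y | m]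
  have hC : MemLp (P[Y | m]) 2 P := hY.condExp (by norm_num)
  have hZ : MemLp Z 2 P := hY.sub hC
  have hZ0 := condExp_sub_condExp_ae_eq_zero hm hYi
  have h1 : ∫ ω, (P[Y | m]) ω * Z ω ∂P = 0 :=
    integral_mul_eq_zero_of_condExp_eq_zero hm hZ hC
      stronglyMeasurable_condExp.aestronglyMeasurable hZ0
  have h2 : ∫ ω, Y ω * Z ω ∂P = 0 := by
    have hprod : Integrable (fun q : ℝ × Ω => f q.1 q.2 * Z q.2) (timeProd t P) :=
      hft.integrable_mul (hZ.comp_snd (volume.restrict (Icc 0 t)))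
    calc ∫ ω, Y ω * Z ω ∂P = ∫ ω, (∫ s in Icc 0 t, f s ω * Z ω) ∂P := by
          simp only [hYeq, integral_mul_const]
      _ = ∫ s in Icc 0 t, ∫ ω, f s ω * Z ω ∂P := (integral_integral_swap hprod).symm
      _ = ∫ s in Icc 0 t, (0 : ℝ) := by
          refine integral_congr_ae ?_
          have hsq : Integrable (fun q : ℝ × Ω => f q.1 q.2 ^ 2) (timeProd t P) :=
            hft.integrable_sq
          filter_upwards [ae_restrict_mem measurableSet_Icc, hsq.prod_right_ae,
            hft.aestronglyMeasurable.prodMk_left] with s hs h3 h4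
          exact integral_mul_eq_zero_of_condExp_eq_zero hm hZ
            ((memLp_two_iff_integrable_sq h4).2 h3) (hfm s hs) hZ0
      _ = 0 := by simp
  have h3 : ∫ ω, Z ω ^ 2 ∂P = 0 := by
    have e : ∀ ω, Z ω ^ 2 = Y ω * Z ω - (P[Y | m]) ω * Z ω := fun ω => by
      simp only [Z, Pi.sub_apply]; ring
    simp only [e]
    rw [integral_sub (f := fun ω => Y ω * Z ω) (g := fun ω => (P[Y | m]) ω * Z ω)
      (hY.integrable_mul hZ) (hC.integrable_mul hZ), h2, h1, sub_zero]
  have h4 := (integral_eq_zero_iff_of_nonneg (fun ω => sq_nonneg (Z ω)) hZ.integrable_sq).1 h3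
  refine ⟨P[Y | m], stronglyMeasurable_condExp, ?_⟩
  filter_upwards [h4] with ω hω
  have : Z ω = 0 := by simpa using hω
  simpa [Z, sub_eq_zero] using this

end Processes

/-! ### Adapted versions -/

lemma stronglyMeasurable_limUnder_pi {α : Type*} {m : MeasurableSpace α} {k : ℕ}
    {q : ℕ → α → Fin k → ℝ} (hq : ∀ N, StronglyMeasurable (q N)) :
    StronglyMeasurable (fun z => limUnder atTop fun N => q N z) :=
  StronglyMeasurable.limUnder hq

lemma aestronglyMeasurable_limUnder {α : Type*} [MeasurableSpace α] {μ : Measure α} {k : ℕ}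
    {q : ℕ → α → Fin k → ℝ} (hq : ∀ N, AEStronglyMeasurable (q N) μ) :
    AEStronglyMeasurable (fun z => limUnder atTop fun N => q N z) μ := by
  refine ⟨_, stronglyMeasurable_limUnder_pi fun N => (hq N).stronglyMeasurable_mk, ?_⟩
  filter_upwards [ae_all_iff.2 fun N => (hq N).ae_eq_mk] with z hz
  simp only [hz]

section AdaptedVersions

variable {Ω : Type*} {m₁ m₂ : MeasurableSpace Ω} [mΩ : MeasurableSpace Ω] {P : Measure Ω} {T : ℝ}
  {k : ℕ}

/-- Jointly measurable processes which agree almost surely at almost every time agree almost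
everywhere. -/
lemma ae_eq_timeProd_of_ae [SFinite P] {F G : ℝ → Ω → Fin k → ℝ}
    (hF : AEStronglyMeasurable (Function.uncurry F) (timeProd T P))
    (hG : AEStronglyMeasurable (Function.uncurry G) (timeProd T P))
    (h : ∀ᵐ t ∂(volume.restrict (Icc 0 T)), F t =ᵐ[P] G t) :
    Function.uncurry F =ᵐ[timeProd T P] Function.uncurry G := by
  have h1 := Measure.ae_ae_of_ae_prod hF.ae_eq_mk
  have h2 := Measure.ae_ae_of_ae_prod hG.ae_eq_mk
  have hs : MeasurableSet {z | hF.mk _ z = hG.mk _ z} :=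
    measurableSet_eq_fun hF.stronglyMeasurable_mk.measurable hG.stronglyMeasurable_mk.measurable
  have h3 : ∀ᵐ z ∂(timeProd T P), hF.mk _ z = hG.mk _ z := by
    rw [Measure.ae_prod_iff_ae_ae hs]
    filter_upwards [h, h1, h2] with t a b c
    filter_upwards [a, b, c] with ω a b c
    rw [← b, ← c]
    exact a
  filter_upwards [h3, hF.ae_eq_mk, hG.ae_eq_mk] with z a b c
  rw [b, c, a]

/-- If strictly adapted processes converge to `g`, which is adapted up to null sets, then `g` has a
version which is strictly adapted at every time and jointly measurable. The pointwise limit of the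
processes provides it off a null set of times. -/
lemma exists_adapted_version [SFinite P] (ℱ : Filtration ℝ mΩ) {g : ℝ → Ω → Fin k → ℝ}
    {q : ℕ → ℝ → Ω → Fin k → ℝ} (hq : ∀ N, ∀ t ∈ Icc 0 T, StronglyMeasurable[ℱ t] (q N t))
    (hqm : ∀ N, AEStronglyMeasurable (Function.uncurry (q N)) (timeProd T P))
    (hlim : ∀ᵐ t ∂(volume.restrict (Icc 0 T)), ∀ᵐ ω ∂P,
      Tendsto (fun N => q N t ω) atTop (𝓝 (g t ω)))
    (hg : ∀ t ∈ Icc 0 T, AEStronglyMeasurable[ℱ t] (g t) P) :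
    ∃ p : ℝ → Ω → Fin k → ℝ, (∀ t ∈ Icc 0 T, StronglyMeasurable[ℱ t] (p t)) ∧
      (∀ t ∈ Icc 0 T, p t =ᵐ[P] g t) ∧
      AEStronglyMeasurable (Function.uncurry p) (timeProd T P) := by
  classical
  let l : ℝ → Ω → Fin k → ℝ := fun t ω => limUnder atTop fun N => q N t ω
  have hl : ∀ t ∈ Icc 0 T, StronglyMeasurable[ℱ t] (l t) := fun t ht =>
    stronglyMeasurable_limUnder_pi (m := ℱ t) fun N => hq N t ht
  have hlm : AEStronglyMeasurable (Function.uncurry l) (timeProd T P) :=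
    aestronglyMeasurable_limUnder hqm
  have hlg : ∀ᵐ t ∂(volume.restrict (Icc 0 T)), l t =ᵐ[P] g t := by
    filter_upwards [hlim] with t ht
    filter_upwards [ht] with ω hω using hω.limUnder_eq
  let p : ℝ → Ω → Fin k → ℝ := fun t =>
    if l t =ᵐ[P] g t then l t else if h : t ∈ Icc 0 T then (hg t h).mk (g t) else 0
  refine ⟨p, fun t ht => ?_, fun t ht => ?_, hlm.congr ?_⟩
  · by_cases h : l t =ᵐ[P] g t
    · simpa only [p, h, if_true] using hl t ht
    · simpa only [p, h, if_false, ht, dite_true] using (hg t ht).stronglyMeasurable_mk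
  · by_cases h : l t =ᵐ[P] g t
    · simp only [p, h, if_true]
    · simpa only [p, h, if_false, ht, dite_true] using (hg t ht).ae_eq_mk.symm
  · filter_upwards [Measure.quasiMeasurePreserving_fst.ae hlg] with z hz
    simp only [Function.uncurry, p, hz, if_true]

/-- A continuous process which is adapted up to null sets has a strictly adapted version. -/
lemma exists_adapted_version_of_continuousOn [SFinite P] (ℱ : Filtration ℝ mΩ)
    {X : ℝ → Ω → Fin k → ℝ} (hc : ∀ᵐ ω ∂P, ContinuousOn (fun t => X t ω) (Icc 0 T))
    (hX : ∀ t ∈ Icc 0 T, AEStronglyMeasurable[ℱ t] (X t) P) :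
    ∃ p : ℝ → Ω → Fin k → ℝ, (∀ t ∈ Icc 0 T, StronglyMeasurable[ℱ t] (p t)) ∧
      (∀ t ∈ Icc 0 T, p t =ᵐ[P] X t) ∧
      AEStronglyMeasurable (Function.uncurry p) (timeProd T P) := by
  classical
  let Y : ℝ → Ω → Fin k → ℝ := fun t => if h : t ∈ Icc 0 T then (hX t h).mk (X t) else 0
  have hY : ∀ t, StronglyMeasurable[ℱ t] (Y t) := fun t => by
    by_cases h : t ∈ Icc 0 T
    · simpa only [Y, h, dite_true] using (hX t h).stronglyMeasurable_mk
    · simpa only [Y, h, dite_false] using stronglyMeasurable_zero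
  have hYX : ∀ t ∈ Icc 0 T, Y t =ᵐ[P] X t := fun t ht => by
    simpa only [Y, ht, dite_true] using (hX t ht).ae_eq_mk.symm
  refine exists_adapted_version ℱ (q := fun N t => Y (dyadicFloor N t)) (fun N t ht => ?_)
    (fun N => ?_) ?_ hX
  · exact (hY _).mono (ℱ.mono (dyadicFloor_le N ht.1))
  · exact (measurable_sample (X := fun r => Y ((r : ℝ) / 2 ^ N))
      (fun r => ((hY _).mono (ℱ.le _)).measurable) N).aestronglyMeasurable
  · filter_upwards [ae_restrict_mem measurableSet_Icc] with t ht
    filter_upwards [hc, ae_all_iff.2 fun N => hYX _ (dyadicFloor_mem (N := N) ht)] with ω h1 h2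
    simp only [h2]
    exact (h1 t ht).tendsto.comp (tendsto_nhdsWithin_iff.2
      ⟨tendsto_dyadicFloor ht.1, Eventually.of_forall fun N => dyadicFloor_mem ht⟩)

lemma condExp_apply_ae_eq {m₁ : MeasurableSpace Ω} {ξ : Ω → Fin k → ℝ} (hξ : Integrable ξ P)
    (i : Fin k) :
    (fun ω => (P[ξ | m₁]) ω i) =ᵐ[P] P[fun ω => ξ ω i | m₁] :=
  (ContinuousLinearMap.proj (R := ℝ) (φ := fun _ : Fin k => ℝ) i).comp_condExp_comm hξ

/-- Pythagoras' theorem for conditional expectations along an inclusion of σ-algebras. -/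
lemma integral_sq_condExp_sub [IsProbabilityMeasure P] {X : Ω → ℝ} (hX : MemLp X 2 P)
    (h₁₂ : m₁ ≤ m₂) (h₂ : m₂ ≤ mΩ) :
    ∫ ω, ((P[X | m₂]) ω - (P[X | m₁]) ω) ^ 2 ∂P
      = ∫ ω, (P[X | m₂]) ω ^ 2 ∂P - ∫ ω, (P[X | m₁]) ω ^ 2 ∂P := by
  have hA : MemLp (P[X | m₁]) 2 P := hX.condExp (by norm_num)
  have hB : MemLp (P[X | m₂]) 2 P := hX.condExp (by norm_num)
  have hZ : P[P[X | m₂] - P[X | m₁] | m₁] =ᵐ[P] 0 := by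
    filter_upwards [condExp_sub (integrable_condExp (f := X) (m := m₂) (μ := P))
      (integrable_condExp (f := X) (m := m₁)) m₁,
      condExp_condExp_of_le (f := X) (μ := P) h₁₂ h₂,
      condExp_condExp_of_le (f := X) (μ := P) (le_refl m₁) (h₁₂.trans h₂)] with ω a b c
    rw [a, Pi.sub_apply, b, c]
    simp
  have h0 := integral_mul_eq_zero_of_condExp_eq_zero (h₁₂.trans h₂) (hB.sub hA) hA
    stronglyMeasurable_condExp.aestronglyMeasurable hZ
  have e : ∀ ω, ((P[X | m₂]) ω - (P[X | m₁]) ω) ^ 2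
      = ((P[X | m₂]) ω ^ 2 - (P[X | m₁]) ω ^ 2)
        - 2 * ((P[X | m₁]) ω * (P[X | m₂] - P[X | m₁]) ω) := fun ω => by
    simp only [Pi.sub_apply]; ring
  simp only [e]
  rw [integral_sub (f := fun ω => (P[X | m₂]) ω ^ 2 - (P[X | m₁]) ω ^ 2)
    (g := fun ω => 2 * ((P[X | m₁]) ω * (P[X | m₂] - P[X | m₁]) ω))
    (hB.integrable_sq.sub hA.integrable_sq) ((hA.integrable_mul (hB.sub hA)).const_mul 2),
    integral_const_mul, h0, mul_zero, sub_zero, integral_sub hB.integrable_sq hA.integrable_sq]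

lemma integral_sq_condExp_mono [IsProbabilityMeasure P] {X : Ω → ℝ} (hX : MemLp X 2 P)
    (h₁₂ : m₁ ≤ m₂) (h₂ : m₂ ≤ mΩ) :
    ∫ ω, (P[X | m₁]) ω ^ 2 ∂P ≤ ∫ ω, (P[X | m₂]) ω ^ 2 ∂P := by
  rw [← sub_nonneg, ← integral_sq_condExp_sub hX h₁₂ h₂]
  exact integral_nonneg fun ω => sq_nonneg _

/-- For all but countably many times the conditional expectations along the dyadic times below `t`
converge to the one at time `t`: the second moment of the conditional expectation is a monotone
function of time, so it has countably many jumps. -/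
lemma ae_tendsto_condExp_dyadicFloor [IsProbabilityMeasure P] (ℱ : Filtration ℝ mΩ) {X : Ω → ℝ}
    (hX : MemLp X 2 P) :
    ∀ᵐ t ∂(volume.restrict (Icc 0 T)), ∀ᵐ ω ∂P,
      Tendsto (fun N => (P[X | ℱ (dyadicFloor N t)]) ω) atTop (𝓝 ((P[X | ℱ t]) ω)) := by
  set h : ℝ → ℝ := fun t => ∫ ω, (P[X | ℱ t]) ω ^ 2 ∂P
  have hmono : Monotone h := fun s t hst => integral_sq_condExp_mono hX (ℱ.mono hst) (ℱ.le t)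
  have hcount := hmono.countable_not_continuousAt
  filter_upwards [ae_restrict_mem measurableSet_Icc,
    ae_restrict_of_ae (hcount.ae_notMem volume)] with t ht hcont
  replace hcont : ContinuousAt h t := not_not.1 hcont
  let 𝒢 : Filtration ℕ mΩ := ⟨fun N => ℱ (dyadicFloor N t),
    fun N M hNM => ℱ.mono (monotone_dyadicFloor ht.1 hNM), fun N => ℱ.le _⟩
  have hG : (⨆ N, 𝒢 N) ≤ ℱ t := iSup_le fun N => ℱ.mono (dyadicFloor_le N ht.1)
  have hGh : h t ≤ ∫ ω, (P[X | ⨆ N, 𝒢 N]) ω ^ 2 ∂P :=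
    le_of_tendsto (hcont.tendsto.comp (tendsto_dyadicFloor ht.1))
      (Eventually.of_forall fun N => integral_sq_condExp_mono hX (le_iSup (fun N => 𝒢 N) N) (hG.trans (ℱ.le t)))
  have hsq := integral_sq_condExp_sub hX hG (ℱ.le t)
  have hA : MemLp (P[X | ⨆ N, 𝒢 N]) 2 P := hX.condExp (by norm_num)
  have hB : MemLp (P[X | ℱ t]) 2 P := hX.condExp (by norm_num)
  have h0 : ∫ ω, ((P[X | ℱ t]) ω - (P[X | ⨆ N, 𝒢 N]) ω) ^ 2 ∂P = 0 := by
    refine le_antisymm ?_ (integral_nonneg fun ω => sq_nonneg _)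
    rw [hsq]
    linarith
  have h1 := (integral_eq_zero_iff_of_nonneg (fun ω => sq_nonneg _) (hB.sub hA).integrable_sq).1 h0
  filter_upwards [h1, tendsto_ae_condExp (μ := P) (ℱ := 𝒢) X] with ω h2 h3
  have h4 : (P[X | ℱ t]) ω = (P[X | ⨆ N, 𝒢 N]) ω := by simpa [sub_eq_zero] using h2
  rw [h4]
  exact h3

lemma memLp_uncurry_of_eLpNorm_le [SFinite P] {X : ℝ → Ω → Fin k → ℝ}
    (hX : AEStronglyMeasurable (Function.uncurry X) (timeProd T P)) {K : ℝ≥0∞} (hK : K ≠ ⊤)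
    (hb : ∀ t ∈ Icc 0 T, eLpNorm (X t) 2 P ≤ K) : MemLp (Function.uncurry X) 2 (timeProd T P) := by
  have hb' : ∀ t ∈ Icc 0 T, ∫⁻ ω, ‖X t ω‖ₑ ^ (2 : ℝ) ∂P ≤ K ^ (2 : ℝ) := fun t ht => by
    calc ∫⁻ ω, ‖X t ω‖ₑ ^ (2 : ℝ) ∂P = eLpNorm (X t) 2 P ^ (2 : ℝ) := by
          rw [eLpNorm_eq_lintegral_rpow_enorm_toReal (by norm_num) (by norm_num)]
          rw [← ENNReal.rpow_mul]
          norm_num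
      _ ≤ _ := by
          have := hb t ht
          gcongr
  refine ⟨hX, ?_⟩
  rw [eLpNorm_lt_top_iff_lintegral_rpow_enorm_lt_top (by norm_num) (by norm_num)]
  rw [lintegral_prod _ (hX.enorm.pow_const _)]
  calc _ ≤ ∫⁻ t in Icc 0 T, K ^ (2 : ℝ) := by
        refine setLIntegral_mono measurable_const fun t ht => ?_
        simpa [Function.uncurry] using hb' t ht
    _ < ⊤ := by
        rw [lintegral_const]
        refine ENNReal.mul_lt_top (ENNReal.rpow_lt_top_of_nonneg (by norm_num) hK) ?_
        simp

/-- The martingale `t ↦ E[ξ | ℱ t]` of a square integrable random vector has a strictly adapted,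
jointly measurable and square integrable version. -/
lemma exists_adapted_version_condExp [IsProbabilityMeasure P] (ℱ : Filtration ℝ mΩ)
    {ξ : Ω → Fin k → ℝ} (hξ : MemLp ξ 2 P) :
    ∃ p : ℝ → Ω → Fin k → ℝ, (∀ t ∈ Icc 0 T, StronglyMeasurable[ℱ t] (p t)) ∧
      (∀ t ∈ Icc 0 T, p t =ᵐ[P] P[ξ | ℱ t]) ∧ MemLp (Function.uncurry p) 2 (timeProd T P) := by
  have hξi := hξ.integrable (q := 2) (by norm_num)
  obtain ⟨p, hp, hpe, hpm⟩ := exists_adapted_version (P := P) (T := T) ℱ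
    (g := fun t => P[ξ | ℱ t]) (q := fun N t => P[ξ | ℱ (dyadicFloor N t)])
    (fun N t ht => stronglyMeasurable_condExp.mono (ℱ.mono (dyadicFloor_le N ht.1)))
    (fun N => (measurable_sample (X := fun r => P[ξ | ℱ ((r : ℝ) / 2 ^ N)])
      (fun r => (stronglyMeasurable_condExp.mono (ℱ.le _)).measurable) N).aestronglyMeasurable)
    (by
      have := fun i => ae_tendsto_condExp_dyadicFloor (T := T) ℱ (memLp_pi_iff.1 hξ i)
      filter_upwards [ae_all_iff.2 this] with t ht
      filter_upwards [ae_all_iff.2 ht, ae_all_iff.2 fun i => condExp_apply_ae_eq (m₁ := ℱ t) hξi i,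
        ae_all_iff.2 fun N => ae_all_iff.2 fun i =>
          condExp_apply_ae_eq (m₁ := ℱ (dyadicFloor N t)) hξi i] with ω a b c
      refine tendsto_pi_nhds.2 fun i => ?_
      simp only [b, c]
      exact a i)
    (fun t ht => stronglyMeasurable_condExp.aestronglyMeasurable)
  refine ⟨p, hp, hpe, memLp_uncurry_of_eLpNorm_le hpm hξ.2.ne fun t ht => ?_⟩
  rw [eLpNorm_congr_ae (hpe t ht)]
  exact eLpNorm_condExp_le_eLpNorm ξ (by norm_num)

end AdaptedVersions

namespace LQ

variable {Ω : Type*} [mΩ : MeasurableSpace Ω] {P : Measure Ω} {T : ℝ} {n k : ℕ}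
  {x₀ : Ω → Fin n → ℝ} {W : ℝ≥0 → Ω → Fin n → ℝ}

/-- The σ-algebras `ℱ_t` form a filtration. -/
def historyFiltration (hx₀ : Measurable x₀) (hW : ∀ t, Measurable (W t)) : Filtration ℝ mΩ where
  seq := history x₀ W
  mono' s t hst := by
    refine sup_le_sup_left (iSup_mono fun r => ?_) _
    exact iSup_le fun h => le_iSup_of_le (h.trans hst) le_rfl
  le' _ := sup_le hx₀.comap_le (iSup_le fun s => iSup_le fun _ => (hW s).comap_le)

/-- Completeness of `L²_ℱ(0, T; ℝᵏ)`. -/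
lemma exists_memL2F_tendsto [IsProbabilityMeasure P] {v : ℕ → ℝ → Ω → Fin k → ℝ}
    (hv : ∀ N, MemL2F T x₀ W P (v N))
    (hc : ∀ ε : ℝ≥0∞, 0 < ε → ∃ N₀, ∀ N ≥ N₀, ∀ M ≥ N₀,
      eLpNorm (Function.uncurry (v N) - Function.uncurry (v M)) 2 (timeProd T P) < ε) :
    ∃ u, MemL2F T x₀ W P u ∧ Tendsto
      (fun N => eLpNorm (Function.uncurry (v N) - Function.uncurry u) 2 (timeProd T P)) atTop
      (𝓝 0) := by
  have hcau : CauchySeq fun N => (hv N).memLp.toLp (Function.uncurry (v N)) := by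
    rw [EMetric.cauchySeq_iff]
    intro ε hε
    obtain ⟨N₀, h⟩ := hc ε hε
    refine ⟨N₀, fun N hN M hM => ?_⟩
    rw [Lp.edist_toLp_toLp]
    exact h N hN M hM
  obtain ⟨f, hf⟩ := cauchySeq_tendsto_of_complete hcau
  rw [Lp.tendsto_Lp_iff_tendsto_eLpNorm'] at hf
  have hf' : Tendsto (fun N => eLpNorm (Function.uncurry (v N) - ⇑f) 2 (timeProd T P)) atTop
      (𝓝 0) := by
    refine hf.congr fun N => eLpNorm_congr_ae ?_
    filter_upwards [(hv N).memLp.coeFn_toLp] with z hz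
    simp [hz]
  have hmeas : TendstoInMeasure (timeProd T P) (fun N => Function.uncurry (v N)) atTop ⇑f :=
    tendstoInMeasure_of_tendsto_eLpNorm (by norm_num) (fun N => (hv N).memLp.1)
      (Lp.aestronglyMeasurable f) hf'
  obtain ⟨ns, -, hns⟩ := hmeas.exists_seq_tendsto_ae
  let u : ℝ → Ω → Fin k → ℝ := fun t ω => limUnder atTop fun N => v (ns N) t ω
  have huf : Function.uncurry u =ᵐ[timeProd T P] ⇑f := by
    filter_upwards [hns] with z hz using hz.limUnder_eq
  refine ⟨u, ⟨fun t ht => stronglyMeasurable_limUnder_pi (m := history x₀ W t) fun N =>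
    (hv _).adapted t ht,
    (memLp_congr_ae huf).2 (Lp.memLp f)⟩, hf'.congr fun N => eLpNorm_congr_ae ?_⟩
  filter_upwards [huf] with z hz
  simp [hz]

end LQ

/-! ### Elementary stochastic integrals and maximal inequalities -/

section StepIntegral

variable {Ω : Type*} [mΩ : MeasurableSpace Ω] {P : Measure Ω} {B : ℝ≥0 → Ω → ℝ} {ι : Type*}

/-- The elementary integral `∑ aₖ (B (uₖ ∧ t) - B (lₖ ∧ t))`, where neither disjointness nor order
of the intervals `(lₖ, uₖ]` is required. -/
def stepIntegral (s : Finset ι) (a : ι → ℝ) (l u : ι → ℝ≥0) (B : ℝ≥0 → Ω → ℝ) (t : ℝ≥0) (ω : Ω) : ℝ :=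
  ∑ k ∈ s, a k * (B (min (u k) t) ω - B (min (l k) t) ω)

/-- The integrand `∑ aₖ 1_(lₖ, uₖ]` of an elementary integral. -/
noncomputable def stepSum (s : Finset ι) (a : ι → ℝ) (l u : ι → ℝ≥0) (x : ℝ) : ℝ :=
  ∑ k ∈ s, a k * (Ioc (l k : ℝ) (u k)).indicator (fun _ => 1) x

lemma memLp_brownian (hB : IsBrownianReal B P) (t : ℝ≥0) : MemLp (B t) 2 P :=
  (hB.isGaussianProcess.hasGaussianLaw_eval t).memLp_two

lemma integral_mul_brownian (hB : IsBrownianReal B P) (s t : ℝ≥0) :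
    ∫ ω, B s ω * B t ω ∂P = min s t := by
  have : IsProbabilityMeasure P := hB.isGaussianProcess.isProbabilityMeasure
  have h := hB.covariance_eval s t
  rw [covariance_eq_sub (memLp_brownian hB s) (memLp_brownian hB t), hB.integral_eval,
    hB.integral_eval] at h
  simpa using h

lemma memLp_stepIntegral (hB : IsBrownianReal B P) (s : Finset ι) (a : ι → ℝ) (l u : ι → ℝ≥0)
    (t : ℝ≥0) : MemLp (stepIntegral s a l u B t) 2 P :=
  memLp_finsetSum s fun _ _ => ((memLp_brownian hB _).sub (memLp_brownian hB _)).const_mul _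

lemma memLp_stepSum (s : Finset ι) (a : ι → ℝ) (l u : ι → ℝ≥0) (μ : Measure ℝ) [IsFiniteMeasure μ] :
    MemLp (stepSum s a l u) 2 μ :=
  memLp_finsetSum s fun _ _ =>
    (memLp_indicator_const 2 measurableSet_Ioc 1 (Or.inr (measure_ne_top _ _))).const_mul _

lemma integral_mul_increments (hB : IsBrownianReal B P) {l u l' u' : ℝ≥0} (h : l ≤ u)
    (h' : l' ≤ u') :
    ∫ ω, (B u ω - B l ω) * (B u' ω - B l' ω) ∂P
      = ∫ x, (Ioc (l : ℝ) u).indicator (fun _ => (1 : ℝ)) x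
          * (Ioc (l' : ℝ) u').indicator (fun _ => 1) x := by
  have hi : ∀ s t, Integrable (fun ω => B s ω * B t ω) P := fun s t =>
    (memLp_brownian hB s).integrable_mul (memLp_brownian hB t)
  have e : ∀ ω, (B u ω - B l ω) * (B u' ω - B l' ω)
      = (B u ω * B u' ω - B u ω * B l' ω) - (B l ω * B u' ω - B l ω * B l' ω) := fun ω => by ring
  simp only [e]
  rw [integral_sub (f := fun ω => B u ω * B u' ω - B u ω * B l' ω)
      (g := fun ω => B l ω * B u' ω - B l ω * B l' ω) ((hi _ _).sub (hi _ _))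
      ((hi _ _).sub (hi _ _)), integral_sub (hi _ _) (hi _ _), integral_sub (hi _ _) (hi _ _)]
  simp only [integral_mul_brownian hB]
  have e2 : ∀ x : ℝ, (Ioc (l : ℝ) u).indicator (fun _ => (1 : ℝ)) x
      * (Ioc (l' : ℝ) u').indicator (fun _ => 1) x
      = (Ioc (max (l : ℝ) l') (min (u : ℝ) u')).indicator (fun _ => 1) x := fun x => by
    rw [← Ioc_inter_Ioc]
    by_cases h1 : x ∈ Ioc (l : ℝ) u <;> by_cases h2 : x ∈ Ioc (l' : ℝ) u' <;>
      simp only [indicator_apply, mem_inter_iff, h1, h2] <;> norm_num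
  simp only [e2]
  rw [integral_indicator measurableSet_Ioc]
  simp only [integral_const, measureReal_restrict_apply_univ, Real.volume_real_Ioc, smul_eq_mul,
    mul_one]
  have h1 : (l : ℝ) ≤ u := by exact_mod_cast h
  have h2 : (l' : ℝ) ≤ u' := by exact_mod_cast h'
  push_cast
  grind

/-- The Itô isometry for elementary integrals. -/
lemma integral_sq_stepIntegral (hB : IsBrownianReal B P) (s : Finset ι) (a : ι → ℝ)
    {l u : ι → ℝ≥0} (hlu : ∀ k, l k ≤ u k) (t : ℝ≥0) :
    ∫ ω, stepIntegral s a l u B t ω ^ 2 ∂P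
      = ∫ x in Ioc 0 (t : ℝ), stepSum s a l u x ^ 2 := by
  have hinc : ∀ k, MemLp (fun ω => B (min (u k) t) ω - B (min (l k) t) ω) 2 P := fun k =>
    (memLp_brownian hB _).sub (memLp_brownian hB _)
  have hinc2 : ∀ k k', Integrable (fun ω => (B (min (u k) t) ω - B (min (l k) t) ω)
      * (B (min (u k') t) ω - B (min (l k') t) ω)) P := fun k k' =>
    (hinc k).integrable_mul (hinc k')
  have e1 : ∀ ω, stepIntegral s a l u B t ω ^ 2 = ∑ k ∈ s, ∑ k' ∈ s, (a k * a k')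
      * ((B (min (u k) t) ω - B (min (l k) t) ω) * (B (min (u k') t) ω - B (min (l k') t) ω)) :=
    fun ω => by
      rw [stepIntegral, sq, Finset.sum_mul_sum]
      exact Finset.sum_congr rfl fun k _ => Finset.sum_congr rfl fun k' _ => by ring
  have hind : ∀ k x, (Ioc (((min (l k) t : ℝ≥0) : ℝ)) ((min (u k) t : ℝ≥0) : ℝ)).indicator
      (fun _ => (1 : ℝ)) x = (Ioc 0 (t : ℝ)).indicator
        (fun x => (Ioc (l k : ℝ) (u k)).indicator (fun _ => (1 : ℝ)) x) x := fun k x => by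
    rw [indicator_indicator]
    congr 1
    ext y
    have := (l k).coe_nonneg
    simp only [mem_Ioc, mem_inter_iff, NNReal.coe_min]
    grind
  have e2 : ∀ x, (Ioc 0 (t : ℝ)).indicator (fun x => stepSum s a l u x ^ 2) x
      = ∑ k ∈ s, ∑ k' ∈ s, (a k * a k') *
        ((Ioc (((min (l k) t : ℝ≥0) : ℝ)) ((min (u k) t : ℝ≥0) : ℝ)).indicator (fun _ => (1 : ℝ)) x
        * (Ioc (((min (l k') t : ℝ≥0) : ℝ)) ((min (u k') t : ℝ≥0) : ℝ)).indicator
          (fun _ => (1 : ℝ)) x) := fun x => by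
    simp only [hind]
    by_cases hx : x ∈ Ioc 0 (t : ℝ)
    · simp only [indicator_of_mem hx, stepSum, sq, Finset.sum_mul_sum]
      exact Finset.sum_congr rfl fun k _ => Finset.sum_congr rfl fun k' _ => by ring
    · simp [indicator_of_notMem hx]
  rw [← integral_indicator measurableSet_Ioc]
  simp only [e1, e2]
  have hi : ∀ k k', Integrable (fun x : ℝ =>
      (Ioc (((min (l k) t : ℝ≥0) : ℝ)) ((min (u k) t : ℝ≥0) : ℝ)).indicator (fun _ => (1 : ℝ)) x
        * (Ioc (((min (l k') t : ℝ≥0) : ℝ)) ((min (u k') t : ℝ≥0) : ℝ)).indicator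
          (fun _ => (1 : ℝ)) x) := fun k k' =>
    (memLp_indicator_const 2 measurableSet_Ioc (1 : ℝ) (Or.inr (by simp))).integrable_mul
      (memLp_indicator_const 2 measurableSet_Ioc (1 : ℝ) (Or.inr (by simp)))
  rw [integral_finsetSum _ fun k _ => integrable_finsetSum _ fun k' _ =>
      (hinc2 k k').const_mul _,
    integral_finsetSum _ fun k _ => integrable_finsetSum _ fun k' _ => (hi k k').const_mul _]
  refine Finset.sum_congr rfl fun k _ => ?_
  rw [integral_finsetSum _ fun k' _ => (hinc2 k k').const_mul _,
    integral_finsetSum _ fun k' _ => (hi k k').const_mul _]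
  refine Finset.sum_congr rfl fun k' _ => ?_
  rw [integral_const_mul, integral_const_mul,
    integral_mul_increments hB (min_le_min_right t (hlu k)) (min_le_min_right t (hlu k'))]

lemma eLpNorm_two_le_of_integral_sq_le {α β : Type*} [MeasurableSpace α] [MeasurableSpace β]
    {μ : Measure α} {ν : Measure β} {f : α → ℝ} {g : β → ℝ} (hf : MemLp f 2 μ) (hg : MemLp g 2 ν)
    (h : ∫ x, f x ^ 2 ∂μ ≤ ∫ x, g x ^ 2 ∂ν) : eLpNorm f 2 μ ≤ eLpNorm g 2 ν := by
  rw [hf.eLpNorm_eq_integral_rpow_norm (by norm_num) (by norm_num),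
    hg.eLpNorm_eq_integral_rpow_norm (by norm_num) (by norm_num)]
  refine ENNReal.ofReal_le_ofReal (Real.rpow_le_rpow (integral_nonneg fun x => by positivity) ?_
    (by positivity))
  simpa using h

lemma eLpNorm_stepIntegral_le (hB : IsBrownianReal B P) (s : Finset ι) (a : ι → ℝ)
    {l u : ι → ℝ≥0} (hlu : ∀ k, l k ≤ u k) {T : ℝ} {t : ℝ≥0} (ht : (t : ℝ) ≤ T) :
    eLpNorm (stepIntegral s a l u B t) 2 P
      ≤ eLpNorm (stepSum s a l u) 2 (volume.restrict (Icc 0 T)) := by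
  refine eLpNorm_two_le_of_integral_sq_le (memLp_stepIntegral hB s a l u t)
    (memLp_stepSum s a l u _) ?_
  rw [integral_sq_stepIntegral hB s a hlu t]
  exact setIntegral_mono_set (memLp_stepSum s a l u _).integrable_sq
    (Eventually.of_forall fun x => sq_nonneg _)
    (Ioc_subset_Icc_self.trans (Icc_subset_Icc le_rfl ht)).eventuallyLE

/-- A Brownian motion stopped at a deterministic time is a martingale. -/
lemma martingale_stopped_brownian (hB : IsBrownianReal B P) (hm : ∀ t, StronglyMeasurable (B t))
    (u : ℝ≥0) : Martingale (fun t => B (min u t)) (Filtration.natural B hm) P := by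
  have : IsProbabilityMeasure P := hB.isGaussianProcess.isProbabilityMeasure
  have had := Filtration.stronglyAdapted_natural hm
  set ℱ := Filtration.natural B hm
  have hint : ∀ t, Integrable (B t) P := hB.integrable_eval
  refine ⟨fun t => (had _).mono (ℱ.mono (min_le_right u t)), fun i j hij => ?_⟩
  change P[B (min u j) | ℱ i] =ᵐ[P] B (min u i)
  rcases le_total u i with hui | hui
  · rw [min_eq_left hui, min_eq_left (hui.trans hij),
      condExp_of_stronglyMeasurable (ℱ.le i) ((had u).mono (ℱ.mono hui)) (hint u)]
  · rw [min_eq_right hui]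
    have hi : i ≤ min u j := le_min hui hij
    obtain ⟨r, hr⟩ := exists_add_of_le hi
    have hind := hB.indepFun_shift i
    rw [IndepFun_iff_Indep, ← Filtration.natural_eq_comap B hm i] at hind
    have hsm : StronglyMeasurable[MeasurableSpace.comap (fun ω t => B (i + t) ω - B i ω)
        inferInstance] (fun ω => B (i + r) ω - B i ω) := by
      have h1 := (measurable_pi_apply (X := fun _ : ℝ≥0 => ℝ) r).comp
        (comap_measurable fun ω t => B (i + t) ω - B i ω)
      exact h1.stronglyMeasurable
    have hle : MeasurableSpace.comap (fun ω t => B (i + t) ω - B i ω) inferInstance ≤ mΩ :=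
      (measurable_pi_lambda _ fun t =>
        ((hm _).measurable.sub (hm _).measurable)).comap_le
    have h0 := condExp_indep_eq hle (ℱ.le i) hsm hind
    have e : B (min u j) = (fun ω => B (i + r) ω - B i ω) + B i := by
      ext ω; simp [hr]
    rw [e]
    filter_upwards [condExp_add ((hint (i + r)).sub (hint i)) (hint i) (ℱ i), h0] with ω h1 h2
    have h3 : (P[fun ω => B (i + r) ω - B i ω | ℱ i]) ω = 0 := by
      rw [h2, integral_sub (hint _) (hint _), hB.integral_eval, hB.integral_eval, sub_zero]
    rw [condExp_of_stronglyMeasurable (ℱ.le i) (had i) (hint i)] at h1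
    refine h1.trans ?_
    have h4 : (P[B (i + r) - B i | ℱ i]) ω = 0 := h3
    rw [Pi.add_apply, h4, zero_add]

lemma martingale_stepIntegral (hB : IsBrownianReal B P) (hm : ∀ t, StronglyMeasurable (B t))
    (s : Finset ι) (a : ι → ℝ) (l u : ι → ℝ≥0) :
    Martingale (stepIntegral s a l u B) (Filtration.natural B hm) P := by
  classical
  induction s using Finset.induction_on with
  | empty =>
    have : stepIntegral ∅ a l u B = 0 := by ext; simp [stepIntegral]
    rw [this]
    exact martingale_zero _ _ _
  | insert k s hk ih =>
    have : stepIntegral (insert k s) a l u B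
        = a k • ((fun t => B (min (u k) t)) - fun t => B (min (l k) t)) + stepIntegral s a l u B := by
      ext t ω
      simp [stepIntegral, Finset.sum_insert hk]
    rw [this]
    exact (((martingale_stopped_brownian hB hm _).sub
      (martingale_stopped_brownian hB hm _)).smul _).add ih

lemma continuous_stepIntegral (hB : IsBrownianReal B P) (s : Finset ι) (a : ι → ℝ)
    (l u : ι → ℝ≥0) : ∀ᵐ ω ∂P, Continuous fun t => stepIntegral s a l u B t ω := by
  filter_upwards [hB.cont] with ω h
  unfold stepIntegral
  fun_prop

end StepIntegral

section Maximal

variable {Ω : Type*} [mΩ : MeasurableSpace Ω] {P : Measure Ω} [IsProbabilityMeasure P]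

/-- Doob's maximal inequality for a martingale sampled at finitely many times, with the `L²` norm in
place of the first moment. -/
lemma maximal_ineq_sampled {ℱ : Filtration ℝ≥0 mΩ} {S : ℝ≥0 → Ω → ℝ} (hS : Martingale S ℱ P)
    (hS2 : ∀ t, MemLp (S t) 2 P) (ε : ℝ≥0) {τ : ℕ → ℝ≥0} (hτ : Monotone τ) (N : ℕ) :
    ε * P {ω | ∃ r ≤ N, ε ≤ |S (τ r) ω|} ≤ eLpNorm (S (τ N)) 2 P := by
  let 𝒢 : Filtration ℕ mΩ := ⟨fun r => ℱ (τ r), fun r r' h => ℱ.mono (hτ h), fun r => ℱ.le _⟩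
  have hM : Martingale (fun r => S (τ r)) 𝒢 P :=
    ⟨fun r => hS.1 (τ r), fun i j hij => hS.2 _ _ (hτ hij)⟩
  have hsub : Submartingale (fun r ω => |S (τ r) ω|) 𝒢 P :=
    hM.submartingale.sup hM.neg.submartingale
  have h := maximal_ineq hsub (fun r ω => abs_nonneg _) (ε := ε) N
  have hset : {ω | ∃ r ≤ N, ε ≤ |S (τ r) ω|} = {ω | (ε : ℝ) ≤ (Finset.range (N + 1)).sup'
      Finset.nonempty_range_add_one fun k => |S (τ k) ω|} := by
    ext ω
    simp [Finset.le_sup'_iff]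
  rw [hset]
  refine h.trans ?_
  calc _ ≤ ENNReal.ofReal (∫ ω, |S (τ N) ω| ∂P) := ENNReal.ofReal_le_ofReal
        (setIntegral_le_integral ((hS2 _).integrable (by norm_num)).abs
          (Eventually.of_forall fun ω => abs_nonneg _))
    _ = eLpNorm (S (τ N)) 1 P := by
        rw [eLpNorm_one_eq_lintegral_enorm]
        exact ofReal_integral_norm_eq_lintegral_enorm ((hS2 _).integrable (by norm_num))
    _ ≤ _ := eLpNorm_le_eLpNorm_of_exponent_le (by norm_num) (hS2 _).1

/-- Doob's maximal inequality for a martingale with continuous paths. -/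
lemma maximal_ineq_continuous {ℱ : Filtration ℝ≥0 mΩ} {S : ℝ≥0 → Ω → ℝ} (hS : Martingale S ℱ P)
    (hS2 : ∀ t, MemLp (S t) 2 P) (hc : ∀ᵐ ω ∂P, Continuous fun t => S t ω) (ε T : ℝ≥0) :
    ε * P {ω | ∃ t ≤ T, ε < |S t ω|} ≤ eLpNorm (S T) 2 P := by
  let τ : ℕ → ℕ → ℝ≥0 := fun m r => min ((r : ℝ≥0) / 2 ^ m) T
  -- level `m` of the grid covers `[0, T]` as soon as it has `2 ^ m * (⌈T⌉ + 1)` points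
  let N : ℕ → ℕ := fun m => 2 ^ m * (⌈T⌉₊ + 1)
  let E : ℕ → Set Ω := fun m => {ω | ∃ r ≤ N m, ε ≤ |S (τ m r) ω|}
  have hN : ∀ m, τ m (N m) = T := fun m => by
    refine min_eq_right ?_
    rw [le_div_iff₀ (by positivity)]
    have := Nat.le_ceil T
    simp only [N]
    push_cast
    rw [mul_comm]
    gcongr
    exact this.trans (by simp)
  have hE : Monotone E := by
    refine monotone_nat_of_le_succ fun m ω => ?_
    rintro ⟨r, hr, h⟩
    refine ⟨2 * r, ?_, ?_⟩
    · simp only [N, pow_succ] at hr ⊢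
      nlinarith
    · have : τ (m + 1) (2 * r) = τ m r := by
        simp only [τ]
        congr 1
        push_cast
        rw [pow_succ, mul_comm ((2 : ℝ≥0) ^ m), mul_div_mul_left _ _ (by norm_num)]
      rwa [this]
  have hsub : ({ω | ∃ t ≤ T, ε < |S t ω|} : Set Ω) ≤ᵐ[P] ⋃ m, E m := by
    filter_upwards [hc] with ω hω
    rintro ⟨t, ht, h⟩
    have hlim : Tendsto (fun m => min (dyadicFloor m t).toNNReal T) atTop (𝓝 t) := by
      have h1 := (tendsto_dyadicFloor t.coe_nonneg)
      have h2 := (continuous_real_toNNReal.tendsto _).comp h1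
      rw [Real.toNNReal_coe] at h2
      have h3 := h2.min (tendsto_const_nhds (x := T))
      rwa [min_eq_left ht] at h3
    have h4 := ((hω.abs.tendsto t).comp hlim).eventually (lt_mem_nhds h)
    obtain ⟨m, hm⟩ := h4.exists
    refine mem_iUnion.2 ⟨m, ⌊(2 : ℝ) ^ m * t⌋₊, ?_, ?_⟩
    · refine Nat.floor_le_of_le ?_
      have h5 : (t : ℝ) ≤ ⌈T⌉₊ := by
        have := ht.trans (Nat.le_ceil T)
        exact_mod_cast this
      simp only [N]
      push_cast
      gcongr
      linarith
    · have : τ m ⌊(2 : ℝ) ^ m * t⌋₊ = min (dyadicFloor m t).toNNReal T := by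
        simp only [τ]
        congr 1
        apply NNReal.coe_injective
        rw [Real.coe_toNNReal _ (dyadicFloor_nonneg _ _)]
        simp [dyadicFloor]
      rw [this]
      exact hm.le
  calc ε * P {ω | ∃ t ≤ T, ε < |S t ω|} ≤ ε * P (⋃ m, E m) := by
        gcongr ε * ?_
        exact measure_mono_ae hsub
    _ = ⨆ m, ε * P (E m) := by rw [hE.measure_iUnion, ENNReal.mul_iSup]
    _ ≤ _ := iSup_le fun m => by
        have hτ : Monotone (τ m) := fun r r' h => by
          simp only [τ]
          gcongr
        have := maximal_ineq_sampled hS hS2 ε hτ (N m)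
        rwa [hN m] at this

/-- A sequence of continuous martingales which converges geometrically in `L²` at time `T` converges
uniformly on `[0, T]`, almost surely. -/
lemma ae_uniformCauchySeqOn {ℱ : Filtration ℝ≥0 mΩ} {S : ℕ → ℝ≥0 → Ω → ℝ}
    (hS : ∀ k, Martingale (S k) ℱ P) (hS2 : ∀ k t, MemLp (S k t) 2 P)
    (hc : ∀ k, ∀ᵐ ω ∂P, Continuous fun t => S k t ω) {T : ℝ≥0} {C : ℝ≥0}
    (hb : ∀ k, eLpNorm (S k T - S (k + 1) T) 2 P ≤ C * (1 / 4) ^ k) :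
    ∀ᵐ ω ∂P, UniformCauchySeqOn (fun k t => S k t ω) atTop (Iic T) := by
  -- the probabilities of these events are summable, so Borel-Cantelli applies
  let E : ℕ → Set Ω := fun k => {ω | ∃ t ≤ T, ((1 / 2 : ℝ≥0) ^ k : ℝ≥0) < |(S k - S (k + 1)) t ω|}
  have hE : ∀ k, P (E k) ≤ C * (1 / 2) ^ k := fun k => by
    have h1 := maximal_ineq_continuous ((hS k).sub (hS (k + 1)))
      (fun t => (hS2 k t).sub (hS2 (k + 1) t)) (by
        filter_upwards [hc k, hc (k + 1)] with ω h h'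
        exact h.sub h') ((1 / 2) ^ k) T
    have h2 := h1.trans (hb k)
    calc P (E k) = 2 ^ k * ((((1 / 2 : ℝ≥0) ^ k : ℝ≥0) : ℝ≥0∞) * P (E k)) := by
          rw [← mul_assoc]
          have : (2 : ℝ≥0∞) ^ k * (((1 / 2 : ℝ≥0) ^ k : ℝ≥0) : ℝ≥0∞) = 1 := by
            have : ((2 : ℝ≥0) ^ k * (1 / 2 : ℝ≥0) ^ k) = 1 := by
              rw [← mul_pow]; norm_num
            exact_mod_cast this
          rw [this, one_mul]
      _ ≤ 2 ^ k * (C * (1 / 4) ^ k) := by gcongr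
      _ = C * (1 / 2) ^ k := by
          have : (2 : ℝ≥0) ^ k * (C * (1 / 4) ^ k) = C * (1 / 2) ^ k := by
            rw [mul_left_comm, ← mul_pow]; norm_num
          have h' := congrArg ((↑) : ℝ≥0 → ℝ≥0∞) this
          push_cast at h'
          simpa using h'
  have hsum : ∑' k, P (E k) ≠ ⊤ := by
    refine ne_top_of_le_ne_top ?_ (ENNReal.tsum_le_tsum hE)
    rw [ENNReal.tsum_mul_left]
    refine ENNReal.mul_ne_top (by simp) ?_
    simp [ENNReal.tsum_geometric]
  filter_upwards [ae_eventually_notMem hsum] with ω hω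
  obtain ⟨K, hK⟩ := eventually_atTop.1 hω
  have hstep : ∀ k ≥ K, ∀ t ≤ T, |S k t ω - S (k + 1) t ω| ≤ (1 / 2 : ℝ) ^ k := fun k hk t ht => by
    have := hK k hk
    simp only [E, mem_ofPred_eq, not_exists, not_and, not_lt] at this
    simpa using this t ht
  have htel : ∀ k ≥ K, ∀ j, ∀ t ≤ T,
      |S k t ω - S (k + j) t ω| ≤ 2 * (1 / 2 : ℝ) ^ k - 2 * (1 / 2 : ℝ) ^ (k + j) := by
    intro k hk j t ht
    induction j with
    | zero => simp
    | succ j ih =>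
      have h1 := hstep (k + j) (by omega) t ht
      have h2 := abs_sub_le (S k t ω) (S (k + j) t ω) (S (k + j + 1) t ω)
      rw [← add_assoc, pow_succ]
      linarith
  rw [Metric.uniformCauchySeqOn_iff]
  intro ε hε
  obtain ⟨L, hL⟩ := exists_pow_lt_of_lt_one (show 0 < ε / 4 by linarith)
    (show (1 / 2 : ℝ) < 1 by norm_num)
  refine ⟨max K L, fun k hk l hl t ht => ?_⟩
  have hpow : (1 / 2 : ℝ) ^ max K L ≤ (1 / 2) ^ L :=
    pow_le_pow_of_le_one (by norm_num) (by norm_num) (le_max_right _ _)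
  have hbd : ∀ i ≥ max K L, |S (max K L) t ω - S i t ω| ≤ 2 * (1 / 2) ^ max K L := fun i hi => by
    obtain ⟨j, rfl⟩ := exists_add_of_le hi
    have h1 := htel (max K L) (le_max_left _ _) j t ht
    have h2 : 0 < (1 / 2 : ℝ) ^ (max K L + j) := by positivity
    linarith
  have h1 := hbd k hk
  have h2 := hbd l hl
  have h3 := abs_sub_le (S k t ω) (S (max K L) t ω) (S l t ω)
  rw [abs_sub_comm (S k t ω) (S (max K L) t ω)] at h3
  rw [Real.dist_eq]
  linarith

end Maximal

/-! ### Elementary integrals against a Wiener process -/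

lemma eLpNorm_pi_le_sum {α : Type*} [MeasurableSpace α] {μ : Measure α} {k : ℕ}
    {f : α → Fin k → ℝ} (hf : ∀ i, AEStronglyMeasurable (fun x => f x i) μ) :
    eLpNorm f 2 μ ≤ ∑ i, eLpNorm (fun x => f x i) 2 μ := by
  calc eLpNorm f 2 μ ≤ eLpNorm (∑ i, fun x => |f x i|) 2 μ := by
        refine eLpNorm_mono fun x => ?_
        rw [Finset.sum_apply, Real.norm_of_nonneg (Finset.sum_nonneg fun i _ => abs_nonneg _)]
        refine (pi_norm_le_iff_of_nonneg (Finset.sum_nonneg fun i _ => abs_nonneg _)).2 fun i => ?_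
        exact Finset.single_le_sum (f := fun i => |f x i|) (fun _ _ => abs_nonneg _)
          (Finset.mem_univ i)
    _ ≤ ∑ i, eLpNorm (fun x => |f x i|) 2 μ :=
        eLpNorm_sum_le (fun i _ => (hf i).norm) (by norm_num)
    _ = _ := Finset.sum_congr rfl fun i _ => eLpNorm_norm fun x => f x i

namespace LQ

section

variable {n : ℕ} {Ω : Type*} {m : MeasurableSpace Ω} {W : ℝ≥0 → Ω → Fin n → ℝ}

/-- The elementary integral of the `(i, j)` entry of a step function against the `j`-th component. -/
def StepFn.entryIntegral (φ : StepFn n) (W : ℝ≥0 → Ω → Fin n → ℝ) (i j : Fin n) (t : ℝ≥0) (ω : Ω) :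
    ℝ :=
  stepIntegral (Finset.range φ.N) (fun k => φ.c k i j) φ.τ (fun k => φ.τ (k + 1))
    (fun t ω => W t ω j) t ω

lemma StepFn.integral_apply (φ : StepFn n) (t : ℝ≥0) (ω : Ω) (i : Fin n) :
    φ.integral W t ω i = ∑ j, φ.entryIntegral W i j t ω := by
  simp only [StepFn.integral, StepFn.entryIntegral, stepIntegral, Finset.sum_apply, Matrix.mulVec,
    dotProduct, Pi.sub_apply]
  exact Finset.sum_comm

lemma StepFn.measurable_integral (φ : StepFn n) {t : ℝ≥0}
    (hm : ∀ s ≤ t, Measurable[m] (W s)) : Measurable[m] (φ.integral W t) := by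
  refine measurable_pi_lambda _ fun i => ?_
  simp only [StepFn.integral_apply, StepFn.entryIntegral, stepIntegral]
  refine Finset.measurable_fun_sum _ fun j _ => Finset.measurable_fun_sum _ fun k _ => ?_
  exact (((measurable_pi_apply j).comp (hm _ (min_le_right _ _))).sub
    ((measurable_pi_apply j).comp (hm _ (min_le_right _ _)))).const_mul _

end

variable {n : ℕ} {Ω : Type*} [mΩ : MeasurableSpace Ω] {P : Measure Ω} {W : ℝ≥0 → Ω → Fin n → ℝ}
  {T : ℝ}

lemma StepFn.eval_apply (φ : StepFn n) (s : ℝ) (i j : Fin n) :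
    φ.eval s i j = stepSum (Finset.range φ.N) (fun k => φ.c k i j) φ.τ
      (fun k => φ.τ (k + 1)) s := by
  simp only [StepFn.eval, stepSum, Matrix.sum_apply]
  refine Finset.sum_congr rfl fun k _ => ?_
  by_cases h : s ∈ Ioc (φ.τ k : ℝ) (φ.τ (k + 1) : ℝ)
  · simp only [indicator_of_mem h, mul_one]
  · simp only [indicator_of_notMem h, mul_zero, Matrix.zero_apply]

lemma StepFn.memLp_entryIntegral (hW : IsWienerProcess W P) (φ : StepFn n) (i j : Fin n)
    (t : ℝ≥0) : MemLp (φ.entryIntegral W i j t) 2 P :=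
  memLp_stepIntegral (hW.brownian j) _ _ _ _ _

/-- The `L²` bound for the difference of two elementary integrals. No common refinement of the two
partitions is needed, as elementary integrals over overlapping intervals are allowed. -/
lemma StepFn.eLpNorm_entryIntegral_sub_le (hW : IsWienerProcess W P) (φ ψ : StepFn n) {t : ℝ≥0}
    (ht : (t : ℝ) ≤ T) (i j : Fin n) :
    eLpNorm (φ.entryIntegral W i j t - ψ.entryIntegral W i j t) 2 P
      ≤ eLpNorm (fun s => φ.eval s i j - ψ.eval s i j) 2 (volume.restrict (Icc 0 T)) := by
  set s := (Finset.range φ.N).disjSum (Finset.range ψ.N)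
  set a : ℕ ⊕ ℕ → ℝ := Sum.elim (fun k => φ.c k i j) (fun k => -ψ.c k i j)
  set l : ℕ ⊕ ℕ → ℝ≥0 := Sum.elim φ.τ ψ.τ
  set u : ℕ ⊕ ℕ → ℝ≥0 := Sum.elim (fun k => φ.τ (k + 1)) (fun k => ψ.τ (k + 1))
  have hlu : ∀ k, l k ≤ u k := by
    rintro (k | k)
    · exact φ.mono (Nat.le_succ k)
    · exact ψ.mono (Nat.le_succ k)
  have e1 : φ.entryIntegral W i j t - ψ.entryIntegral W i j t
      = stepIntegral s a l u (fun t ω => W t ω j) t := by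
    ext ω
    simp [StepFn.entryIntegral, stepIntegral, s, a, l, u, Finset.sum_disjSum, sub_eq_add_neg]
  have e2 : (fun s => φ.eval s i j - ψ.eval s i j) = stepSum s a l u := by
    ext x
    rw [φ.eval_apply, ψ.eval_apply]
    simp [stepSum, s, a, l, u, Finset.sum_disjSum, sub_eq_add_neg]
  rw [e1, e2]
  exact eLpNorm_stepIntegral_le (hW.brownian j) s a hlu ht

lemma StepFn.memLp_eval (φ : StepFn n) (i j : Fin n) :
    MemLp (fun s => φ.eval s i j) 2 (volume.restrict (Icc 0 T)) := by
  simp only [StepFn.eval_apply]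
  exact memLp_stepSum _ _ _ _ _

lemma StepFn.memLp_integral (hW : IsWienerProcess W P) (φ : StepFn n) (t : ℝ≥0) :
    MemLp (φ.integral W t) 2 P := by
  refine memLp_pi_iff.2 fun i => ?_
  simp only [StepFn.integral_apply]
  exact memLp_finsetSum _ fun j _ => φ.memLp_entryIntegral hW i j t

/-- The triangle inequality over the entries, so that no correlations between different components
of `W` enter. -/
lemma StepFn.eLpNorm_integral_sub_le (hW : IsWienerProcess W P) (φ ψ : StepFn n) {t : ℝ}
    (ht : t ∈ Icc 0 T) :
    eLpNorm (fun ω => φ.integral W t.toNNReal ω - ψ.integral W t.toNNReal ω) 2 P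
      ≤ ∑ i, ∑ j, eLpNorm (fun s => φ.eval s i j - ψ.eval s i j) 2 (volume.restrict (Icc 0 T)) := by
  refine (eLpNorm_pi_le_sum fun i => ((memLp_pi_iff.1 (φ.memLp_integral hW _) i).sub
    (memLp_pi_iff.1 (ψ.memLp_integral hW _) i)).1).trans (Finset.sum_le_sum fun i _ => ?_)
  have e : (fun ω => (φ.integral W t.toNNReal ω - ψ.integral W t.toNNReal ω) i)
      = ∑ j, (φ.entryIntegral W i j t.toNNReal - ψ.entryIntegral W i j t.toNNReal) := by
    ext ω
    simp [StepFn.integral_apply]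
  refine (congrArg (fun f => eLpNorm f 2 P) e).trans_le ?_
  refine (eLpNorm_sum_le (fun j _ => ((φ.memLp_entryIntegral hW i j _).sub
    (ψ.memLp_entryIntegral hW i j _)).1) (by norm_num)).trans (Finset.sum_le_sum fun j _ => ?_)
  exact StepFn.eLpNorm_entryIntegral_sub_le hW φ ψ
    (by rw [Real.coe_toNNReal _ ht.1]; exact ht.2) i j

variable {σ : ℝ → Matrix (Fin n) (Fin n) ℝ} {M M' : ℝ → Ω → Fin n → ℝ}

/-- The Wiener integral at a given time is unique up to null sets. -/
lemma IsWienerIntegral.ae_eq (hW : IsWienerProcess W P)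
    (hσ : ∀ i j, AEStronglyMeasurable (fun t => σ t i j) (volume.restrict (Icc 0 T)))
    (hM : IsWienerIntegral T σ W P M) (hM' : IsWienerIntegral T σ W P M') {t : ℝ}
    (ht : t ∈ Icc 0 T) : M t =ᵐ[P] M' t := by
  obtain ⟨hMm, φ, hφ, hφM⟩ := hM
  obtain ⟨hMm', ψ, hψ, hψM⟩ := hM'
  have hb : ∀ k, eLpNorm (M t - M' t) 2 P
      ≤ eLpNorm (fun ω => (φ k).integral W t.toNNReal ω - M t ω) 2 P
        + (∑ i, ∑ j, (eLpNorm (fun s => (φ k).eval s i j - σ s i j) 2 (volume.restrict (Icc 0 T))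
          + eLpNorm (fun s => (ψ k).eval s i j - σ s i j) 2 (volume.restrict (Icc 0 T)))
        + eLpNorm (fun ω => (ψ k).integral W t.toNNReal ω - M' t ω) 2 P) := fun k => by
    have m1 : AEStronglyMeasurable (fun ω => (φ k).integral W t.toNNReal ω - M t ω) P :=
      ((φ k).memLp_integral hW _).1.sub (hMm t ht)
    have m2 : AEStronglyMeasurable (fun ω => (ψ k).integral W t.toNNReal ω - M' t ω) P :=
      ((ψ k).memLp_integral hW _).1.sub (hMm' t ht)
    have m3 : AEStronglyMeasurable
        (fun ω => (φ k).integral W t.toNNReal ω - (ψ k).integral W t.toNNReal ω) P :=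
      ((φ k).memLp_integral hW _).1.sub ((ψ k).memLp_integral hW _).1
    have e : M t - M' t = (fun ω => (φ k).integral W t.toNNReal ω
        - (ψ k).integral W t.toNNReal ω) + (fun ω => (ψ k).integral W t.toNNReal ω - M' t ω)
        - (fun ω => (φ k).integral W t.toNNReal ω - M t ω) := by
      ext ω i
      simp
    rw [e]
    refine (eLpNorm_sub_le (m3.add m2) m1 (by norm_num)).trans ?_
    rw [add_comm]
    gcongr
    refine (eLpNorm_add_le m3 m2 (by norm_num)).trans ?_
    gcongr
    refine (StepFn.eLpNorm_integral_sub_le hW (φ k) (ψ k) ht).trans ?_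
    gcongr with i _ j _
    have e' : (fun s => (φ k).eval s i j - (ψ k).eval s i j)
        = (fun s => (φ k).eval s i j - σ s i j) - fun s => (ψ k).eval s i j - σ s i j := by
      ext s
      simp
    rw [e']
    exact eLpNorm_sub_le (((φ k).memLp_eval i j).1.sub (hσ i j))
      (((ψ k).memLp_eval i j).1.sub (hσ i j)) (by norm_num)
  have hlim := (hφM t ht).add ((tendsto_finsetSum Finset.univ fun i _ =>
    tendsto_finsetSum Finset.univ fun j _ => (hφ i j).add (hψ i j)).add (hψM t ht))
  have h0 : eLpNorm (M t - M' t) 2 P = 0 := by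
    refine le_antisymm ?_ bot_le
    simpa using ge_of_tendsto' hlim hb
  have h1 := (eLpNorm_eq_zero_iff ((hMm t ht).sub (hMm' t ht)) (by norm_num)).1 h0
  filter_upwards [h1] with ω hω
  simpa [sub_eq_zero] using hω

/-- The step function with values `g (k h)` on `(k h, (k + 1) h]`, `k < N`. -/
noncomputable def StepFn.ofGrid (g : ℝ → Fin n → Fin n → ℝ) (h : ℝ≥0) (N : ℕ) : StepFn n where
  N := N
  τ k := k * h
  mono k l hkl := by dsimp only; gcongr
  c k := Matrix.of (g (k * h))

lemma StepFn.ofGrid_eval (g : ℝ → Fin n → Fin n → ℝ) {h : ℝ≥0} (hh : 0 < h) (N : ℕ) {s : ℝ}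
    (hs : s ∈ Ioc 0 (N * h : ℝ)) :
    ∃ k : ℕ, (k * h : ℝ) < s ∧ s ≤ (k + 1) * h ∧
      ∀ i j, (StepFn.ofGrid g h N).eval s i j = g (k * h) i j := by
  have hh' : (0 : ℝ) < h := hh
  have hpos : 0 < ⌈s / h⌉₊ := Nat.ceil_pos.2 (div_pos hs.1 hh')
  obtain ⟨k, hk⟩ := Nat.exists_eq_succ_of_ne_zero hpos.ne'
  have h1 : (k * h : ℝ) < s := by
    rw [← lt_div_iff₀ hh']
    exact Nat.lt_ceil.1 (by omega)
  have h2 : s ≤ (k + 1) * h := by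
    rw [← div_le_iff₀ hh']
    exact_mod_cast hk ▸ Nat.le_ceil (s / h)
  have hkN : k < N := by
    have : (k * h : ℝ) < N * h := h1.trans_le hs.2
    exact_mod_cast lt_of_mul_lt_mul_right this hh'.le
  refine ⟨k, h1, h2, fun i j => ?_⟩
  rw [StepFn.eval_apply, stepSum, Finset.sum_eq_single k]
  · simp [StepFn.ofGrid, h1, h2]
  · intro l _ hlk
    rw [indicator_of_notMem, mul_zero]
    simp only [StepFn.ofGrid, mem_Ioc, not_and, not_le]
    push_cast
    intro hl
    rcases lt_or_gt_of_ne hlk with hlt | hlt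
    · refine lt_of_le_of_lt ?_ h1
      have : ((l + 1 : ℕ) : ℝ) ≤ k := by exact_mod_cast hlt
      push_cast at this
      gcongr
    · exfalso
      have : ((k + 1 : ℕ) : ℝ) ≤ l := by exact_mod_cast hlt
      push_cast at this
      have h3 : ((k : ℝ) + 1) * h ≤ l * h := by gcongr
      linarith
  · intro h3
    exact absurd (Finset.mem_range.2 hkN) h3

/-- Step functions are dense in `L²(0, T)`. -/
lemma exists_stepFn_eLpNorm_le (hT : 0 < T)
    (hσ : ∀ i j, MemLp (fun t => σ t i j) 2 (volume.restrict (Icc 0 T))) {ε : ℝ≥0∞} (hε : ε ≠ 0) :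
    ∃ φ : StepFn n, ∀ i j,
      eLpNorm (fun s => φ.eval s i j - σ s i j) 2 (volume.restrict (Icc 0 T)) ≤ ε := by
  choose g hg hgm using fun i j =>
    (hσ i j).exists_boundedContinuous_eLpNorm_sub_le (by norm_num) (ENNReal.half_pos hε).ne'
  let G : ℝ → Fin n → Fin n → ℝ := fun s i j => g i j s
  have hGc : Continuous G := continuous_pi fun i => continuous_pi fun j => (g i j).continuous
  have hGu := isCompact_Icc.uniformContinuousOn_of_continuous (hGc.continuousOn (s := Icc 0 T))
  -- the oscillation of `G` allowed on each grid interval, so that the `L²` error is at most `ε / 2`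
  obtain ⟨η, hη0, hη⟩ : ∃ η : ℝ≥0, 0 < η ∧
      (volume.restrict (Icc 0 T)) Set.univ ^ (2 : ℝ≥0∞).toReal⁻¹ * ENNReal.ofReal η ≤ ε / 2 := by
    set V := (volume.restrict (Icc 0 T)) Set.univ ^ (2 : ℝ≥0∞).toReal⁻¹
    have hV : V ≠ ⊤ := ENNReal.rpow_ne_top_of_nonneg (by simp) (measure_ne_top _ _)
    have hlim : Tendsto (fun x : ℝ≥0∞ => V * x) (𝓝 0) (𝓝 0) := by
      simpa using ENNReal.Tendsto.const_mul (a := V) (tendsto_id (x := 𝓝 (0 : ℝ≥0∞))) (Or.inr hV)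
    have hev := (ENNReal.tendsto_nhds_zero.1 hlim) (ε / 2) (ENNReal.half_pos hε)
    obtain ⟨δ, hδ, hδ'⟩ := ENNReal.nhds_zero_basis.mem_iff.1 hev
    obtain ⟨η, hη, hη'⟩ := ENNReal.lt_iff_exists_nnreal_btwn.1 hδ
    refine ⟨η, by exact_mod_cast hη, ?_⟩
    rw [ENNReal.ofReal_coe_nnreal]
    exact hδ' hη'
  obtain ⟨δ, hδ0, hδ⟩ := Metric.uniformContinuousOn_iff.1 hGu η hη0
  obtain ⟨N, hN⟩ := exists_nat_gt (T / δ)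
  have hN0 : 0 < N := by
    have : (0 : ℝ) < N := (div_pos hT hδ0).trans hN
    exact_mod_cast this
  have hN0' : (0 : ℝ) < N := by exact_mod_cast hN0
  set h : ℝ≥0 := ⟨T / N, by positivity⟩
  have hh : (h : ℝ) = T / N := rfl
  have hh0 : 0 < h := by
    have : (0 : ℝ) < h := by rw [hh]; positivity
    exact_mod_cast this
  have hNh : (N * h : ℝ) = T := by rw [hh]; field_simp
  have hhδ : (h : ℝ) < δ := by
    rw [hh, div_lt_iff₀ hN0']
    rw [div_lt_iff₀ hδ0] at hN
    linarith
  refine ⟨StepFn.ofGrid G h N, fun i j => ?_⟩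
  set φ := StepFn.ofGrid G h N
  have hclose : ∀ s ∈ Ioc 0 T, |φ.eval s i j - g i j s| ≤ η := fun s hs => by
    obtain ⟨k, h1, h2, h3⟩ := StepFn.ofGrid_eval G hh0 N (s := s) (by rwa [hNh])
    rw [h3]
    have h4 : dist (G (k * h)) (G s) < η := by
      refine hδ _ ⟨by positivity, h1.le.trans hs.2⟩ _ ⟨hs.1.le, hs.2⟩ ?_
      rw [Real.dist_eq, abs_lt]
      constructor <;> nlinarith
    exact ((dist_le_pi_dist (G (k * h) i) (G s i) j).trans (dist_le_pi_dist (G (k * h)) (G s) i)).trans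
      h4.le
  have m1 : AEStronglyMeasurable (fun s => φ.eval s i j - g i j s) (volume.restrict (Icc 0 T)) :=
    (φ.memLp_eval i j).1.sub (hgm i j).1
  have m2 : AEStronglyMeasurable (fun s => σ s i j - g i j s) (volume.restrict (Icc 0 T)) :=
    (hσ i j).1.sub (hgm i j).1
  have e : (fun s => φ.eval s i j - σ s i j)
      = (fun s => φ.eval s i j - g i j s) - fun s => σ s i j - g i j s := by
    ext s
    simp
  rw [e]
  refine (eLpNorm_sub_le m1 m2 (by norm_num)).trans ?_
  rw [← ENNReal.add_halves ε]
  refine add_le_add ?_ (hg i j)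
  refine (eLpNorm_le_of_ae_bound (C := η) ?_).trans hη
  rw [← Measure.restrict_congr_set Ioc_ae_eq_Icc]
  filter_upwards [ae_restrict_mem measurableSet_Ioc] with s hs using hclose s hs

end LQ

/-! ### Existence of a continuous Wiener integral -/

namespace LQ

variable {n : ℕ} {Ω : Type*} [mΩ : MeasurableSpace Ω] {P : Measure Ω} {W : ℝ≥0 → Ω → Fin n → ℝ}
  {T : ℝ} {σ : ℝ → Matrix (Fin n) (Fin n) ℝ}

/-- The elementary integrals of step functions which converge geometrically to `σ` converge uniformly
in time, almost surely; this gives the Wiener integral continuous paths. -/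
lemma exists_continuous_wienerIntegral [IsProbabilityMeasure P] (hT : 0 < T)
    (hW : IsWienerProcess W P)
    (hσ : ∀ i j, MemLp (fun t => σ t i j) 2 (volume.restrict (Icc 0 T)))
    {x₀ : Ω → Fin n → ℝ} :
    ∃ M : ℝ → Ω → Fin n → ℝ, IsWienerIntegral T σ W P M ∧
      (∀ᵐ ω ∂P, ContinuousOn (fun t => M t ω) (Icc 0 T)) ∧
      (∀ t ∈ Icc 0 T, StronglyMeasurable[history x₀ W t] (M t)) ∧
      ∃ K : ℝ≥0∞, K ≠ ⊤ ∧ ∀ t ∈ Icc 0 T, eLpNorm (M t) 2 P ≤ K := by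
  choose φ hφ using fun k : ℕ => exists_stepFn_eLpNorm_le hT hσ
    (ε := (1 / 4) ^ k) (pow_ne_zero _ (by simp))
  let I : ℕ → ℝ → Ω → Fin n → ℝ := fun k t => (φ k).integral W t.toNNReal
  have hdiff : ∀ k l, k ≤ l → ∀ i j, eLpNorm (fun s => (φ k).eval s i j - (φ l).eval s i j) 2
      (volume.restrict (Icc 0 T)) ≤ 2 * (1 / 4) ^ k := fun k l hkl i j => by
    have e : (fun s => (φ k).eval s i j - (φ l).eval s i j)
        = (fun s => (φ k).eval s i j - σ s i j) - fun s => (φ l).eval s i j - σ s i j := by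
      ext s; simp
    rw [e]
    refine (eLpNorm_sub_le (((φ k).memLp_eval i j).1.sub (hσ i j).1)
      (((φ l).memLp_eval i j).1.sub (hσ i j).1) (by norm_num)).trans ?_
    rw [two_mul]
    refine add_le_add (hφ k i j) ((hφ l i j).trans ?_)
    exact pow_le_pow_right_of_le_one' (by simp) hkl
  have hpow : Tendsto (fun k : ℕ => (1 / 4 : ℝ≥0∞) ^ k) atTop (𝓝 0) :=
    ENNReal.tendsto_pow_atTop_nhds_zero_of_lt_one (by simp)
  have hIdiff : ∀ k l, k ≤ l → ∀ t ∈ Icc 0 T,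
      eLpNorm (fun ω => I k t ω - I l t ω) 2 P ≤ (n * n * 2 : ℝ≥0∞) * (1 / 4) ^ k :=
    fun k l hkl t ht => by
      refine (StepFn.eLpNorm_integral_sub_le hW (φ k) (φ l) ht).trans ?_
      calc _ ≤ ∑ _i : Fin n, ∑ _j : Fin n, (2 * (1 / 4 : ℝ≥0∞) ^ k) :=
            Finset.sum_le_sum fun i _ => Finset.sum_le_sum fun j _ => hdiff k l hkl i j
        _ = _ := by simp [mul_assoc]
  have hunif : ∀ᵐ ω ∂P, ∀ i j, UniformCauchySeqOn
      (fun k t => (φ k).entryIntegral W i j t ω) atTop (Iic T.toNNReal) := by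
    refine ae_all_iff.2 fun i => ae_all_iff.2 fun j => ?_
    have hm : ∀ t, StronglyMeasurable (fun ω => W t ω j) := fun t =>
      ((measurable_pi_apply j).comp (hW.measurable t)).stronglyMeasurable
    refine ae_uniformCauchySeqOn (ℱ := Filtration.natural (fun t ω => W t ω j) hm) (C := 2)
      (S := fun k => (φ k).entryIntegral W i j)
      (fun k => martingale_stepIntegral (hW.brownian j) hm _ _ _ _)
      (fun k t => (φ k).memLp_entryIntegral hW i j t)
      (fun k => continuous_stepIntegral (hW.brownian j) _ _ _ _) fun k => ?_
    refine (StepFn.eLpNorm_entryIntegral_sub_le (T := T) hW (φ k) (φ (k + 1)) ?_ i j).trans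
      (hdiff k (k + 1) k.le_succ i j)
    rw [Real.coe_toNNReal _ hT.le]
  let M : ℝ → Ω → Fin n → ℝ := fun t ω => limUnder atTop fun k => I k t ω
  have hI : ∀ᵐ ω ∂P, UniformCauchySeqOn (fun k t => I k t ω) atTop (Icc 0 T) := by
    filter_upwards [hunif] with ω hω
    rw [Metric.uniformCauchySeqOn_iff]
    intro ε hε
    have h1 : ∀ i j, ∀ᶠ K in atTop, ∀ k ≥ K, ∀ l ≥ K, ∀ t ∈ Iic T.toNNReal,
        dist ((φ k).entryIntegral W i j t ω) ((φ l).entryIntegral W i j t ω) < ε / (n + 1) :=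
      fun i j => by
        obtain ⟨K, hK⟩ := (Metric.uniformCauchySeqOn_iff.1 (hω i j)) (ε / (n + 1)) (by positivity)
        filter_upwards [eventually_ge_atTop K] with K' hK' k hk l hl
        exact hK k (hK'.trans hk) l (hK'.trans hl)
    obtain ⟨K, hK⟩ := (eventually_all.2 fun i => eventually_all.2 fun j => h1 i j).exists
    refine ⟨K, fun k hk l hl t ht => ?_⟩
    refine (dist_pi_lt_iff hε).2 fun i => ?_
    simp only [I, StepFn.integral_apply]
    refine (dist_sum_sum_le _ _ _).trans_lt ?_
    calc _ ≤ ∑ _j : Fin n, ε / (n + 1) := Finset.sum_le_sum fun j _ =>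
          (hK i j k hk l hl _ (Real.toNNReal_le_toNNReal ht.2)).le
      _ = n * (ε / (n + 1)) := by simp
      _ < ε := by
          rw [mul_div_assoc', div_lt_iff₀ (by positivity)]
          nlinarith
  have hlim : ∀ᵐ ω ∂P, ∀ t ∈ Icc 0 T, Tendsto (fun k => I k t ω) atTop (𝓝 (M t ω)) := by
    filter_upwards [hI] with ω hω t ht
    exact CauchySeq.tendsto_limUnder (hω.cauchySeq ht)
  have hIc : ∀ᵐ ω ∂P, ∀ k, Continuous fun t => I k t ω := by
    have : ∀ᵐ ω ∂P, ∀ k i j, Continuous fun t => (φ k).entryIntegral W i j t ω :=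
      ae_all_iff.2 fun k => ae_all_iff.2 fun i => ae_all_iff.2 fun j =>
        continuous_stepIntegral (hW.brownian j) _ _ _ _
    filter_upwards [this] with ω hω k
    refine continuous_pi fun i => ?_
    simp only [I, StepFn.integral_apply]
    exact continuous_finsetSum _ fun j _ => (hω k i j).comp continuous_real_toNNReal
  have hMm : ∀ t ∈ Icc 0 T, StronglyMeasurable[history x₀ W t] (M t) := fun t ht => by
    refine stronglyMeasurable_limUnder_pi (m := history x₀ W t) fun k => ?_
    refine Measurable.stronglyMeasurable (StepFn.measurable_integral (φ k) fun s hs => ?_)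
    have hs' : (s : ℝ) ≤ t := by
      have : (s : ℝ) ≤ t.toNNReal := by exact_mod_cast hs
      rwa [Real.coe_toNNReal _ ht.1] at this
    exact Measurable.mono (comap_measurable (W s))
      (le_sup_of_le_right (le_iSup₂_of_le s hs' le_rfl)) le_rfl
  have hMae : ∀ t ∈ Icc 0 T, AEStronglyMeasurable (M t) P := fun t ht => by
    refine aestronglyMeasurable_of_tendsto_ae atTop
      (fun k => ((φ k).memLp_integral hW t.toNNReal).1) ?_
    filter_upwards [hlim] with ω hω using hω t ht
  have hIM : ∀ k, ∀ t ∈ Icc 0 T,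
      eLpNorm (fun ω => I k t ω - M t ω) 2 P ≤ (n * n * 2 : ℝ≥0∞) * (1 / 4) ^ k := fun k t ht => by
    refine Lp.eLpNorm_le_of_ae_tendsto (u := atTop) (f := fun l ω => I k t ω - I l t ω) ?_ ?_ ?_
    · filter_upwards [eventually_ge_atTop k] with l hl using hIdiff k l hl t ht
    · exact fun l => ((φ k).memLp_integral hW _).1.sub ((φ l).memLp_integral hW _).1
    · filter_upwards [hlim] with ω hω using tendsto_const_nhds.sub (hω t ht)
  refine ⟨M, ⟨hMae, φ, fun i j => ?_, fun t ht => ?_⟩, ?_, hMm, ?_⟩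
  · exact tendsto_of_tendsto_of_tendsto_of_le_of_le tendsto_const_nhds hpow (fun _ => zero_le)
      fun k => hφ k i j
  · refine tendsto_of_tendsto_of_tendsto_of_le_of_le tendsto_const_nhds
      (h := fun k : ℕ => (n * n * 2 : ℝ≥0∞) * (1 / 4) ^ k) ?_ (fun _ => zero_le)
      fun k => hIM k t ht
    simpa using ENNReal.Tendsto.const_mul (a := (n * n * 2 : ℝ≥0∞)) hpow
      (Or.inr (by finiteness))
  · filter_upwards [hI, hlim, hIc] with ω h1 h2 h3
    exact (h1.tendstoUniformlyOn_of_tendsto h2).continuousOn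
      (Frequently.of_forall fun k => (h3 k).continuousOn)
  · -- comparing with the first elementary integral, and that one with the zero step function
    let ψ : StepFn n := ⟨0, fun _ => 0, monotone_const, fun _ => 0⟩
    refine ⟨(n * n * 2 : ℝ≥0∞) * (1 / 4) ^ 0
      + ∑ i, ∑ j, eLpNorm (fun s => (φ 0).eval s i j - ψ.eval s i j) 2 (volume.restrict (Icc 0 T)),
      ?_, fun t ht => ?_⟩
    · refine ENNReal.add_ne_top.2 ⟨by finiteness, ?_⟩
      exact ENNReal.sum_ne_top.2 fun i _ => ENNReal.sum_ne_top.2 fun j _ =>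
        (((φ 0).memLp_eval i j).sub (ψ.memLp_eval i j)).2.ne
    · have e : M t = (fun ω => (φ 0).integral W t.toNNReal ω - ψ.integral W t.toNNReal ω)
          - fun ω => I 0 t ω - M t ω := by
        ext ω i
        simp [I, ψ, StepFn.integral]
      calc eLpNorm (M t) 2 P = eLpNorm ((fun ω => (φ 0).integral W t.toNNReal ω
            - ψ.integral W t.toNNReal ω) - fun ω => I 0 t ω - M t ω) 2 P := by rw [← e]
        _ ≤ _ := eLpNorm_sub_le
          (((φ 0).memLp_integral hW _).1.sub (ψ.memLp_integral hW _).1)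
          (((φ 0).memLp_integral hW _).1.sub (hMae t ht)) (by norm_num)
        _ ≤ _ := by
          rw [add_comm]
          exact add_le_add (hIM 0 t ht) (StepFn.eLpNorm_integral_sub_le hW (φ 0) ψ ht)

end LQ

/-! ### Variation of constants for processes -/

lemma stronglyMeasurable_pi_of_apply {α : Type*} {m : MeasurableSpace α} {k : ℕ}
    {f : α → Fin k → ℝ} (hf : ∀ i, StronglyMeasurable (fun x => f x i)) : StronglyMeasurable f :=
  (measurable_pi_lambda _ fun i => (hf i).measurable).stronglyMeasurable

lemma aestronglyMeasurable_pi_of_apply {α : Type*} {m m0 : MeasurableSpace α} {μ : Measure[m0] α}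
    {k : ℕ} {f : α → Fin k → ℝ} (hf : ∀ i, AEStronglyMeasurable[m] (fun x => f x i) μ) :
    AEStronglyMeasurable[m] f μ := by
  refine ⟨fun x i => (hf i).mk _ x,
    stronglyMeasurable_pi_of_apply fun i => (hf i).stronglyMeasurable_mk, ?_⟩
  filter_upwards [ae_all_iff.2 fun i => (hf i).ae_eq_mk] with x hx
  exact funext hx

lemma aestronglyMeasurable_mulVec {α : Type*} {m m0 : MeasurableSpace α} {μ : Measure[m0] α}
    {k l : ℕ} (N : Matrix (Fin k) (Fin l) ℝ) {f : α → Fin l → ℝ} (hf : AEStronglyMeasurable[m] f μ) :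
    AEStronglyMeasurable[m] (fun x => N *ᵥ f x) μ :=
  (Continuous.matrix_mulVec continuous_const continuous_id).comp_aestronglyMeasurable hf

lemma stronglyMeasurable_mulVec {α : Type*} {m : MeasurableSpace α}
    {k l : ℕ} (N : Matrix (Fin k) (Fin l) ℝ) {f : α → Fin l → ℝ} (hf : StronglyMeasurable f) :
    StronglyMeasurable (fun x => N *ᵥ f x) :=
  (Continuous.matrix_mulVec continuous_const continuous_id).comp_stronglyMeasurable hf

lemma memLp_mulVec {α : Type*} {m : MeasurableSpace α} {μ : Measure α}
    {k l : ℕ} (N : Matrix (Fin k) (Fin l) ℝ) {f : α → Fin l → ℝ} (hf : MemLp f 2 μ) :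
    MemLp (fun x => N *ᵥ f x) 2 μ := by
  refine memLp_pi_iff.2 fun i => ?_
  simp only [Matrix.mulVec, dotProduct]
  exact memLp_finsetSum _ fun j _ => (memLp_pi_iff.1 hf j).const_mul _

lemma integrable_dotProduct {α : Type*} {m : MeasurableSpace α} {μ : Measure α} {k : ℕ}
    {f g : α → Fin k → ℝ} (hf : MemLp f 2 μ) (hg : MemLp g 2 μ) :
    Integrable (fun x => f x ⬝ᵥ g x) μ := by
  simp only [dotProduct]
  exact integrable_finsetSum _ fun i _ => (memLp_pi_iff.1 hf i).integrable_mul (memLp_pi_iff.1 hg i)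

lemma intervalIntegral_apply {k : ℕ} {f : ℝ → Fin k → ℝ} {a b : ℝ} (hab : a ≤ b)
    (hf : ∀ i, IntegrableOn (fun t => f t i) (Icc a b)) (i : Fin k) :
    (∫ s in a..b, f s) i = ∫ s in a..b, f s i := by
  rw [intervalIntegral.integral_of_le hab, intervalIntegral.integral_of_le hab]
  exact eval_integral (fun i => (hf i).mono_set Ioc_subset_Icc_self) i

section

variable {Ω : Type*} [mΩ : MeasurableSpace Ω] {P : Measure Ω} {T : ℝ} {k l : ℕ}

/-- Multiplication by a bounded coefficient preserves square integrability of processes. -/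
lemma LQ.IsBoundedCoeff.memLp_mulVec [IsProbabilityMeasure P] {N : ℝ → Matrix (Fin k) (Fin l) ℝ}
    (hN : LQ.IsBoundedCoeff T N) {v : ℝ → Ω → Fin l → ℝ}
    (hv : MemLp (Function.uncurry v) 2 (timeProd T P)) :
    MemLp (Function.uncurry fun t ω => N t *ᵥ v t ω) 2 (timeProd T P) := by
  obtain ⟨C, -, hC⟩ := hN.exists_pos_bound
  refine memLp_pi_iff.2 fun i => ?_
  simp only [Function.uncurry, Matrix.mulVec, dotProduct]
  refine memLp_finsetSum _ fun j _ => ?_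
  have hvj := memLp_pi_iff.1 hv j
  refine MemLp.of_le_mul (c := C) hvj
    ((hN.aemeasurable i j).aestronglyMeasurable.comp_fst.mul hvj.1) ?_
  filter_upwards [ae_timeProd_fst_mem (T := T) (P := P)] with q hq
  rw [norm_mul]
  exact mul_le_mul_of_nonneg_right (hC _ hq i j) (norm_nonneg _)

lemma memLp_uncurry_of_continuousOn [IsProbabilityMeasure P] {z : ℝ → Fin k → ℝ}
    (hz : ContinuousOn z (Icc 0 T)) :
    MemLp (Function.uncurry fun t (_ : Ω) => z t) 2 (timeProd T P) := by
  obtain ⟨C, hC⟩ := isCompact_Icc.exists_bound_of_continuousOn hz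
  refine MemLp.of_bound (hz.aestronglyMeasurable measurableSet_Icc).comp_fst C ?_
  filter_upwards [ae_timeProd_fst_mem (T := T) (P := P)] with q hq using hC _ hq

lemma ae_integrableOn_apply [IsProbabilityMeasure P] {v : ℝ → Ω → Fin k → ℝ}
    (hv : MemLp (Function.uncurry v) 2 (timeProd T P)) :
    ∀ᵐ ω ∂P, ∀ j, IntegrableOn (fun t => v t ω j) (Icc 0 T) :=
  ae_all_iff.2 fun j => ((memLp_pi_iff.1 hv j).integrable (by norm_num)).prod_left_ae

/-- Two processes with continuous paths which agree almost surely at each time are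
indistinguishable. -/
lemma ae_forall_eq_of_continuousOn {X Y : ℝ → Ω → Fin k → ℝ}
    (hX : ∀ᵐ ω ∂P, ContinuousOn (fun t => X t ω) (Icc 0 T))
    (hY : ∀ᵐ ω ∂P, ContinuousOn (fun t => Y t ω) (Icc 0 T))
    (h : ∀ t ∈ Icc 0 T, X t =ᵐ[P] Y t) : ∀ᵐ ω ∂P, ∀ t ∈ Icc 0 T, X t ω = Y t ω := by
  have h1 : ∀ᵐ ω ∂P, ∀ N r : ℕ, (r : ℝ) / 2 ^ N ∈ Icc 0 T →
      X ((r : ℝ) / 2 ^ N) ω = Y ((r : ℝ) / 2 ^ N) ω := by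
    refine ae_all_iff.2 fun N => ae_all_iff.2 fun r => ?_
    by_cases hr : (r : ℝ) / 2 ^ N ∈ Icc 0 T
    · filter_upwards [h _ hr] with ω hω _ using hω
    · simp [hr]
  filter_upwards [hX, hY, h1] with ω hx hy he t ht
  have hlim : Tendsto (fun N => dyadicFloor N t) atTop (𝓝[Icc 0 T] t) :=
    tendsto_nhdsWithin_iff.2
      ⟨tendsto_dyadicFloor ht.1, Eventually.of_forall fun N => dyadicFloor_mem ht⟩
  refine tendsto_nhds_unique ((hx t ht).tendsto.comp hlim) (((hy t ht).tendsto.comp hlim).congr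
    fun N => ?_)
  exact (he N _ (dyadicFloor_mem ht)).symm

variable {n : ℕ} {Φ Ψ : ℝ → Matrix (Fin n) (Fin n) ℝ}

lemma continuousOn_of_isLinearSolution {A : ℝ → Matrix (Fin n) (Fin n) ℝ} {f ζ : ℝ → Fin n → ℝ}
    (h : IsLinearSolution T A f ζ) : ContinuousOn ζ (Icc 0 T) :=
  continuousOn_pi.2 fun i => (h i).continuousOn

/-- The variation of constants formula with a square integrable forcing is dominated, uniformly in
time, by a square integrable random variable. -/
lemma exists_bound_duhamel [IsProbabilityMeasure P] (hT : 0 < T) (hΦ : LQ.IsBoundedCoeff T Φ)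
    (hΨ : LQ.IsBoundedCoeff T Ψ) {c : Ω → Fin n → ℝ} (hc : MemLp c 2 P) {f : ℝ → Ω → Fin n → ℝ}
    (hf : MemLp (Function.uncurry f) 2 (timeProd T P)) :
    ∃ G : Ω → ℝ, MemLp G 2 P ∧ ∀ᵐ ω ∂P, ∀ t ∈ Icc 0 T, ∀ i,
      |duhamel Φ Ψ (c ω) (fun s => f s ω) t i| ≤ G ω := by
  obtain ⟨C, hC0, hC⟩ := hΦ.exists_pos_bound
  have hΨf := hΨ.memLp_mulVec hf
  let H : Ω → ℝ := fun ω => ∑ j, (|c ω j| + ∫ s in Icc 0 T, |(Ψ s *ᵥ f s ω) j|)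
  have hH : MemLp H 2 P := memLp_finsetSum _ fun j _ =>
    ((memLp_pi_iff.1 hc j).abs).add
      (memLp_integral_abs hT (f := fun s ω => (Ψ s *ᵥ f s ω) j) (memLp_pi_iff.1 hΨf j))
  refine ⟨fun ω => (n * C) * H ω, hH.const_mul _, ?_⟩
  filter_upwards [ae_integrableOn_apply hΨf] with ω hω t ht i
  refine abs_mulVec_le _ _ hC0.le (hC t ht) (fun j => ?_) i
  calc |(c ω + fun j => ∫ s in (0 : ℝ)..t, (Ψ s *ᵥ f s ω) j) j|
      ≤ |c ω j| + |∫ s in (0 : ℝ)..t, (Ψ s *ᵥ f s ω) j| := abs_add_le _ _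
    _ ≤ |c ω j| + ∫ s in Icc 0 T, |(Ψ s *ᵥ f s ω) j| := by
        gcongr
        exact abs_intervalIntegral_le ht (hω j)
    _ ≤ H ω := Finset.single_le_sum
        (f := fun j => |c ω j| + ∫ s in Icc 0 T, |(Ψ s *ᵥ f s ω) j|)
        (fun j _ => add_nonneg (abs_nonneg _) (integral_nonneg fun _ => abs_nonneg _))
        (Finset.mem_univ j)

/-- The variation of constants formula is measurable at time `t` if the initial value and the
forcing are. -/
lemma aestronglyMeasurable_duhamel {Ω : Type*} {m : MeasurableSpace Ω} [mΩ : MeasurableSpace Ω]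
    {P : Measure Ω} [IsProbabilityMeasure P] (hT : 0 < T) (hm : m ≤ mΩ) (hΨ : LQ.IsBoundedCoeff T Ψ) {c : Ω → Fin n → ℝ}
    (hc : AEStronglyMeasurable[m] c P) {f : ℝ → Ω → Fin n → ℝ}
    (hf : MemLp (Function.uncurry f) 2 (timeProd T P)) {t : ℝ} (ht : t ∈ Icc 0 T)
    (hfm : ∀ s ∈ Icc 0 t, AEStronglyMeasurable[m] (f s) P) :
    AEStronglyMeasurable[m] (fun ω => duhamel Φ Ψ (c ω) (fun s => f s ω) t) P := by
  refine aestronglyMeasurable_mulVec _ (hc.add (aestronglyMeasurable_pi_of_apply fun j => ?_))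
  refine aestronglyMeasurable_integral_of_adapted hT hm ht
    (f := fun s ω => (Ψ s *ᵥ f s ω) j) (memLp_pi_iff.1 (hΨ.memLp_mulVec hf) j) fun s hs => ?_
  exact (continuous_apply j).comp_aestronglyMeasurable (aestronglyMeasurable_mulVec _ (hfm s hs))

end

/-! ### The state equation -/

lemma stronglyMeasurable_of_comap_le {α : Type*} {m : MeasurableSpace α} {k : ℕ} {f : α → Fin k → ℝ}
    (h : MeasurableSpace.comap f inferInstance ≤ m) : StronglyMeasurable f :=
  ((comap_measurable f).mono h le_rfl).stronglyMeasurable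

section LinearSolutions

variable {n : ℕ} {T : ℝ} {A : ℝ → Matrix (Fin n) (Fin n) ℝ}

lemma IsLinearSolution.congr {f f' ζ ζ' : ℝ → Fin n → ℝ} (h : IsLinearSolution T A f ζ) (hT : 0 ≤ T)
    (hζ : ∀ t ∈ Icc 0 T, ζ t = ζ' t) (hf : ∀ t ∈ Icc 0 T, f t = f' t) :
    IsLinearSolution T A f' ζ' := fun i =>
  (h i).congr hT (fun t ht => by rw [hζ t ht]) fun t ht => by rw [hζ t ht, hf t ht]

lemma IsLinearSolution.sub {f f' ζ ζ' : ℝ → Fin n → ℝ} (h : IsLinearSolution T A f ζ)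
    (h' : IsLinearSolution T A f' ζ') (hT : 0 ≤ T) :
    IsLinearSolution T A (fun t => f t - f' t) (fun t => ζ t - ζ' t) := fun i =>
  ((h i).add (h' i).neg).congr hT (fun t _ => by simp [sub_eq_add_neg]) fun t _ => by
    simp only [Pi.add_apply, Matrix.mulVec_sub, Pi.sub_apply]
    ring

/-- An integral equation with an additive noise `μ` becomes a linear differential equation after
subtraction of the noise. -/
lemma isLinearSolution_sub_of_eq (hT : 0 ≤ T) (hA : LQ.IsBoundedCoeff T A) {f x μ : ℝ → Fin n → ℝ}
    (hf : ∀ j, IntegrableOn (fun t => f t j) (Icc 0 T)) (hx : ContinuousOn x (Icc 0 T))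
    {c : Fin n → ℝ}
    (h : ∀ t ∈ Icc 0 T, x t = c + (∫ s in (0 : ℝ)..t, (A s *ᵥ x s + f s)) + μ t) :
    IsLinearSolution T A (fun s => f s + A s *ᵥ μ s) (fun t => x t - μ t) ∧ x 0 - μ 0 = c := by
  have hint : ∀ i, IntegrableOn (fun s => (A s *ᵥ x s + f s) i) (Icc 0 T) := fun i =>
    (hA.integrableOn_mulVec (fun j => (continuousOn_pi.1 hx j).integrableOn_Icc) i).add (hf i)
  refine ⟨fun i => (IsPrimitive.of_integral (hint i) (c i)).congr hT (fun t ht => ?_)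
    fun t _ => ?_, ?_⟩
  · simp only [Pi.sub_apply]
    rw [h t ht]
    simp only [Pi.add_apply, add_sub_cancel_right]
    rw [intervalIntegral_apply ht.1
      (fun i => (hint i).mono_set (Icc_subset_Icc le_rfl ht.2))]
    rfl
  · simp only [Pi.add_apply, Matrix.mulVec_sub, Pi.sub_apply]
    ring
  · rw [h 0 ⟨le_rfl, hT⟩]
    simp

/-- Conversely, adding the noise to a solution of the linear differential equation solves the
integral equation. -/
lemma eq_of_isLinearSolution (hA : LQ.IsBoundedCoeff T A) {f ζ μ : ℝ → Fin n → ℝ}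
    (hf : ∀ j, IntegrableOn (fun t => f t j) (Icc 0 T)) (hμ : ContinuousOn μ (Icc 0 T))
    (h : IsLinearSolution T A (fun s => f s + A s *ᵥ μ s) ζ) {t : ℝ} (ht : t ∈ Icc 0 T) :
    μ t + ζ t = ζ 0 + (∫ s in (0 : ℝ)..t, (A s *ᵥ (μ s + ζ s) + f s)) + μ t := by
  have hζ := continuousOn_of_isLinearSolution h
  have hint : ∀ i, IntegrableOn (fun s => (A s *ᵥ (μ s + ζ s) + f s) i) (Icc 0 T) := fun i =>
    (hA.integrableOn_mulVec (fun j => (continuousOn_pi.1 (hμ.add hζ) j).integrableOn_Icc) i).add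
      (hf i)
  ext i
  simp only [Pi.add_apply]
  rw [intervalIntegral_apply ht.1 (fun i => (hint i).mono_set (Icc_subset_Icc le_rfl ht.2)),
    (h i).eq_add_integral t ht]
  have : ∀ s, (A s *ᵥ ζ s + (f s + A s *ᵥ μ s)) i = (A s *ᵥ (μ s + ζ s) + f s) i := fun s => by
    simp only [Matrix.mulVec_add, Pi.add_apply]
    ring
  simp only [this]
  ring

end LinearSolutions

namespace LQ

variable {n m : ℕ} {Ω : Type*} [mΩ : MeasurableSpace Ω] {D : Data n m} {x₀ : Ω → Fin n → ℝ}
  {W : ℝ≥0 → Ω → Fin n → ℝ} {P : Measure Ω} {Φ Ψ : ℝ → Matrix (Fin n) (Fin n) ℝ}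
  {M : ℝ → Ω → Fin n → ℝ}

/-- The hypotheses of the control problem, together with a fundamental matrix `Φ` of `ζ' = A ζ`, its
inverse `Ψ`, and a continuous adapted version `M` of the Wiener integral `∫ σ dW`. -/
structure IsFrame (D : Data n m) (x₀ : Ω → Fin n → ℝ) (W : ℝ≥0 → Ω → Fin n → ℝ) (P : Measure Ω)
    (Φ Ψ : ℝ → Matrix (Fin n) (Fin n) ℝ) (M : ℝ → Ω → Fin n → ℝ) : Prop where
  standing : D.Standing
  wiener : IsWienerProcess W P
  init_measurable : Measurable x₀
  init_memLp : MemLp x₀ 2 P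
  fundamental : IsFundamental D.T D.A Φ Ψ
  noise_integral : IsWienerIntegral D.T D.σ W P M
  noise_cont : ∀ᵐ ω ∂P, ContinuousOn (fun t => M t ω) (Icc 0 D.T)
  noise_adapted : ∀ t ∈ Icc 0 D.T, StronglyMeasurable[history x₀ W t] (M t)
  noise_bound : ∃ K : ℝ≥0∞, K ≠ ⊤ ∧ ∀ t ∈ Icc 0 D.T, eLpNorm (M t) 2 P ≤ K

lemma exists_isFrame [IsProbabilityMeasure P] (hD : D.Standing) (hW : IsWienerProcess W P)
    (hx₀ : Measurable x₀) (hx₀_sq : MemLp x₀ 2 P) : ∃ Φ Ψ M, IsFrame D x₀ W P Φ Ψ M := by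
  obtain ⟨Φ, Ψ, h⟩ := exists_isFundamental hD.T_pos.le hD.A_bdd
  obtain ⟨M, h1, h2, h3, h4⟩ :=
    exists_continuous_wienerIntegral (x₀ := x₀) hD.T_pos hW hD.σ_memLp
  exact ⟨Φ, Ψ, M, hD, hW, hx₀, hx₀_sq, h, h1, h2, h3, h4⟩

/-- The part of the drift of the state which does not depend on the state. -/
def drive (D : Data n m) (v : ℝ → Ω → Fin m → ℝ) (s : ℝ) (ω : Ω) : Fin n → ℝ :=
  D.B s *ᵥ v s ω + D.Abar s *ᵥ D.z s

/-- The state process of the control `v`, given by the variation of constants formula. -/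
noncomputable def stateMap (D : Data n m) (x₀ : Ω → Fin n → ℝ) (Φ Ψ : ℝ → Matrix (Fin n) (Fin n) ℝ)
    (M : ℝ → Ω → Fin n → ℝ) (v : ℝ → Ω → Fin m → ℝ) (t : ℝ) (ω : Ω) : Fin n → ℝ :=
  M t ω + duhamel Φ Ψ (x₀ ω) (fun s => drive D v s ω + D.A s *ᵥ M s ω) t

namespace IsFrame

lemma history_le (F : IsFrame D x₀ W P Φ Ψ M) (t : ℝ) : history x₀ W t ≤ mΩ :=
  (historyFiltration F.init_measurable F.wiener.measurable).le t

lemma history_mono (F : IsFrame D x₀ W P Φ Ψ M) {s t : ℝ} (h : s ≤ t) :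
    history x₀ W s ≤ history x₀ W t :=
  (historyFiltration F.init_measurable F.wiener.measurable).mono h

lemma init_adapted (t : ℝ) : StronglyMeasurable[history x₀ W t] x₀ :=
  stronglyMeasurable_of_comap_le le_sup_left

variable [IsProbabilityMeasure P] {v u h : ℝ → Ω → Fin m → ℝ} {x y : ℝ → Ω → Fin n → ℝ}

lemma noise_memLp (F : IsFrame D x₀ W P Φ Ψ M) :
    MemLp (Function.uncurry M) 2 (timeProd D.T P) := by
  obtain ⟨K, hK, hM⟩ := F.noise_bound
  exact memLp_uncurry_of_eLpNorm_le (aestronglyMeasurable_uncurry_of_continuousOn F.noise_cont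
    fun t ht => ((F.noise_adapted t ht).mono (F.history_le t)).aestronglyMeasurable) hK hM

lemma noise_memLp_apply (F : IsFrame D x₀ W P Φ Ψ M) {t : ℝ} (ht : t ∈ Icc 0 D.T) :
    MemLp (M t) 2 P := by
  obtain ⟨K, hK, hM⟩ := F.noise_bound
  exact ⟨((F.noise_adapted t ht).mono (F.history_le t)).aestronglyMeasurable,
    (hM t ht).trans_lt hK.lt_top⟩

lemma drive_memLp (F : IsFrame D x₀ W P Φ Ψ M) (hv : MemL2F D.T x₀ W P v) :
    MemLp (Function.uncurry (drive D v)) 2 (timeProd D.T P) :=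
  (F.standing.B_bdd.memLp_mulVec hv.memLp).add
    (F.standing.Abar_bdd.memLp_mulVec (memLp_uncurry_of_continuousOn F.standing.z_cont))

lemma forcing_memLp (F : IsFrame D x₀ W P Φ Ψ M) (hv : MemL2F D.T x₀ W P v) :
    MemLp (Function.uncurry fun s ω => drive D v s ω + D.A s *ᵥ M s ω) 2 (timeProd D.T P) :=
  (F.drive_memLp hv).add (F.standing.A_bdd.memLp_mulVec F.noise_memLp)

lemma forcing_adapted (F : IsFrame D x₀ W P Φ Ψ M) (hv : MemL2F D.T x₀ W P v) {s t : ℝ}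
    (hs : s ∈ Icc 0 D.T) (hst : s ≤ t) :
    StronglyMeasurable[history x₀ W t] fun ω => drive D v s ω + D.A s *ᵥ M s ω :=
  (((stronglyMeasurable_mulVec _ (hv.adapted s hs)).add stronglyMeasurable_const).add
    (stronglyMeasurable_mulVec _ (F.noise_adapted s hs))).mono (F.history_mono hst)

/-- A state process solves, after subtraction of the noise, a linear differential equation. -/
lemma ae_isLinearSolution (F : IsFrame D x₀ W P Φ Ψ M) (hv : MemL2F D.T x₀ W P v)
    (hx : IsState D x₀ W P v x) :
    ∀ᵐ ω ∂P, IsLinearSolution D.T D.A (fun s => drive D v s ω + D.A s *ᵥ M s ω)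
      (fun t => x t ω - M t ω) ∧ x 0 ω - M 0 ω = x₀ ω := by
  have hD := F.standing
  obtain ⟨M', hM', he⟩ := hx.eqn
  have he' : ∀ᵐ ω ∂P, ∀ t ∈ Icc 0 D.T,
      x t ω = x₀ ω + (∫ s in (0 : ℝ)..t, (D.A s *ᵥ x s ω + drive D v s ω)) + M' t ω := by
    filter_upwards [he] with ω h
    simpa only [drive, add_assoc] using h
  -- the version of the Wiener integral in the state equation has continuous paths, since the other
  -- terms of the equation do, so it is indistinguishable from `M`
  have hc : ∀ᵐ ω ∂P, ContinuousOn (fun t => M' t ω) (Icc 0 D.T) := by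
    filter_upwards [he', hx.cont, ae_integrableOn_apply (F.drive_memLp hv)] with ω h1 h2 h3
    have := continuousOn_of_isLinearSolution (isLinearSolution_sub_of_eq hD.T_pos.le hD.A_bdd h3 h2
      h1).1
    refine (h2.sub this).congr fun t _ => by simp
  have hMM : ∀ᵐ ω ∂P, ∀ t ∈ Icc 0 D.T, M' t ω = M t ω :=
    ae_forall_eq_of_continuousOn hc F.noise_cont fun t ht =>
      IsWienerIntegral.ae_eq F.wiener (fun i j => (hD.σ_memLp i j).1) hM' F.noise_integral ht
  filter_upwards [he', hx.cont, ae_integrableOn_apply (F.drive_memLp hv), hMM] with ω h1 h2 h3 h4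
  exact isLinearSolution_sub_of_eq hD.T_pos.le hD.A_bdd h3 h2 fun t ht => by
    rw [← h4 t ht]; exact h1 t ht

/-- Every state process is given by the variation of constants formula. -/
lemma ae_eq_stateMap (F : IsFrame D x₀ W P Φ Ψ M) (hv : MemL2F D.T x₀ W P v)
    (hx : IsState D x₀ W P v x) :
    ∀ᵐ ω ∂P, ∀ t ∈ Icc 0 D.T, x t ω = stateMap D x₀ Φ Ψ M v t ω := by
  filter_upwards [F.ae_isLinearSolution hv hx] with ω h t ht
  have := F.fundamental.eq_duhamel h.1 ht
  rw [h.2] at this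
  rw [stateMap, ← this, add_sub_cancel]

lemma isState_stateMap (F : IsFrame D x₀ W P Φ Ψ M) (hv : MemL2F D.T x₀ W P v) :
    IsState D x₀ W P v (stateMap D x₀ Φ Ψ M v) := by
  have hD := F.standing
  have hlin : ∀ᵐ ω ∂P, IsLinearSolution D.T D.A (fun s => drive D v s ω + D.A s *ᵥ M s ω)
      (duhamel Φ Ψ (x₀ ω) (fun s => drive D v s ω + D.A s *ᵥ M s ω)) := by
    filter_upwards [ae_integrableOn_apply (F.forcing_memLp hv)] with ω h
    exact F.fundamental.isLinearSolution_duhamel hD.T_pos.le h _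
  refine ⟨fun t ht => ?_, ?_, M, F.noise_integral, ?_⟩
  · refine (F.noise_adapted t ht).aestronglyMeasurable.add (aestronglyMeasurable_duhamel hD.T_pos
      (F.history_le t) F.fundamental.inv_bdd (init_adapted t).aestronglyMeasurable
      (F.forcing_memLp hv) ht fun s hs => ?_)
    exact (F.forcing_adapted hv ⟨hs.1, hs.2.trans ht.2⟩ hs.2).aestronglyMeasurable
  · filter_upwards [hlin, F.noise_cont] with ω h1 h2
    exact h2.add (continuousOn_of_isLinearSolution h1)
  · filter_upwards [hlin, F.noise_cont, ae_integrableOn_apply (F.drive_memLp hv)] with ω h1 h2 h3 t ht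
    have := eq_of_isLinearSolution hD.A_bdd h3 h2 h1 ht
    rw [F.fundamental.duhamel_zero] at this
    simpa only [stateMap, drive, add_assoc] using this

lemma state_ae_unique (F : IsFrame D x₀ W P Φ Ψ M) (hv : MemL2F D.T x₀ W P v)
    (hx : IsState D x₀ W P v x) (hy : IsState D x₀ W P v y) :
    ∀ᵐ ω ∂P, ∀ t ∈ Icc 0 D.T, x t ω = y t ω := by
  filter_upwards [F.ae_eq_stateMap hv hx, F.ae_eq_stateMap hv hy] with ω h1 h2 t ht
  rw [h1 t ht, h2 t ht]

/-- The state of a square integrable control is square integrable, in time and pointwise. -/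
lemma state_memLp_both (F : IsFrame D x₀ W P Φ Ψ M) (hv : MemL2F D.T x₀ W P v)
    (hx : IsState D x₀ W P v x) :
    MemLp (Function.uncurry x) 2 (timeProd D.T P) ∧ ∀ t ∈ Icc 0 D.T, MemLp (x t) 2 P := by
  have hxm : ∀ t ∈ Icc 0 D.T, AEStronglyMeasurable (x t) P := fun t ht =>
    (hx.adapted t ht).mono (F.history_le t)
  have hd : ∀ᵐ ω ∂P, ∀ t ∈ Icc 0 D.T, x t ω - M t ω
      = duhamel Φ Ψ (x₀ ω) (fun s => drive D v s ω + D.A s *ᵥ M s ω) t := by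
    filter_upwards [F.ae_eq_stateMap hv hx] with ω h t ht
    rw [h t ht, stateMap, add_sub_cancel_left]
  obtain ⟨G, hG, hb⟩ := exists_bound_duhamel F.standing.T_pos F.fundamental.fwd_bdd
    F.fundamental.inv_bdd F.init_memLp (F.forcing_memLp hv)
  have hb' : ∀ᵐ ω ∂P, ∀ t ∈ Icc 0 D.T, ∀ i, |(x t ω - M t ω) i| ≤ G ω := by
    filter_upwards [hd, hb] with ω h1 h2 t ht i
    rw [h1 t ht]
    exact h2 t ht i
  constructor
  · have h1 : MemLp (Function.uncurry fun t ω => x t ω - M t ω) 2 (timeProd D.T P) :=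
      memLp_uncurry_of_bound ((aestronglyMeasurable_uncurry_of_continuousOn hx.cont hxm).sub
        F.noise_memLp.1) hG hb'
    exact (memLp_congr_ae (Eventually.of_forall fun q => by simp [Function.uncurry])).1
      (h1.add F.noise_memLp)
  · intro t ht
    have h1 : MemLp (fun ω => x t ω - M t ω) 2 P :=
      memLp_marginal_of_bound (X := fun t ω => x t ω - M t ω) ht
        ((hxm t ht).sub (F.noise_memLp_apply ht).1) hG hb'
    exact (memLp_congr_ae (Eventually.of_forall fun ω => by simp)).1
      (h1.add (F.noise_memLp_apply ht))

lemma state_memLp (F : IsFrame D x₀ W P Φ Ψ M) (hv : MemL2F D.T x₀ W P v)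
    (hx : IsState D x₀ W P v x) : MemLp (Function.uncurry x) 2 (timeProd D.T P) :=
  (F.state_memLp_both hv hx).1

lemma state_memLp_apply (F : IsFrame D x₀ W P Φ Ψ M) (hv : MemL2F D.T x₀ W P v)
    (hx : IsState D x₀ W P v x) {t : ℝ} (ht : t ∈ Icc 0 D.T) : MemLp (x t) 2 P :=
  (F.state_memLp_both hv hx).2 t ht

end IsFrame

/-- The state process depends on the control only through its almost everywhere class. -/
lemma IsState.congr [IsProbabilityMeasure P] {u v : ℝ → Ω → Fin m → ℝ} {y : ℝ → Ω → Fin n → ℝ}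
    (h : IsState D x₀ W P v y)
    (huv : Function.uncurry v =ᵐ[timeProd D.T P] Function.uncurry u) : IsState D x₀ W P u y := by
  obtain ⟨M, hM, he⟩ := h.eqn
  refine ⟨h.adapted, h.cont, M, hM, ?_⟩
  filter_upwards [he, ae_ae_of_timeProd_swap (p := fun t ω => v t ω = u t ω) huv] with ω h1 h2 t ht
  rw [h1 t ht]
  congr 2
  refine intervalIntegral.integral_congr_ae ?_
  rw [uIoc_of_le ht.1]
  filter_upwards [(ae_restrict_iff' measurableSet_Icc).1 h2] with s hs hst
  rw [hs ⟨hst.1.le, hst.2.trans ht.2⟩]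

end LQ

/-! ### The adjoint equation -/

section BackwardEquation

variable {n : ℕ} {T : ℝ} {A : ℝ → Matrix (Fin n) (Fin n) ℝ}

/-- The backward equation `-w' = A* w + g`, `w T = c`, in integrated form, is the forward linear
equation with coefficient `-A*` together with the terminal condition. -/
lemma backward_eq_iff (hT : 0 ≤ T) (hA : LQ.IsBoundedCoeff T A) {g w : ℝ → Fin n → ℝ}
    (hg : ∀ j, IntegrableOn (fun t => g t j) (Icc 0 T)) (hw : ContinuousOn w (Icc 0 T))
    {c : Fin n → ℝ} :
    (∀ t ∈ Icc 0 T, w t = c + ∫ s in t..T, ((A s)ᵀ *ᵥ w s + g s)) ↔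
      IsLinearSolution T (fun t => -(A t)ᵀ) (fun t => -g t) w ∧ w T = c := by
  have hint : ∀ i, IntegrableOn (fun s => ((A s)ᵀ *ᵥ w s + g s) i) (Icc 0 T) := fun i =>
    (hA.transpose.integrableOn_mulVec (fun j => (continuousOn_pi.1 hw j).integrableOn_Icc) i).add
      (hg i)
  have hI : ∀ i, ∀ a ∈ Icc 0 T, ∀ b ∈ Icc 0 T,
      IntervalIntegrable (fun s => ((A s)ᵀ *ᵥ w s + g s) i) volume a b := fun i a ha b hb =>
    ((hint i).mono_set (by rw [← uIcc_of_le hT] at *; exact uIcc_subset_uIcc ha hb)).intervalIntegrable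
  have h0 : (0 : ℝ) ∈ Icc 0 T := ⟨le_rfl, hT⟩
  have hTT : T ∈ Icc 0 T := ⟨hT, le_rfl⟩
  have hadd : ∀ i, ∀ t ∈ Icc 0 T, (∫ s in (0 : ℝ)..t, ((A s)ᵀ *ᵥ w s + g s) i)
      + (∫ s in t..T, ((A s)ᵀ *ᵥ w s + g s) i) = ∫ s in (0 : ℝ)..T, ((A s)ᵀ *ᵥ w s + g s) i :=
    fun i t ht => intervalIntegral.integral_add_adjacent_intervals (hI i 0 h0 t ht) (hI i t ht T hTT)
  have hneg : ∀ i s, (-(A s)ᵀ *ᵥ w s + -g s) i = -((A s)ᵀ *ᵥ w s + g s) i := fun i s => by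
    simp only [Matrix.neg_mulVec, Pi.add_apply, Pi.neg_apply]
    ring
  have happ : ∀ i, ∀ t ∈ Icc 0 T, (∫ s in t..T, ((A s)ᵀ *ᵥ w s + g s)) i
      = ∫ s in t..T, ((A s)ᵀ *ᵥ w s + g s) i := fun i t ht =>
    intervalIntegral_apply ht.2 (fun i => (hint i).mono_set (Icc_subset_Icc ht.1 le_rfl)) i
  constructor
  · intro h
    refine ⟨fun i => ?_, by simpa using h T hTT⟩
    refine (IsPrimitive.of_integral (f := fun s => -((A s)ᵀ *ᵥ w s + g s) i) (hint i).neg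
      (c i + ∫ s in (0 : ℝ)..T, ((A s)ᵀ *ᵥ w s + g s) i)).congr hT (fun t ht => ?_)
      fun t _ => (hneg i t).symm
    rw [h t ht, Pi.add_apply, happ i t ht, intervalIntegral.integral_neg, ← hadd i t ht]
    ring
  · rintro ⟨h, hc⟩ t ht
    ext i
    have e1 := (h i).eq_add_integral t ht
    have e2 := (h i).eq_add_integral T hTT
    simp only [hneg, intervalIntegral.integral_neg] at e1 e2
    rw [Pi.add_apply, happ i t ht, ← hc, e1, e2, ← hadd i t ht]
    ring

end BackwardEquation

namespace LQ

variable {n m : ℕ} {Ω : Type*} [mΩ : MeasurableSpace Ω] {D : Data n m} {x₀ : Ω → Fin n → ℝ}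
  {W : ℝ≥0 → Ω → Fin n → ℝ} {P : Measure Ω} {Φ Ψ : ℝ → Matrix (Fin n) (Fin n) ℝ}
  {M : ℝ → Ω → Fin n → ℝ}

/-- The inhomogeneity of the adjoint equation. Its value at the final time is the terminal value of
the adjoint process. -/
def costGradient (D : Data n m) (y : ℝ → Ω → Fin n → ℝ) (s : ℝ) (ω : Ω) : Fin n → ℝ :=
  (D.Q s + D.Qbar s) *ᵥ y s ω - (D.Qbar s * D.S s) *ᵥ D.z s

/-- The time integral of `Φ* g`, where `g` is the inhomogeneity of the adjoint equation. -/
noncomputable def gradientIntegral (D : Data n m) (Φ : ℝ → Matrix (Fin n) (Fin n) ℝ)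
    (y : ℝ → Ω → Fin n → ℝ) (t : ℝ) (ω : Ω) : Fin n → ℝ :=
  fun j => ∫ s in (0 : ℝ)..t, ((Φ s)ᵀ *ᵥ costGradient D y s ω) j

/-- The initial value of the adjoint process. -/
noncomputable def adjointInit (D : Data n m) (Φ : ℝ → Matrix (Fin n) (Fin n) ℝ)
    (y : ℝ → Ω → Fin n → ℝ) (ω : Ω) : Fin n → ℝ :=
  (Φ D.T)ᵀ *ᵥ costGradient D y D.T ω + gradientIntegral D Φ y D.T ω

/-- The adjoint process, given by the variation of constants formula. -/
noncomputable def adjointMap (D : Data n m) (Φ Ψ : ℝ → Matrix (Fin n) (Fin n) ℝ)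
    (y : ℝ → Ω → Fin n → ℝ) (t : ℝ) (ω : Ω) : Fin n → ℝ :=
  (Ψ t)ᵀ *ᵥ (adjointInit D Φ y ω - gradientIntegral D Φ y t ω)

lemma duhamel_adjoint_eq (c : Fin n → ℝ) (y : ℝ → Ω → Fin n → ℝ) (t : ℝ) (ω : Ω) :
    duhamel (fun t => (Ψ t)ᵀ) (fun t => (Φ t)ᵀ) c (fun s => -costGradient D y s ω) t
      = (Ψ t)ᵀ *ᵥ (c - gradientIntegral D Φ y t ω) := by
  rw [duhamel]
  congr 1
  ext j
  simp [gradientIntegral, Matrix.mulVec_neg, intervalIntegral.integral_neg, sub_eq_add_neg]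

lemma IsAdjoint.eqn_costGradient {y w : ℝ → Ω → Fin n → ℝ} (h : IsAdjoint D P y w) :
    ∀ᵐ ω ∂P, ∀ t ∈ Icc 0 D.T, w t ω = costGradient D y D.T ω
      + ∫ s in t..D.T, ((D.A s)ᵀ *ᵥ w s ω + costGradient D y s ω) := by
  filter_upwards [h.eqn] with ω hω t ht
  simpa only [costGradient, add_sub_assoc] using hω t ht

namespace IsFrame

variable [IsProbabilityMeasure P] {u : ℝ → Ω → Fin m → ℝ} {y w : ℝ → Ω → Fin n → ℝ}

lemma costGradient_memLp (F : IsFrame D x₀ W P Φ Ψ M) (hu : MemL2F D.T x₀ W P u)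
    (hy : IsState D x₀ W P u y) :
    MemLp (Function.uncurry (costGradient D y)) 2 (timeProd D.T P) :=
  ((F.standing.Q_bdd.add F.standing.Qbar_bdd).memLp_mulVec (F.state_memLp hu hy)).sub
    ((F.standing.Qbar_bdd.mul F.standing.S_bdd).memLp_mulVec
      (memLp_uncurry_of_continuousOn F.standing.z_cont))

lemma costGradient_memLp_apply (F : IsFrame D x₀ W P Φ Ψ M) (hu : MemL2F D.T x₀ W P u)
    (hy : IsState D x₀ W P u y) {t : ℝ} (ht : t ∈ Icc 0 D.T) :
    MemLp (costGradient D y t) 2 P :=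
  (memLp_mulVec _ (F.state_memLp_apply hu hy ht)).sub (memLp_const _)

lemma costGradient_adapted (F : IsFrame D x₀ W P Φ Ψ M) (hy : IsState D x₀ W P u y) {s t : ℝ}
    (hs : s ∈ Icc 0 D.T) (hst : s ≤ t) :
    AEStronglyMeasurable[history x₀ W t] (costGradient D y s) P :=
  (aestronglyMeasurable_mulVec _ ((hy.adapted s hs).mono (F.history_mono hst))).sub
    aestronglyMeasurable_const

lemma ae_isLinearSolution_adjoint (F : IsFrame D x₀ W P Φ Ψ M) (hu : MemL2F D.T x₀ W P u)
    (hy : IsState D x₀ W P u y) (hw : IsAdjoint D P y w) :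
    ∀ᵐ ω ∂P, IsLinearSolution D.T (fun t => -(D.A t)ᵀ) (fun t => -costGradient D y t ω)
      (fun t => w t ω) ∧ w D.T ω = costGradient D y D.T ω := by
  filter_upwards [hw.cont, hw.eqn_costGradient,
    ae_integrableOn_apply (F.costGradient_memLp hu hy)] with ω h1 h2 h3
  exact (backward_eq_iff F.standing.T_pos.le F.standing.A_bdd h3 h1).1 h2

lemma ae_eq_adjointMap (F : IsFrame D x₀ W P Φ Ψ M) (hu : MemL2F D.T x₀ W P u)
    (hy : IsState D x₀ W P u y) (hw : IsAdjoint D P y w) :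
    ∀ᵐ ω ∂P, ∀ t ∈ Icc 0 D.T, w t ω = adjointMap D Φ Ψ y t ω := by
  have hT := F.standing.T_pos.le
  have hTT : D.T ∈ Icc 0 D.T := ⟨hT, le_rfl⟩
  filter_upwards [F.ae_isLinearSolution_adjoint hu hy hw] with ω h t ht
  have he : ∀ t ∈ Icc 0 D.T, w t ω = (Ψ t)ᵀ *ᵥ (w 0 ω - gradientIntegral D Φ y t ω) :=
    fun t ht => by rw [← duhamel_adjoint_eq]; exact (F.fundamental.adjoint hT).eq_duhamel h.1 ht
  have h0 : w 0 ω = adjointInit D Φ y ω := by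
    rw [adjointInit, ← h.2, he _ hTT, Matrix.mulVec_mulVec, ← Matrix.transpose_mul,
      F.fundamental.inv_mul_fwd hTT, Matrix.transpose_one, Matrix.one_mulVec, sub_add_cancel]
  rw [he t ht, h0, adjointMap]

lemma isAdjoint_adjointMap (F : IsFrame D x₀ W P Φ Ψ M) (hu : MemL2F D.T x₀ W P u)
    (hy : IsState D x₀ W P u y) : IsAdjoint D P y (adjointMap D Φ Ψ y) := by
  have hT := F.standing.T_pos.le
  have hTT : D.T ∈ Icc 0 D.T := ⟨hT, le_rfl⟩
  have hlin : ∀ᵐ ω ∂P, IsLinearSolution D.T (fun t => -(D.A t)ᵀ)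
      (fun t => -costGradient D y t ω) (fun t => adjointMap D Φ Ψ y t ω) := by
    filter_upwards [ae_integrableOn_apply (F.costGradient_memLp hu hy)] with ω h
    have := (F.fundamental.adjoint hT).isLinearSolution_duhamel hT
      (f := fun t => -costGradient D y t ω) (fun j => (h j).neg) (adjointInit D Φ y ω)
    exact this.congr hT (fun t _ => duhamel_adjoint_eq _ _ _ _) fun _ _ => rfl
  refine ⟨hlin.mono fun ω h => continuousOn_of_isLinearSolution h, ?_⟩
  filter_upwards [hlin, ae_integrableOn_apply (F.costGradient_memLp hu hy)] with ω h1 h2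
  have hend : adjointMap D Φ Ψ y D.T ω = costGradient D y D.T ω := by
    rw [adjointMap, adjointInit, add_sub_cancel_right, Matrix.mulVec_mulVec,
      ← Matrix.transpose_mul, F.fundamental.fwd_mul_inv hTT, Matrix.transpose_one,
      Matrix.one_mulVec]
  have := (backward_eq_iff hT F.standing.A_bdd h2 (continuousOn_of_isLinearSolution h1)).2
    ⟨h1, hend⟩
  simpa only [costGradient, add_sub_assoc] using this

lemma gradientIntegral_adapted (F : IsFrame D x₀ W P Φ Ψ M) (hu : MemL2F D.T x₀ W P u)
    (hy : IsState D x₀ W P u y) {t : ℝ} (ht : t ∈ Icc 0 D.T) :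
    AEStronglyMeasurable[history x₀ W t] (gradientIntegral D Φ y t) P := by
  have := aestronglyMeasurable_duhamel (Φ := fun _ => 1) (c := fun _ => 0) (P := P)
    F.standing.T_pos (F.history_le t) F.fundamental.fwd_bdd.transpose aestronglyMeasurable_const
    (F.costGradient_memLp hu hy) ht
    fun s hs => F.costGradient_adapted hy ⟨hs.1, hs.2.trans ht.2⟩ hs.2
  simp only [duhamel, zero_add, Matrix.one_mulVec] at this
  exact this

lemma gradientIntegral_bound (F : IsFrame D x₀ W P Φ Ψ M) (hu : MemL2F D.T x₀ W P u)
    (hy : IsState D x₀ W P u y) : ∃ G : Ω → ℝ, MemLp G 2 P ∧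
      ∀ᵐ ω ∂P, ∀ t ∈ Icc 0 D.T, ∀ i, |gradientIntegral D Φ y t ω i| ≤ G ω := by
  have := exists_bound_duhamel (Φ := fun _ => 1) (c := fun _ => 0) (P := P) F.standing.T_pos
    (.of_continuousOn fun _ _ => continuousOn_const) F.fundamental.fwd_bdd.transpose
    (memLp_const _) (F.costGradient_memLp hu hy)
  simpa [duhamel, gradientIntegral, ← Pi.zero_def] using this

lemma gradientIntegral_cont (F : IsFrame D x₀ W P Φ Ψ M) (hu : MemL2F D.T x₀ W P u)
    (hy : IsState D x₀ W P u y) :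
    ∀ᵐ ω ∂P, ContinuousOn (fun t => gradientIntegral D Φ y t ω) (Icc 0 D.T) := by
  filter_upwards [ae_integrableOn_apply (F.costGradient_memLp hu hy)] with ω h
  refine continuousOn_pi.2 fun j => ?_
  have := (IsPrimitive.of_integral (F.fundamental.fwd_bdd.transpose.integrableOn_mulVec h j)
    0).continuousOn
  simpa [gradientIntegral] using this

lemma gradientIntegral_memLp (F : IsFrame D x₀ W P Φ Ψ M) (hu : MemL2F D.T x₀ W P u)
    (hy : IsState D x₀ W P u y) :
    MemLp (Function.uncurry (gradientIntegral D Φ y)) 2 (timeProd D.T P) := by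
  obtain ⟨G, hG, hb⟩ := F.gradientIntegral_bound hu hy
  exact memLp_uncurry_of_bound (aestronglyMeasurable_uncurry_of_continuousOn
    (F.gradientIntegral_cont hu hy)
    fun t ht => (F.gradientIntegral_adapted hu hy ht).mono (F.history_le t)) hG hb

lemma gradientIntegral_memLp_apply (F : IsFrame D x₀ W P Φ Ψ M) (hu : MemL2F D.T x₀ W P u)
    (hy : IsState D x₀ W P u y) {t : ℝ} (ht : t ∈ Icc 0 D.T) :
    MemLp (gradientIntegral D Φ y t) 2 P := by
  obtain ⟨G, hG, hb⟩ := F.gradientIntegral_bound hu hy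
  exact memLp_marginal_of_bound ht
    ((F.gradientIntegral_adapted hu hy ht).mono (F.history_le t)) hG hb

lemma adjointInit_memLp (F : IsFrame D x₀ W P Φ Ψ M) (hu : MemL2F D.T x₀ W P u)
    (hy : IsState D x₀ W P u y) : MemLp (adjointInit D Φ y) 2 P :=
  have hTT : D.T ∈ Icc 0 D.T := ⟨F.standing.T_pos.le, le_rfl⟩
  (memLp_mulVec _ (F.costGradient_memLp_apply hu hy hTT)).add
    (F.gradientIntegral_memLp_apply hu hy hTT)

lemma adjointMap_memLp_apply (F : IsFrame D x₀ W P Φ Ψ M) (hu : MemL2F D.T x₀ W P u)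
    (hy : IsState D x₀ W P u y) {t : ℝ} (ht : t ∈ Icc 0 D.T) :
    MemLp (adjointMap D Φ Ψ y t) 2 P :=
  memLp_mulVec _ ((F.adjointInit_memLp hu hy).sub (F.gradientIntegral_memLp_apply hu hy ht))

/-- Every adjoint process is square integrable, in time and pointwise. -/
lemma adjoint_memLp_both (F : IsFrame D x₀ W P Φ Ψ M) (hu : MemL2F D.T x₀ W P u)
    (hy : IsState D x₀ W P u y) (hw : IsAdjoint D P y w) :
    MemLp (Function.uncurry w) 2 (timeProd D.T P) ∧ ∀ t ∈ Icc 0 D.T, MemLp (w t) 2 P := by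
  have he := F.ae_eq_adjointMap hu hy hw
  refine ⟨(memLp_congr_ae (ae_timeProd_of_ae_forall (p := fun t ω => w t ω = _) he)).2 ?_,
    fun t ht => (memLp_congr_ae (he.mono fun ω h => h t ht)).2 (F.adjointMap_memLp_apply hu hy ht)⟩
  exact F.fundamental.inv_bdd.transpose.memLp_mulVec
    (v := fun t ω => adjointInit D Φ y ω - gradientIntegral D Φ y t ω)
    (((F.adjointInit_memLp hu hy).comp_snd _).sub (F.gradientIntegral_memLp hu hy))

/-- The conditional expectations of the adjoint process along the filtration have a strictly adapted
and square integrable version: the adjoint process is a deterministic linear image of a fixed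
random vector plus an adapted continuous process. -/
lemma exists_condExp_adjointMap (F : IsFrame D x₀ W P Φ Ψ M) (hu : MemL2F D.T x₀ W P u)
    (hy : IsState D x₀ W P u y) : ∃ p : ℝ → Ω → Fin n → ℝ, MemL2F D.T x₀ W P p ∧
      ∀ t ∈ Icc 0 D.T, p t =ᵐ[P] P[adjointMap D Φ Ψ y t | history x₀ W t] := by
  let ℱ := historyFiltration F.init_measurable F.wiener.measurable
  obtain ⟨p, hp, hpe, hpm⟩ := exists_adapted_version_condExp (P := P) (T := D.T) ℱ
    (F.adjointInit_memLp hu hy)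
  obtain ⟨q, hq, hqe, hqm⟩ := exists_adapted_version_of_continuousOn (P := P) (T := D.T) ℱ
    (F.gradientIntegral_cont hu hy) fun t ht => F.gradientIntegral_adapted hu hy ht
  have hG := F.gradientIntegral_memLp hu hy
  have hqG : Function.uncurry q =ᵐ[timeProd D.T P] Function.uncurry (gradientIntegral D Φ y) :=
    ae_eq_timeProd_of_ae hqm hG.1 (by
      filter_upwards [ae_restrict_mem measurableSet_Icc] with t ht using hqe t ht)
  refine ⟨fun t ω => (Ψ t)ᵀ *ᵥ (p t ω - q t ω),
    ⟨fun t ht => stronglyMeasurable_mulVec _ ((hp t ht).sub (hq t ht)),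
      F.fundamental.inv_bdd.transpose.memLp_mulVec (v := fun t ω => p t ω - q t ω)
        (hpm.sub ((memLp_congr_ae hqG).2 hG))⟩, fun t ht => ?_⟩
  have hi1 := (F.adjointInit_memLp hu hy).integrable (q := 2) (by norm_num)
  have hi2 := (F.gradientIntegral_memLp_apply hu hy ht).integrable (q := 2) (by norm_num)
  have h1 := (Matrix.mulVecLin (Ψ t)ᵀ).toContinuousLinearMap.comp_condExp_comm
    (m := history x₀ W t) (hi1.sub hi2)
  have h2 := condExp_sub hi1 hi2 (history x₀ W t)
  have h3 := condExp_of_aestronglyMeasurable' (F.history_le t)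
    (F.gradientIntegral_adapted hu hy ht) hi2
  filter_upwards [h1, h2, h3, hpe t ht, hqe t ht] with ω e1 e2 e3 e4 e5
  rw [e4, e5]
  refine Eq.trans ?_ e1
  rw [Function.comp_apply, e2, Pi.sub_apply, e3]
  rfl

end IsFrame

end LQ

/-! ### Second order expansion of the cost -/

section QuadraticForms

variable {k : ℕ} {N : Matrix (Fin k) (Fin k) ℝ}

lemma Matrix.PosSemidef.transpose_eq (hN : N.PosSemidef) : Nᵀ = N := by
  rw [← Matrix.conjTranspose_eq_transpose_of_trivial]
  exact hN.isHermitian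

lemma Matrix.PosSemidef.dotProduct_mulVec_nonneg_real (hN : N.PosSemidef) (a : Fin k → ℝ) :
    0 ≤ a ⬝ᵥ (N *ᵥ a) := by
  simpa using hN.dotProduct_mulVec_nonneg a

lemma dotProduct_mulVec_self_add (hN : Nᵀ = N) (a b : Fin k → ℝ) :
    (a + b) ⬝ᵥ (N *ᵥ (a + b)) = a ⬝ᵥ (N *ᵥ a) + b ⬝ᵥ (N *ᵥ b) + 2 * (b ⬝ᵥ (N *ᵥ a)) := by
  have h : a ⬝ᵥ (N *ᵥ b) = b ⬝ᵥ (N *ᵥ a) := by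
    conv_lhs => rw [← hN]
    exact Matrix.dotProduct_transpose_mulVec N a b
  simp only [Matrix.mulVec_add, dotProduct_add, add_dotProduct, h]
  ring

end QuadraticForms

lemma integral_integral_timeProd {Ω : Type*} [MeasurableSpace Ω] {P : Measure Ω} [SFinite P] {T : ℝ}
    (hT : 0 ≤ T) {f : ℝ → Ω → ℝ} (hf : Integrable (fun q : ℝ × Ω => f q.1 q.2) (timeProd T P)) :
    ∫ ω, (∫ t in (0 : ℝ)..T, f t ω) ∂P = ∫ q, f q.1 q.2 ∂(timeProd T P) := by
  rw [integral_prod_symm _ hf]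
  refine integral_congr_ae (Eventually.of_forall fun ω => ?_)
  simp only
  rw [intervalIntegral.integral_of_le hT, integral_Icc_eq_integral_Ioc]

namespace LQ

variable {n m : ℕ} {Ω : Type*} [mΩ : MeasurableSpace Ω] {D : Data n m} {x₀ : Ω → Fin n → ℝ}
  {W : ℝ≥0 → Ω → Fin n → ℝ} {P : Measure Ω} {Φ Ψ : ℝ → Matrix (Fin n) (Fin n) ℝ}
  {M : ℝ → Ω → Fin n → ℝ}

lemma MemL2F.zero [IsFiniteMeasure P] {T : ℝ} {k : ℕ} :
    MemL2F (k := k) T x₀ W P (fun _ _ => 0) :=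
  ⟨fun _ _ => stronglyMeasurable_const, memLp_const _⟩

lemma MemL2F.sub {T : ℝ} {k : ℕ} {u v : ℝ → Ω → Fin k → ℝ} (hu : MemL2F T x₀ W P u)
    (hv : MemL2F T x₀ W P v) : MemL2F T x₀ W P (fun t ω => u t ω - v t ω) :=
  ⟨fun t ht => (hu.adapted t ht).sub (hv.adapted t ht), hu.memLp.sub hv.memLp⟩

lemma MemL2F.add {T : ℝ} {k : ℕ} {u v : ℝ → Ω → Fin k → ℝ} (hu : MemL2F T x₀ W P u)
    (hv : MemL2F T x₀ W P v) : MemL2F T x₀ W P (fun t ω => u t ω + v t ω) :=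
  ⟨fun t ht => (hu.adapted t ht).add (hv.adapted t ht), hu.memLp.add hv.memLp⟩

lemma MemL2F.const_smul {T : ℝ} {k : ℕ} {u : ℝ → Ω → Fin k → ℝ} (hu : MemL2F T x₀ W P u) (c : ℝ) :
    MemL2F T x₀ W P (fun t ω => c • u t ω) :=
  ⟨fun t ht => (hu.adapted t ht).const_smul c, hu.memLp.const_smul c⟩

lemma Data.Standing.R_transpose (hD : D.Standing) {t : ℝ} (ht : t ∈ Icc 0 D.T) :
    (D.R t)ᵀ = D.R t := by
  obtain ⟨δ, -, h⟩ := hD.R_coercive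
  have := (h t ht).transpose_eq
  rw [Matrix.transpose_sub, Matrix.transpose_smul, Matrix.transpose_one] at this
  exact sub_left_injective this

/-- The change of the state caused by the change `h` of the control. -/
noncomputable def variation (D : Data n m) (Φ Ψ : ℝ → Matrix (Fin n) (Fin n) ℝ)
    (h : ℝ → Ω → Fin m → ℝ) (t : ℝ) (ω : Ω) : Fin n → ℝ :=
  duhamel Φ Ψ 0 (fun s => D.B s *ᵥ h s ω) t

/-- The integrand of the quadratic part of the cost. -/
def quadDensity (D : Data n m) (t : ℝ) (ξ : Fin n → ℝ) (h : Fin m → ℝ) : ℝ :=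
  ξ ⬝ᵥ ((D.Q t + D.Qbar t) *ᵥ ξ) + h ⬝ᵥ (D.R t *ᵥ h)

/-- The quadratic part of the cost. -/
noncomputable def costQuad (D : Data n m) (P : Measure Ω) (Φ Ψ : ℝ → Matrix (Fin n) (Fin n) ℝ)
    (h : ℝ → Ω → Fin m → ℝ) : ℝ :=
  (∫ q, quadDensity D q.1 (variation D Φ Ψ h q.1 q.2) (h q.1 q.2) ∂(timeProd D.T P))
    + ∫ ω, variation D Φ Ψ h D.T ω
        ⬝ᵥ ((D.Q D.T + D.Qbar D.T) *ᵥ variation D Φ Ψ h D.T ω) ∂P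

/-- The gradient of the cost at the control `u`, in terms of the adjoint process `w`, before
projection on the adapted processes. -/
def controlGradient (D : Data n m) (u : ℝ → Ω → Fin m → ℝ) (w : ℝ → Ω → Fin n → ℝ) (t : ℝ) (ω : Ω) :
    Fin m → ℝ :=
  D.R t *ᵥ u t ω + (D.B t)ᵀ *ᵥ w t ω

/-- The first variation of the cost at the control `u` in the direction `h`. -/
noncomputable def firstVariation (D : Data n m) (P : Measure Ω) (u : ℝ → Ω → Fin m → ℝ)
    (w : ℝ → Ω → Fin n → ℝ) (h : ℝ → Ω → Fin m → ℝ) : ℝ :=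
  ∫ q, h q.1 q.2 ⬝ᵥ controlGradient D u w q.1 q.2 ∂(timeProd D.T P)

lemma Data.Standing.runningCost_add (hD : D.Standing) {t : ℝ} (ht : t ∈ Icc 0 D.T)
    (a ξ : Fin n → ℝ) (b h : Fin m → ℝ) :
    runningCost D t (a + ξ) (b + h) = runningCost D t a b + ((1 / 2) * quadDensity D t ξ h
      + ξ ⬝ᵥ ((D.Q t + D.Qbar t) *ᵥ a - (D.Qbar t * D.S t) *ᵥ D.z t) + h ⬝ᵥ (D.R t *ᵥ b)) := by
  have e : a + ξ - D.S t *ᵥ D.z t = (a - D.S t *ᵥ D.z t) + ξ := by abel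
  rw [runningCost, runningCost, quadDensity, e,
    dotProduct_mulVec_self_add (hD.Q_nonneg t ht).transpose_eq,
    dotProduct_mulVec_self_add (hD.Qbar_nonneg t ht).transpose_eq,
    dotProduct_mulVec_self_add (hD.R_transpose ht), Matrix.add_mulVec, Matrix.add_mulVec,
    ← Matrix.mulVec_mulVec]
  simp only [dotProduct_add, dotProduct_sub, Matrix.mulVec_sub]
  ring

lemma Data.Standing.terminalCost_add (hD : D.Standing) (a ξ : Fin n → ℝ) :
    terminalCost D (a + ξ) = terminalCost D a + ((1 / 2) * (ξ ⬝ᵥ ((D.Q D.T + D.Qbar D.T) *ᵥ ξ))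
      + ξ ⬝ᵥ ((D.Q D.T + D.Qbar D.T) *ᵥ a - (D.Qbar D.T * D.S D.T) *ᵥ D.z D.T)) := by
  have ht : D.T ∈ Icc 0 D.T := ⟨hD.T_pos.le, le_rfl⟩
  have e : a + ξ - D.S D.T *ᵥ D.z D.T = (a - D.S D.T *ᵥ D.z D.T) + ξ := by abel
  rw [terminalCost, terminalCost, e,
    dotProduct_mulVec_self_add (hD.Q_nonneg _ ht).transpose_eq,
    dotProduct_mulVec_self_add (hD.Qbar_nonneg _ ht).transpose_eq, Matrix.add_mulVec,
    Matrix.add_mulVec, ← Matrix.mulVec_mulVec]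
  simp only [dotProduct_add, dotProduct_sub, Matrix.mulVec_sub]
  ring

/-- Integration by parts between the variation `ξ` of the state and the adjoint state `w`. -/
lemma dotProduct_eq_integral_of_isLinearSolution {T : ℝ} (hT : 0 ≤ T)
    {A : ℝ → Matrix (Fin n) (Fin n) ℝ} {B : ℝ → Matrix (Fin n) (Fin m) ℝ} {h : ℝ → Fin m → ℝ}
    {ξ w g : ℝ → Fin n → ℝ} (hξ : IsLinearSolution T A (fun s => B s *ᵥ h s) ξ) (hξ0 : ξ 0 = 0)
    (hw : IsLinearSolution T (fun t => -(A t)ᵀ) (fun t => -g t) w) :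
    ξ T ⬝ᵥ w T = ∫ s in (0 : ℝ)..T, (h s ⬝ᵥ ((B s)ᵀ *ᵥ w s) - ξ s ⬝ᵥ g s) := by
  have hp := (IsPrimitive.dotProduct hξ hw).eq_add_integral T ⟨hT, le_rfl⟩
  rw [hξ0, zero_dotProduct, zero_add] at hp
  refine hp.trans (intervalIntegral.integral_congr fun s _ => ?_)
  change (A s *ᵥ ξ s + B s *ᵥ h s) ⬝ᵥ w s + ξ s ⬝ᵥ (-(A s)ᵀ *ᵥ w s + -g s) = _
  rw [Matrix.neg_mulVec, dotProduct_add, dotProduct_neg, dotProduct_neg, add_dotProduct,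
    Matrix.dotProduct_transpose_mulVec, Matrix.dotProduct_transpose_mulVec,
    dotProduct_comm (A s *ᵥ ξ s), dotProduct_comm (B s *ᵥ h s)]
  ring

namespace IsFrame

variable [IsProbabilityMeasure P] {u v h : ℝ → Ω → Fin m → ℝ} {x y w : ℝ → Ω → Fin n → ℝ}

lemma ae_isLinearSolution_sub (F : IsFrame D x₀ W P Φ Ψ M) (hu : MemL2F D.T x₀ W P u)
    (hv : MemL2F D.T x₀ W P v) (hy : IsState D x₀ W P u y) (hx : IsState D x₀ W P v x) :
    ∀ᵐ ω ∂P, IsLinearSolution D.T D.A (fun s => D.B s *ᵥ (v s ω - u s ω))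
      (fun t => x t ω - y t ω) ∧ x 0 ω - y 0 ω = 0 := by
  filter_upwards [F.ae_isLinearSolution hu hy, F.ae_isLinearSolution hv hx] with ω h1 h2
  refine ⟨(h2.1.sub h1.1 F.standing.T_pos.le).congr F.standing.T_pos.le (fun t _ => ?_)
    fun t _ => ?_, ?_⟩
  · abel
  · simp only [drive, Matrix.mulVec_sub]
    abel
  · have : x 0 ω - y 0 ω = (x 0 ω - M 0 ω) - (y 0 ω - M 0 ω) := by abel
    rw [this, h1.2, h2.2, sub_self]

lemma ae_state_sub_eq_variation (F : IsFrame D x₀ W P Φ Ψ M) (hu : MemL2F D.T x₀ W P u)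
    (hv : MemL2F D.T x₀ W P v) (hy : IsState D x₀ W P u y) (hx : IsState D x₀ W P v x) :
    ∀ᵐ ω ∂P, ∀ t ∈ Icc 0 D.T,
      x t ω - y t ω = variation D Φ Ψ (fun t ω => v t ω - u t ω) t ω := by
  filter_upwards [F.ae_isLinearSolution_sub hu hv hy hx] with ω h t ht
  have := F.fundamental.eq_duhamel h.1 ht
  rwa [h.2] at this

/-- The variation is a difference of two states, whence its integrability. -/
lemma ae_variation_eq (F : IsFrame D x₀ W P Φ Ψ M) (hh : MemL2F D.T x₀ W P h) :
    ∀ᵐ ω ∂P, ∀ t ∈ Icc 0 D.T, variation D Φ Ψ h t ω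
      = stateMap D x₀ Φ Ψ M h t ω - stateMap D x₀ Φ Ψ M (fun _ _ => 0) t ω := by
  filter_upwards [F.ae_state_sub_eq_variation MemL2F.zero hh (F.isState_stateMap MemL2F.zero)
    (F.isState_stateMap hh)] with ω e t ht
  simpa using (e t ht).symm

lemma variation_memLp (F : IsFrame D x₀ W P Φ Ψ M) (hh : MemL2F D.T x₀ W P h) :
    MemLp (Function.uncurry (variation D Φ Ψ h)) 2 (timeProd D.T P) :=
  (memLp_congr_ae (ae_timeProd_of_ae_forall (p := fun t ω => variation D Φ Ψ h t ω = _)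
    (F.ae_variation_eq hh))).2
    ((F.state_memLp hh (F.isState_stateMap hh)).sub
      (F.state_memLp MemL2F.zero (F.isState_stateMap MemL2F.zero)))

lemma variation_memLp_apply (F : IsFrame D x₀ W P Φ Ψ M) (hh : MemL2F D.T x₀ W P h) {t : ℝ}
    (ht : t ∈ Icc 0 D.T) : MemLp (variation D Φ Ψ h t) 2 P :=
  (memLp_congr_ae ((F.ae_variation_eq hh).mono fun _ e => e t ht)).2
    ((F.state_memLp_apply hh (F.isState_stateMap hh) ht).sub
      (F.state_memLp_apply MemL2F.zero (F.isState_stateMap MemL2F.zero) ht))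

lemma integrable_quadDensity (F : IsFrame D x₀ W P Φ Ψ M) (hh : MemL2F D.T x₀ W P h) :
    Integrable (fun q : ℝ × Ω => quadDensity D q.1 (variation D Φ Ψ h q.1 q.2) (h q.1 q.2))
      (timeProd D.T P) :=
  (integrable_dotProduct (F.variation_memLp hh)
    ((F.standing.Q_bdd.add F.standing.Qbar_bdd).memLp_mulVec (F.variation_memLp hh))).add
    (integrable_dotProduct hh.memLp (F.standing.R_bdd.memLp_mulVec hh.memLp))

lemma controlGradient_memLp (F : IsFrame D x₀ W P Φ Ψ M) (hu : MemL2F D.T x₀ W P u)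
    (hw : MemLp (Function.uncurry w) 2 (timeProd D.T P)) :
    MemLp (Function.uncurry (controlGradient D u w)) 2 (timeProd D.T P) :=
  (F.standing.R_bdd.memLp_mulVec hu.memLp).add (F.standing.B_bdd.transpose.memLp_mulVec hw)

lemma costFinite (F : IsFrame D x₀ W P Φ Ψ M) (hv : MemL2F D.T x₀ W P v)
    (hx : IsState D x₀ W P v x) : CostFinite D P v x := by
  have hD := F.standing
  have hxm := F.state_memLp hv hx
  have hxT := F.state_memLp_apply hv hx (t := D.T) ⟨hD.T_pos.le, le_rfl⟩
  have hd : MemLp (Function.uncurry fun t ω => x t ω - D.S t *ᵥ D.z t) 2 (timeProd D.T P) :=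
    hxm.sub (hD.S_bdd.memLp_mulVec (memLp_uncurry_of_continuousOn hD.z_cont))
  have hdT : MemLp (fun ω => x D.T ω - D.S D.T *ᵥ D.z D.T) 2 P := hxT.sub (memLp_const _)
  exact ⟨(((integrable_dotProduct hxm (hD.Q_bdd.memLp_mulVec hxm)).add
    (integrable_dotProduct hv.memLp (hD.R_bdd.memLp_mulVec hv.memLp))).add
    (integrable_dotProduct hd (hD.Qbar_bdd.memLp_mulVec hd))).const_mul _,
    ((integrable_dotProduct hxT (memLp_mulVec _ hxT)).const_mul _).add
      ((integrable_dotProduct hdT (memLp_mulVec _ hdT)).const_mul _)⟩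

/-- The exact second order expansion of the cost. The terms which are linear in the variation of the
state are absorbed by the adjoint process. -/
lemma cost_eq_add (F : IsFrame D x₀ W P Φ Ψ M) (hu : MemL2F D.T x₀ W P u)
    (hv : MemL2F D.T x₀ W P v) (hy : IsState D x₀ W P u y) (hx : IsState D x₀ W P v x)
    (hw : IsAdjoint D P y w) :
    cost D P v x = cost D P u y + firstVariation D P u w (fun t ω => v t ω - u t ω)
      + (1 / 2) * costQuad D P Φ Ψ (fun t ω => v t ω - u t ω) := by
  have hD := F.standing
  have hTT : D.T ∈ Icc 0 D.T := ⟨hD.T_pos.le, le_rfl⟩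
  set h : ℝ → Ω → Fin m → ℝ := fun t ω => v t ω - u t ω
  set ξ := variation D Φ Ψ h
  have hh : MemL2F D.T x₀ W P h := hv.sub hu
  have hwm := (F.adjoint_memLp_both hu hy hw).1
  have hξ : ∀ᵐ ω ∂P, ∀ t ∈ Icc 0 D.T, x t ω - y t ω = ξ t ω :=
    F.ae_state_sub_eq_variation hu hv hy hx
  have hg := F.costGradient_memLp hu hy
  have hxc := F.costFinite hv hx
  have hyc := F.costFinite hu hy
  have i1 := F.integrable_quadDensity hh
  have i2 : Integrable (fun q : ℝ × Ω => ξ q.1 q.2 ⬝ᵥ costGradient D y q.1 q.2) (timeProd D.T P) :=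
    integrable_dotProduct (F.variation_memLp hh) hg
  have i3 : Integrable (fun q : ℝ × Ω => h q.1 q.2 ⬝ᵥ (D.R q.1 *ᵥ u q.1 q.2)) (timeProd D.T P) :=
    integrable_dotProduct hh.memLp (hD.R_bdd.memLp_mulVec hu.memLp)
  have i4 : Integrable (fun q : ℝ × Ω => h q.1 q.2 ⬝ᵥ ((D.B q.1)ᵀ *ᵥ w q.1 q.2)) (timeProd D.T P) :=
    integrable_dotProduct hh.memLp (hD.B_bdd.transpose.memLp_mulVec hwm)
  have j1 := integrable_dotProduct (F.variation_memLp_apply hh hTT)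
    (memLp_mulVec (D.Q D.T + D.Qbar D.T) (F.variation_memLp_apply hh hTT))
  have j2 := integrable_dotProduct (F.variation_memLp_apply hh hTT)
    (F.costGradient_memLp_apply hu hy hTT)
  have hrun : (∫ q, runningCost D q.1 (x q.1 q.2) (v q.1 q.2) ∂(timeProd D.T P))
      = (∫ q, runningCost D q.1 (y q.1 q.2) (u q.1 q.2) ∂(timeProd D.T P))
        + ((1 / 2) * (∫ q, quadDensity D q.1 (ξ q.1 q.2) (h q.1 q.2) ∂(timeProd D.T P))
          + (∫ q, ξ q.1 q.2 ⬝ᵥ costGradient D y q.1 q.2 ∂(timeProd D.T P))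
          + ∫ q, h q.1 q.2 ⬝ᵥ (D.R q.1 *ᵥ u q.1 q.2) ∂(timeProd D.T P)) := by
    have i12 : Integrable (fun q : ℝ × Ω => (1 / 2) * quadDensity D q.1 (ξ q.1 q.2) (h q.1 q.2)
        + ξ q.1 q.2 ⬝ᵥ costGradient D y q.1 q.2) (timeProd D.T P) := (i1.const_mul (1 / 2)).add i2
    have i123 : Integrable (fun q : ℝ × Ω => (1 / 2) * quadDensity D q.1 (ξ q.1 q.2) (h q.1 q.2)
        + ξ q.1 q.2 ⬝ᵥ costGradient D y q.1 q.2 + h q.1 q.2 ⬝ᵥ (D.R q.1 *ᵥ u q.1 q.2))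
        (timeProd D.T P) := i12.add i3
    rw [← integral_const_mul, ← integral_add (i1.const_mul (1 / 2)) i2, ← integral_add i12 i3,
      ← integral_add hyc.1 i123]
    refine integral_congr_ae ?_
    filter_upwards [ae_timeProd_fst_mem (T := D.T) (P := P), ae_timeProd_of_ae_forall hξ]
      with q hq hξq
    have := hD.runningCost_add hq (y q.1 q.2) (ξ q.1 q.2) (u q.1 q.2) (h q.1 q.2)
    rwa [← eq_add_of_sub_eq' hξq, add_sub_cancel (u q.1 q.2) (v q.1 q.2)] at this
  have hter : (∫ ω, terminalCost D (x D.T ω) ∂P) = (∫ ω, terminalCost D (y D.T ω) ∂P)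
      + ((1 / 2) * (∫ ω, ξ D.T ω ⬝ᵥ ((D.Q D.T + D.Qbar D.T) *ᵥ ξ D.T ω) ∂P)
        + ∫ ω, ξ D.T ω ⬝ᵥ costGradient D y D.T ω ∂P) := by
    have j12 : Integrable (fun ω => (1 / 2) * (ξ D.T ω ⬝ᵥ ((D.Q D.T + D.Qbar D.T) *ᵥ ξ D.T ω))
        + ξ D.T ω ⬝ᵥ costGradient D y D.T ω) P := (j1.const_mul (1 / 2)).add j2
    rw [← integral_const_mul, ← integral_add (j1.const_mul (1 / 2)) j2, ← integral_add hyc.2 j12]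
    refine integral_congr_ae ?_
    filter_upwards [hξ] with ω hω
    have := hD.terminalCost_add (y D.T ω) (ξ D.T ω)
    rwa [← eq_add_of_sub_eq' (hω _ hTT)] at this
  have hdual : (∫ ω, ξ D.T ω ⬝ᵥ costGradient D y D.T ω ∂P)
      = (∫ q, h q.1 q.2 ⬝ᵥ ((D.B q.1)ᵀ *ᵥ w q.1 q.2) ∂(timeProd D.T P))
        - ∫ q, ξ q.1 q.2 ⬝ᵥ costGradient D y q.1 q.2 ∂(timeProd D.T P) := by
    rw [← integral_sub i4 i2]
    refine Eq.trans ?_ (integral_integral_timeProd (P := P) hD.T_pos.le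
      (f := fun s ω => h s ω ⬝ᵥ ((D.B s)ᵀ *ᵥ w s ω) - ξ s ω ⬝ᵥ costGradient D y s ω) (i4.sub i2))
    refine integral_congr_ae ?_
    filter_upwards [F.ae_isLinearSolution_sub hu hv hy hx, hξ,
      F.ae_isLinearSolution_adjoint hu hy hw] with ω h1 h2 h3
    have h1' : IsLinearSolution D.T D.A (fun s => D.B s *ᵥ h s ω) (fun t => ξ t ω) :=
      h1.1.congr hD.T_pos.le h2 fun _ _ => rfl
    have h0 : ξ 0 ω = 0 := by rw [← h1.2, h2 0 ⟨le_rfl, hD.T_pos.le⟩]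
    have := dotProduct_eq_integral_of_isLinearSolution hD.T_pos.le h1' h0 h3.1
    rw [h3.2] at this
    exact this
  have hfirst : firstVariation D P u w h
      = (∫ q, h q.1 q.2 ⬝ᵥ (D.R q.1 *ᵥ u q.1 q.2) ∂(timeProd D.T P))
        + ∫ q, h q.1 q.2 ⬝ᵥ ((D.B q.1)ᵀ *ᵥ w q.1 q.2) ∂(timeProd D.T P) := by
    rw [← integral_add i3 i4]
    simp only [firstVariation, controlGradient, dotProduct_add]
  rw [cost, cost, integral_integral_timeProd hD.T_pos.le hxc.1,
    integral_integral_timeProd hD.T_pos.le hyc.1, hrun, hter, hdual, hfirst, costQuad]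
  ring

/-- The quadratic part of the cost is coercive. -/
lemma exists_le_costQuad (F : IsFrame D x₀ W P Φ Ψ M) : ∃ δ : ℝ, 0 < δ ∧ ∀ h,
    MemL2F D.T x₀ W P h →
      δ * ∫ q, h q.1 q.2 ⬝ᵥ h q.1 q.2 ∂(timeProd D.T P) ≤ costQuad D P Φ Ψ h := by
  have hD := F.standing
  have hpos : ∀ t ∈ Icc 0 D.T, ∀ a : Fin n → ℝ, 0 ≤ a ⬝ᵥ ((D.Q t + D.Qbar t) *ᵥ a) :=
    fun t ht a => ((hD.Q_nonneg t ht).add (hD.Qbar_nonneg t ht)).dotProduct_mulVec_nonneg_real a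
  obtain ⟨δ, hδ, hR⟩ := hD.R_coercive
  refine ⟨δ, hδ, fun h hh => ?_⟩
  rw [costQuad, ← integral_const_mul, ← add_zero (∫ q, δ * _ ∂_)]
  refine add_le_add ?_ (integral_nonneg fun ω => hpos _ ⟨hD.T_pos.le, le_rfl⟩ _)
  refine integral_mono_ae ((integrable_dotProduct hh.memLp hh.memLp).const_mul δ)
    (F.integrable_quadDensity hh) ?_
  filter_upwards [ae_timeProd_fst_mem (T := D.T) (P := P)] with q hq
  have h1 := hpos _ hq (variation D Φ Ψ h q.1 q.2)
  have h2 := (hR _ hq).dotProduct_mulVec_nonneg_real (h q.1 q.2)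
  rw [Matrix.sub_mulVec, Matrix.smul_mulVec, Matrix.one_mulVec, dotProduct_sub, dotProduct_smul,
    smul_eq_mul] at h2
  simp only [quadDensity]
  linarith

end IsFrame

lemma variation_smul (c : ℝ) (h : ℝ → Ω → Fin m → ℝ) (t : ℝ) (ω : Ω) :
    variation D Φ Ψ (fun t ω => c • h t ω) t ω = c • variation D Φ Ψ h t ω := by
  rw [variation, variation, duhamel, duhamel, ← Matrix.mulVec_smul]
  congr 1
  ext j
  simp [Matrix.mulVec_smul]

lemma costQuad_smul (c : ℝ) (h : ℝ → Ω → Fin m → ℝ) :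
    costQuad D P Φ Ψ (fun t ω => c • h t ω) = c ^ 2 * costQuad D P Φ Ψ h := by
  rw [costQuad, costQuad, mul_add, ← integral_const_mul, ← integral_const_mul]
  congr 1
  · congr 1
    ext q
    simp only [quadDensity, variation_smul, Matrix.mulVec_smul, dotProduct_smul, smul_dotProduct,
      smul_eq_mul]
    ring
  · congr 1
    ext ω
    simp only [variation_smul, Matrix.mulVec_smul, dotProduct_smul, smul_dotProduct, smul_eq_mul]
    ring

lemma firstVariation_smul (c : ℝ) (u h : ℝ → Ω → Fin m → ℝ) (w : ℝ → Ω → Fin n → ℝ) :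
    firstVariation D P u w (fun t ω => c • h t ω) = c * firstVariation D P u w h := by
  rw [firstVariation, firstVariation, ← integral_const_mul]
  simp only [smul_dotProduct, smul_eq_mul]

end LQ

/-! ### Coercivity and projection on adapted processes -/

section Energy

variable {α : Type*} [MeasurableSpace α] {μ : Measure α} {k : ℕ} {f g : α → Fin k → ℝ}

lemma dotProduct_self_nonneg_real (a : Fin k → ℝ) : 0 ≤ a ⬝ᵥ a :=
  Finset.sum_nonneg fun i _ => mul_self_nonneg (a i)

lemma sq_apply_le_dotProduct_self (a : Fin k → ℝ) (i : Fin k) : a i ^ 2 ≤ a ⬝ᵥ a := by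
  rw [sq]
  exact Finset.single_le_sum (f := fun i => a i * a i) (fun j _ => mul_self_nonneg (a j))
    (Finset.mem_univ i)

lemma norm_sq_le_dotProduct_self (a : Fin k → ℝ) : ‖a‖ ^ 2 ≤ a ⬝ᵥ a := by
  rw [← Real.sq_sqrt (dotProduct_self_nonneg_real a)]
  refine pow_le_pow_left₀ (norm_nonneg _) ?_ 2
  exact (pi_norm_le_iff_of_nonneg (Real.sqrt_nonneg _)).2 fun i =>
    Real.abs_le_sqrt (sq_apply_le_dotProduct_self a i)

lemma dotProduct_self_le_norm_sq (a : Fin k → ℝ) : a ⬝ᵥ a ≤ k * ‖a‖ ^ 2 := by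
  have : ∀ i ∈ Finset.univ, a i * a i ≤ ‖a‖ ^ 2 := fun i _ => by
    rw [← sq, ← sq_abs]
    exact pow_le_pow_left₀ (abs_nonneg _) (norm_le_pi_norm a i) 2
  calc a ⬝ᵥ a ≤ Finset.univ.card • ‖a‖ ^ 2 := Finset.sum_le_card_nsmul _ _ _ this
    _ = k * ‖a‖ ^ 2 := by simp

lemma neg_young_le_dotProduct (a b : Fin k → ℝ) {c : ℝ} (hc : 0 < c) :
    -((1 / 2) * (c * (a ⬝ᵥ a) + c⁻¹ * (b ⬝ᵥ b))) ≤ a ⬝ᵥ b := by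
  have h := mul_nonneg (inv_nonneg.2 hc.le) (dotProduct_self_nonneg_real (c • a + b))
  have e : c⁻¹ * ((c • a + b) ⬝ᵥ (c • a + b)) = c * (a ⬝ᵥ a) + 2 * (a ⬝ᵥ b) + c⁻¹ * (b ⬝ᵥ b) := by
    simp only [add_dotProduct, dotProduct_add, smul_dotProduct, dotProduct_smul, smul_eq_mul,
      dotProduct_comm b a]
    field_simp
    ring
  linarith

lemma eLpNorm_two_eq_ofReal_sqrt (hf : MemLp f 2 μ) :
    eLpNorm f 2 μ = ENNReal.ofReal (√(∫ x, ‖f x‖ ^ 2 ∂μ)) := by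
  rw [hf.eLpNorm_eq_integral_rpow_norm (by norm_num) (by norm_num), Real.sqrt_eq_rpow]
  norm_num

lemma integrable_norm_sq (hf : MemLp f 2 μ) : Integrable (fun x => ‖f x‖ ^ 2) μ := by
  simpa using hf.norm.integrable_sq

lemma eLpNorm_lt_of_integral_dotProduct_self_lt (hf : MemLp f 2 μ) {r : ℝ} (hr : 0 < r)
    (h : ∫ x, f x ⬝ᵥ f x ∂μ < r ^ 2) : eLpNorm f 2 μ < ENNReal.ofReal r := by
  rw [eLpNorm_two_eq_ofReal_sqrt hf, ENNReal.ofReal_lt_ofReal_iff hr, Real.sqrt_lt' hr]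
  exact (integral_mono (integrable_norm_sq hf) (integrable_dotProduct hf hf)
    fun x => norm_sq_le_dotProduct_self (f x)).trans_lt h

lemma integral_dotProduct_self_le (hf : MemLp f 2 μ) :
    ∫ x, f x ⬝ᵥ f x ∂μ ≤ k * (eLpNorm f 2 μ).toReal ^ 2 := by
  rw [eLpNorm_two_eq_ofReal_sqrt hf, ENNReal.toReal_ofReal (Real.sqrt_nonneg _),
    Real.sq_sqrt (integral_nonneg fun x => by positivity), ← integral_const_mul]
  exact integral_mono (integrable_dotProduct hf hf) ((integrable_norm_sq hf).const_mul _)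
    fun x => dotProduct_self_le_norm_sq (f x)

lemma neg_young_le_integral_dotProduct (hf : MemLp f 2 μ) (hg : MemLp g 2 μ) {c : ℝ} (hc : 0 < c) :
    -((1 / 2) * (c * (∫ x, f x ⬝ᵥ f x ∂μ) + c⁻¹ * ∫ x, g x ⬝ᵥ g x ∂μ))
      ≤ ∫ x, f x ⬝ᵥ g x ∂μ := by
  have h1 := (integrable_dotProduct hf hf).const_mul c
  have h2 := (integrable_dotProduct hg hg).const_mul c⁻¹
  rw [← integral_const_mul, ← integral_const_mul, ← integral_add h1 h2, ← integral_const_mul,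
    ← integral_neg]
  exact integral_mono ((h1.add h2).const_mul _).neg (integrable_dotProduct hf hg)
    fun x => neg_young_le_dotProduct (f x) (g x) hc

lemma ae_eq_zero_of_integral_dotProduct_self_le_zero (hf : MemLp f 2 μ)
    (h : ∫ x, f x ⬝ᵥ f x ∂μ ≤ 0) : f =ᵐ[μ] 0 := by
  have h0 : 0 ≤ᵐ[μ] fun x => f x ⬝ᵥ f x :=
    Eventually.of_forall fun x => dotProduct_self_nonneg_real (f x)
  have := (integral_eq_zero_iff_of_nonneg_ae h0 (integrable_dotProduct hf hf)).1
    (le_antisymm h (integral_nonneg_of_ae h0))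
  filter_upwards [this] with x hx
  exact dotProduct_self_eq_zero.1 hx

end Energy

/-- For a.e. `t`, the marginal at time `t` of a square integrable process is square integrable. -/
lemma ae_memLp_apply_of_uncurry {Ω : Type*} [MeasurableSpace Ω] {P : Measure Ω}
    [IsProbabilityMeasure P] {T : ℝ} {k : ℕ} {v : ℝ → Ω → Fin k → ℝ}
    (hm : ∀ t ∈ Icc 0 T, AEStronglyMeasurable (v t) P)
    (hv : MemLp (Function.uncurry v) 2 (timeProd T P)) :
    ∀ᵐ t ∂(volume.restrict (Icc 0 T)), MemLp (v t) 2 P := by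
  have h : ∀ j, ∀ᵐ t ∂(volume.restrict (Icc 0 T)), Integrable (fun ω => v t ω j ^ 2) P :=
    fun j => ((memLp_pi_iff.1 hv j).integrable_sq).prod_right_ae
  filter_upwards [ae_all_iff.2 h, ae_restrict_mem measurableSet_Icc] with t ht hmem
  refine memLp_pi_iff.2 fun j => ?_
  rw [memLp_two_iff_integrable_sq ((continuous_apply j).comp_aestronglyMeasurable (hm t hmem))]
  exact ht j

namespace LQ

variable {n m : ℕ} {Ω : Type*} [mΩ : MeasurableSpace Ω] {D : Data n m} {x₀ : Ω → Fin n → ℝ}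
  {W : ℝ≥0 → Ω → Fin n → ℝ} {P : Measure Ω} {Φ Ψ : ℝ → Matrix (Fin n) (Fin n) ℝ}
  {M : ℝ → Ω → Fin n → ℝ}

namespace Data.Standing

lemma R_posDef (hD : D.Standing) {t : ℝ} (ht : t ∈ Icc 0 D.T) : (D.R t).PosDef := by
  obtain ⟨δ, hδ, h⟩ := hD.R_coercive
  have := Matrix.PosDef.posSemidef_add (h t ht) (Matrix.PosDef.one.smul hδ)
  rwa [sub_add_cancel] at this

lemma R_isUnit_det (hD : D.Standing) {t : ℝ} (ht : t ∈ Icc 0 D.T) : IsUnit (D.R t).det :=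
  (hD.R_posDef ht).det_pos.ne'.isUnit

/-- Coercivity of `R` makes `R⁻¹` bounded. -/
lemma R_inv_bdd (hD : D.Standing) : IsBoundedCoeff D.T fun t => (D.R t)⁻¹ := by
  constructor
  · intro i j
    have h1 : AEMeasurable (fun t => (fun i j => D.R t i j : Fin m → Fin m → ℝ))
        (volume.restrict (Icc 0 D.T)) :=
      aemeasurable_pi_iff.2 fun i => aemeasurable_pi_iff.2 fun j => hD.R_bdd.aemeasurable i j
    have h2 : AEStronglyMeasurable D.R (volume.restrict (Icc 0 D.T)) := h1.aestronglyMeasurable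
    have hdet := (Continuous.matrix_det continuous_id).comp_aestronglyMeasurable h2
    have hadj := ((Continuous.matrix_adjugate
      (continuous_id (X := Matrix (Fin m) (Fin m) ℝ))).matrix_elem i j).comp_aestronglyMeasurable h2
    have he : (fun t => (D.R t)⁻¹ i j) = fun t => (D.R t).det⁻¹ * (D.R t).adjugate i j := by
      funext t
      rw [Matrix.inv_def, Ring.inverse_eq_inv', Matrix.smul_apply, smul_eq_mul]
    rw [he]
    exact hdet.aemeasurable.inv.mul hadj.aemeasurable
  · obtain ⟨δ, hδ, h⟩ := hD.R_coercive
    refine ⟨δ⁻¹, fun t ht i j => ?_⟩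
    set e : Fin m → ℝ := Pi.single j 1
    set a := (D.R t)⁻¹ *ᵥ e with ha
    have hRa : D.R t *ᵥ a = e := by
      rw [ha, Matrix.mulVec_mulVec, Matrix.mul_nonsing_inv _ (hD.R_isUnit_det ht),
        Matrix.one_mulVec]
    have h1 := (h t ht).dotProduct_mulVec_nonneg_real a
    rw [Matrix.sub_mulVec, Matrix.smul_mulVec, Matrix.one_mulVec, dotProduct_sub, dotProduct_smul,
      smul_eq_mul, hRa] at h1
    have h2 : a ⬝ᵥ e = a j := by simp [e]
    have h3 := sq_apply_le_dotProduct_self a j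
    -- `δ |a|² ≤ aⱼ ≤ |a|` gives `|a| ≤ 1 / δ`
    have h4 : a ⬝ᵥ a ≤ δ⁻¹ ^ 2 := by
      have h5 : δ * (a ⬝ᵥ a) ≤ a j := by linarith
      have h6 : 0 ≤ a ⬝ᵥ a := dotProduct_self_nonneg_real a
      have h7 : (δ * (a ⬝ᵥ a)) ^ 2 ≤ a ⬝ᵥ a :=
        (pow_le_pow_left₀ (by positivity) h5 2).trans h3
      rcases h6.eq_or_lt with h8 | h8
      · rw [← h8]
        positivity
      · rw [inv_pow, ← one_div, le_div_iff₀ (by positivity)]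
        refine le_of_mul_le_mul_right ?_ h8
        linarith
    have h8 : (D.R t)⁻¹ i j = a i := by simp [ha, e]
    rw [h8]
    exact abs_le_of_sq_le_sq ((sq_apply_le_dotProduct_self a i).trans h4) (by positivity)

end Data.Standing

lemma MemL2F.feedback (hD : D.Standing) [IsProbabilityMeasure P] {p : ℝ → Ω → Fin n → ℝ}
    (hp : MemL2F D.T x₀ W P p) : MemL2F D.T x₀ W P (feedback D p) :=
  ⟨fun t ht => (stronglyMeasurable_mulVec _ (stronglyMeasurable_mulVec _ (hp.adapted t ht))).neg,
    (hD.R_inv_bdd.memLp_mulVec (hD.B_bdd.transpose.memLp_mulVec hp.memLp)).neg⟩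

lemma Data.Standing.controlGradient_feedback (hD : D.Standing) (p : ℝ → Ω → Fin n → ℝ) {t : ℝ}
    (ht : t ∈ Icc 0 D.T) (ω : Ω) : controlGradient D (LQ.feedback D p) p t ω = 0 := by
  rw [controlGradient, LQ.feedback, Matrix.mulVec_neg, Matrix.mulVec_mulVec,
    Matrix.mul_nonsing_inv _ (hD.R_isUnit_det ht), Matrix.one_mulVec, neg_add_cancel]

lemma Data.Standing.eq_feedback_of_controlGradient_eq_zero (hD : D.Standing)
    {u : ℝ → Ω → Fin m → ℝ} {p : ℝ → Ω → Fin n → ℝ} {t : ℝ} (ht : t ∈ Icc 0 D.T) {ω : Ω}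
    (h : controlGradient D u p t ω = 0) : u t ω = LQ.feedback D p t ω := by
  rw [controlGradient, add_eq_zero_iff_eq_neg] at h
  rw [LQ.feedback, ← Matrix.mulVec_neg, ← h, Matrix.mulVec_mulVec,
    Matrix.nonsing_inv_mul _ (hD.R_isUnit_det ht), Matrix.one_mulVec]

namespace IsFrame

variable [IsProbabilityMeasure P] {u v h : ℝ → Ω → Fin m → ℝ} {x y w p : ℝ → Ω → Fin n → ℝ}

lemma controlGradient_memL2F (F : IsFrame D x₀ W P Φ Ψ M) (hu : MemL2F D.T x₀ W P u)
    (hp : MemL2F D.T x₀ W P p) : MemL2F D.T x₀ W P (controlGradient D u p) :=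
  ⟨fun t ht => (stronglyMeasurable_mulVec _ (hu.adapted t ht)).add
    (stronglyMeasurable_mulVec _ (hp.adapted t ht)), F.controlGradient_memLp hu hp.memLp⟩

/-- In adapted directions the adjoint process may be replaced by its conditional expectations. -/
lemma firstVariation_eq_of_condExp (F : IsFrame D x₀ W P Φ Ψ M) (hu : MemL2F D.T x₀ W P u)
    (hh : MemL2F D.T x₀ W P h) (hw : MemLp (Function.uncurry w) 2 (timeProd D.T P))
    (hwt : ∀ t ∈ Icc 0 D.T, MemLp (w t) 2 P) (hp : MemL2F D.T x₀ W P p)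
    (hpw : ∀ t ∈ Icc 0 D.T, p t =ᵐ[P] P[w t | history x₀ W t]) :
    firstVariation D P u w h = firstVariation D P u p h := by
  have hD := F.standing
  have hBh := hD.B_bdd.memLp_mulVec hh.memLp
  have hwp : MemLp (Function.uncurry fun t ω => w t ω - p t ω) 2 (timeProd D.T P) := hw.sub hp.memLp
  have hint : Integrable (fun q : ℝ × Ω => (D.B q.1 *ᵥ h q.1 q.2) ⬝ᵥ (w q.1 q.2 - p q.1 q.2))
      (timeProd D.T P) := integrable_dotProduct hBh hwp
  have hzero : ∫ q, (D.B q.1 *ᵥ h q.1 q.2) ⬝ᵥ (w q.1 q.2 - p q.1 q.2) ∂(timeProd D.T P) = 0 := by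
    rw [integral_prod _ hint]
    refine integral_eq_zero_of_ae ?_
    filter_upwards [ae_restrict_mem measurableSet_Icc, ae_memLp_apply_of_uncurry (fun t ht =>
      ((hh.adapted t ht).mono (F.history_le t)).aestronglyMeasurable) hh.memLp] with t ht hht
    have hg := memLp_pi_iff.1 (memLp_mulVec (D.B t) hht)
    have hpt : MemLp (p t) 2 P :=
      (memLp_congr_ae (hpw t ht)).2 ((hwt t ht).condExp (by norm_num))
    have hZ := memLp_pi_iff.1 ((hwt t ht).sub hpt)
    simp only [Pi.zero_apply, dotProduct]
    have hi : ∀ i, Integrable (fun ω => (D.B t *ᵥ h t ω) i * (w t ω - p t ω) i) P :=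
      fun i => (hg i).integrable_mul (hZ i)
    rw [integral_finsetSum _ fun i _ => hi i]
    refine Finset.sum_eq_zero fun i _ => ?_
    refine integral_mul_eq_zero_of_condExp_eq_zero (F.history_le t) (hZ i) (hg i)
      ((continuous_apply i).comp_stronglyMeasurable
        (stronglyMeasurable_mulVec _ (hh.adapted t ht))).aestronglyMeasurable ?_
    have hwi := (memLp_pi_iff.1 (hwt t ht) i).integrable (q := 2) (by norm_num)
    refine EventuallyEq.trans (condExp_congr_ae ?_)
      (condExp_sub_condExp_ae_eq_zero (F.history_le t) hwi)
    filter_upwards [hpw t ht, condExp_apply_ae_eq (m₁ := history x₀ W t)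
      ((hwt t ht).integrable (q := 2) (by norm_num)) i] with ω e1 e2
    simp only [Pi.sub_apply, e1, e2]
  have hsub : firstVariation D P u w h - firstVariation D P u p h = 0 := by
    have hi : ∀ {w : ℝ → Ω → Fin n → ℝ}, MemLp (Function.uncurry w) 2 (timeProd D.T P) →
        Integrable (fun q : ℝ × Ω => h q.1 q.2 ⬝ᵥ controlGradient D u w q.1 q.2)
          (timeProd D.T P) :=
      fun hw => integrable_dotProduct hh.memLp (F.controlGradient_memLp hu hw)
    rw [← hzero, firstVariation, firstVariation, ← integral_sub (hi hw) (hi hp.memLp)]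
    refine integral_congr_ae (Eventually.of_forall fun q => ?_)
    simp only [controlGradient, dotProduct_add, dotProduct_sub,
      Matrix.dotProduct_transpose_mulVec]
    rw [dotProduct_comm (w q.1 q.2), dotProduct_comm (p q.1 q.2)]
    ring
  exact sub_eq_zero.1 hsub

end IsFrame

end LQ

/-! ### Existence, uniqueness and the maximum principle -/

namespace LQ

variable {n m : ℕ} {Ω : Type*} [mΩ : MeasurableSpace Ω] {D : Data n m} {x₀ : Ω → Fin n → ℝ}
  {W : ℝ≥0 → Ω → Fin n → ℝ} {P : Measure Ω} {Φ Ψ : ℝ → Matrix (Fin n) (Fin n) ℝ}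
  {M : ℝ → Ω → Fin n → ℝ}

lemma Data.Standing.cost_nonneg (hD : D.Standing) (v : ℝ → Ω → Fin m → ℝ)
    (x : ℝ → Ω → Fin n → ℝ) : 0 ≤ cost D P v x := by
  have hTT : D.T ∈ Icc 0 D.T := ⟨hD.T_pos.le, le_rfl⟩
  have hQ := fun t ht => (hD.Q_nonneg t ht).dotProduct_mulVec_nonneg_real
  have hQb := fun t ht => (hD.Qbar_nonneg t ht).dotProduct_mulVec_nonneg_real
  refine add_nonneg (integral_nonneg fun ω =>
    intervalIntegral.integral_nonneg hD.T_pos.le fun t ht => ?_) (integral_nonneg fun ω => ?_)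
  · have h1 := hQ t ht (x t ω)
    have h2 := hQb t ht (x t ω - D.S t *ᵥ D.z t)
    have h3 := (hD.R_posDef ht).posSemidef.dotProduct_mulVec_nonneg_real (v t ω)
    simp only [runningCost]
    linarith
  · have h1 := hQ _ hTT (x D.T ω)
    have h2 := hQb _ hTT (x D.T ω - D.S D.T *ᵥ D.z D.T)
    simp only [terminalCost, Pi.zero_apply]
    linarith

namespace IsFrame

variable [IsProbabilityMeasure P] {u v h : ℝ → Ω → Fin m → ℝ} {x y w p : ℝ → Ω → Fin n → ℝ}

/-- The expansion of the cost at `u`, for the states given by the variation of constants formula. -/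
lemma cost_stateMap_eq_add (F : IsFrame D x₀ W P Φ Ψ M) (hu : MemL2F D.T x₀ W P u)
    (hv : MemL2F D.T x₀ W P v) :
    cost D P v (stateMap D x₀ Φ Ψ M v) = cost D P u (stateMap D x₀ Φ Ψ M u)
      + firstVariation D P u (adjointMap D Φ Ψ (stateMap D x₀ Φ Ψ M u)) (fun t ω => v t ω - u t ω)
      + (1 / 2) * costQuad D P Φ Ψ (fun t ω => v t ω - u t ω) :=
  F.cost_eq_add hu hv (F.isState_stateMap hu) (F.isState_stateMap hv)
    (F.isAdjoint_adjointMap hu (F.isState_stateMap hu))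

lemma costQuad_nonneg (F : IsFrame D x₀ W P Φ Ψ M) (hh : MemL2F D.T x₀ W P h) :
    0 ≤ costQuad D P Φ Ψ h := by
  obtain ⟨δ, hδ, hq⟩ := F.exists_le_costQuad
  exact (mul_nonneg hδ.le (integral_nonneg fun q => dotProduct_self_nonneg_real _)).trans (hq h hh)

/-- The parallelogram identity for the cost. -/
lemma cost_add_cost (F : IsFrame D x₀ W P Φ Ψ M) (hu : MemL2F D.T x₀ W P u)
    (hv : MemL2F D.T x₀ W P v) :
    cost D P u (stateMap D x₀ Φ Ψ M u) + cost D P v (stateMap D x₀ Φ Ψ M v)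
      = 2 * cost D P (fun t ω => (1 / 2 : ℝ) • (u t ω + v t ω))
          (stateMap D x₀ Φ Ψ M fun t ω => (1 / 2 : ℝ) • (u t ω + v t ω))
        + (1 / 4) * costQuad D P Φ Ψ (fun t ω => u t ω - v t ω) := by
  have hc := (hu.add hv).const_smul (1 / 2)
  have e1 : (fun t ω => u t ω - (1 / 2 : ℝ) • (u t ω + v t ω))
      = fun t ω => (1 / 2 : ℝ) • (u t ω - v t ω) := by
    funext t ω; module
  have e2 : (fun t ω => v t ω - (1 / 2 : ℝ) • (u t ω + v t ω))
      = fun t ω => (-(1 / 2) : ℝ) • (u t ω - v t ω) := by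
    funext t ω; module
  have h1 := F.cost_stateMap_eq_add hc hu
  have h2 := F.cost_stateMap_eq_add hc hv
  rw [e1, firstVariation_smul _ _ (fun t ω => u t ω - v t ω),
    costQuad_smul _ fun t ω => u t ω - v t ω] at h1
  rw [e2, firstVariation_smul _ _ (fun t ω => u t ω - v t ω),
    costQuad_smul _ fun t ω => u t ω - v t ω] at h2
  rw [h1, h2]
  ring

/-- Existence of a minimizer, by the direct method: the parallelogram identity and coercivity make a
minimizing sequence Cauchy. -/
lemma exists_minimizer (F : IsFrame D x₀ W P Φ Ψ M) : ∃ u, MemL2F D.T x₀ W P u ∧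
    ∀ v, MemL2F D.T x₀ W P v →
      cost D P u (stateMap D x₀ Φ Ψ M u) ≤ cost D P v (stateMap D x₀ Φ Ψ M v) := by
  let J : (ℝ → Ω → Fin m → ℝ) → ℝ := fun v => cost D P v (stateMap D x₀ Φ Ψ M v)
  let S : Set ℝ := {r | ∃ v, MemL2F D.T x₀ W P v ∧ J v = r}
  have hbdd : BddBelow S :=
    ⟨0, fun r ⟨v, _, hr⟩ => hr ▸ F.standing.cost_nonneg v (stateMap D x₀ Φ Ψ M v)⟩
  have hle : ∀ v, MemL2F D.T x₀ W P v → sInf S ≤ J v := fun v hv => csInf_le hbdd ⟨v, hv, rfl⟩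
  obtain ⟨r, -, hr, hrS⟩ := exists_seq_tendsto_sInf (S := S) ⟨_, _, MemL2F.zero, rfl⟩ hbdd
  choose v hv hvr using hrS
  have hJ : Tendsto (fun k => J (v k)) atTop (𝓝 (sInf S)) := by simpa only [hvr] using hr
  obtain ⟨δ, hδ, hq⟩ := F.exists_le_costQuad
  have hcauchy : ∀ ε : ℝ≥0∞, 0 < ε → ∃ N₀, ∀ N ≥ N₀, ∀ N' ≥ N₀,
      eLpNorm (Function.uncurry (v N) - Function.uncurry (v N')) 2 (timeProd D.T P) < ε := by
    intro ε hε
    obtain ⟨a, ha0, haε⟩ := ENNReal.lt_iff_exists_nnreal_btwn.1 hε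
    have ha : (0 : ℝ) < a := by exact_mod_cast ha0
    have hη : 0 < δ * (a : ℝ) ^ 2 / 8 := by positivity
    obtain ⟨N₀, hN₀⟩ := eventually_atTop.1 (hJ.eventually_lt_const (lt_add_of_pos_right _ hη))
    refine ⟨N₀, fun N hN N' hN' => lt_of_lt_of_le ?_ haε.le⟩
    have hd := (hv N).sub (hv N')
    rw [← ENNReal.ofReal_coe_nnreal]
    refine eLpNorm_lt_of_integral_dotProduct_self_lt
      (f := Function.uncurry (v N) - Function.uncurry (v N')) hd.memLp ha ?_
    have h1 := F.cost_add_cost (hv N) (hv N')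
    have h2 := hle _ (((hv N).add (hv N')).const_smul (1 / 2))
    have h3 := hq _ hd
    have h4 := hN₀ N hN
    have h5 := hN₀ N' hN'
    simp only [J] at h2 h4 h5
    refine lt_of_mul_lt_mul_left (a := δ) (lt_of_le_of_lt h3 ?_) hδ.le
    linarith
  obtain ⟨u, hu, hlim⟩ := exists_memL2F_tendsto hv hcauchy
  refine ⟨u, hu, fun v' hv' => le_trans ?_ (hle v' hv')⟩
  set G := controlGradient D u (adjointMap D Φ Ψ (stateMap D x₀ Φ Ψ M u))
  have hGm : MemLp (Function.uncurry G) 2 (timeProd D.T P) :=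
    F.controlGradient_memLp hu (F.adjoint_memLp_both hu (F.isState_stateMap hu)
      (F.isAdjoint_adjointMap hu (F.isState_stateMap hu))).1
  set K := ∫ q, G q.1 q.2 ⬝ᵥ G q.1 q.2 ∂(timeProd D.T P)
  let e : ℕ → ℝ := fun k =>
    ∫ q, (v k q.1 q.2 - u q.1 q.2) ⬝ᵥ (v k q.1 q.2 - u q.1 q.2) ∂(timeProd D.T P)
  have he : Tendsto e atTop (𝓝 0) := by
    have h1 : Tendsto (fun k => (m : ℝ) * (eLpNorm (Function.uncurry (v k) - Function.uncurry u) 2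
        (timeProd D.T P)).toReal ^ 2) atTop (𝓝 0) := by
      simpa using (((ENNReal.tendsto_toReal ENNReal.zero_ne_top).comp hlim).pow 2).const_mul (m : ℝ)
    exact squeeze_zero (fun k => integral_nonneg fun q => dotProduct_self_nonneg_real _)
      (fun k => integral_dotProduct_self_le
        (f := Function.uncurry (v k) - Function.uncurry u) ((hv k).sub hu).memLp) h1
  -- the linear term at `u` is bounded by Young's inequality with weight `c`; its part with `v k - u`
  -- disappears as `k → ∞`, and the rest as `c → ∞`
  have hlow : ∀ c : ℝ, 0 < c → J u ≤ sInf S + (1 / 2) * (c⁻¹ * K) := by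
    intro c hc
    have hup : Tendsto (fun k => J (v k) + (1 / 2) * (c * e k + c⁻¹ * K)) atTop
        (𝓝 (sInf S + (1 / 2) * (c * 0 + c⁻¹ * K))) :=
      hJ.add (((he.const_mul c).add_const _).const_mul _)
    rw [mul_zero, zero_add] at hup
    refine ge_of_tendsto' hup fun k => ?_
    have h1 := F.cost_stateMap_eq_add hu (hv k)
    have h2 := F.costQuad_nonneg ((hv k).sub hu)
    have h3 := neg_young_le_integral_dotProduct ((hv k).sub hu).memLp hGm hc
    have h4 : -((1 / 2) * (c * e k + c⁻¹ * K)) ≤ firstVariation D P u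
      (adjointMap D Φ Ψ (stateMap D x₀ Φ Ψ M u)) (fun t ω => v k t ω - u t ω) := h3
    simp only [J]
    linarith
  have hlim2 : Tendsto (fun c : ℝ => sInf S + (1 / 2) * (c⁻¹ * K)) atTop (𝓝 (sInf S)) := by
    simpa using ((tendsto_inv_atTop_zero.mul_const K).const_mul (1 / 2 : ℝ)).const_add (sInf S)
  exact ge_of_tendsto hlim2 ((eventually_gt_atTop 0).mono hlow)

/-- At a minimizer the first variation of the cost vanishes. -/
lemma firstVariation_eq_zero (F : IsFrame D x₀ W P Φ Ψ M) (hu : MemL2F D.T x₀ W P u)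
    (hmin : ∀ v, MemL2F D.T x₀ W P v →
      cost D P u (stateMap D x₀ Φ Ψ M u) ≤ cost D P v (stateMap D x₀ Φ Ψ M v))
    (hh : MemL2F D.T x₀ W P h) :
    firstVariation D P u (adjointMap D Φ Ψ (stateMap D x₀ Φ Ψ M u)) h = 0 := by
  set L := firstVariation D P u (adjointMap D Φ Ψ (stateMap D x₀ Φ Ψ M u)) h
  set q := costQuad D P Φ Ψ h
  have hq : 0 ≤ q := F.costQuad_nonneg hh
  have key : ∀ c : ℝ, 0 ≤ c * L + (1 / 2) * (c ^ 2 * q) := by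
    intro c
    have hv := hu.add (hh.const_smul c)
    have h1 := F.cost_stateMap_eq_add hu hv
    have e : (fun t ω => u t ω + c • h t ω - u t ω) = fun t ω => c • h t ω := by
      funext t ω; abel
    rw [e, firstVariation_smul, costQuad_smul] at h1
    linarith [hmin _ hv]
  -- nearly the minimizing `c = -L / q`, with a denominator that cannot vanish
  have h2 := key (-L / (1 + q))
  have h3 : 0 ≤ (-L / (1 + q) * L + (1 / 2) * ((-L / (1 + q)) ^ 2 * q)) * (1 + q) ^ 2 :=
    mul_nonneg h2 (sq_nonneg _)
  have h4 : (-L / (1 + q) * L + (1 / 2) * ((-L / (1 + q)) ^ 2 * q)) * (1 + q) ^ 2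
      = -(L ^ 2 * (1 + q / 2)) := by
    field_simp
    ring
  rw [h4] at h3
  have h5 : L ^ 2 ≤ 0 := by nlinarith [mul_nonneg (sq_nonneg L) hq]
  exact pow_eq_zero_iff two_ne_zero |>.1 (le_antisymm h5 (sq_nonneg L))

/-- At a control given by the maximum principle the linear part of the expansion of the cost
vanishes. -/
lemma cost_eq_add_costQuad (F : IsFrame D x₀ W P Φ Ψ M) (h : IsMaxPrinciple D x₀ W P y w p)
    (hv : MemL2F D.T x₀ W P v) (hx : IsState D x₀ W P v x) :
    cost D P v x = cost D P (feedback D p) y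
      + (1 / 2) * costQuad D P Φ Ψ (fun t ω => v t ω - feedback D p t ω) := by
  have hf := MemL2F.feedback F.standing h.p_mem
  have hw := F.adjoint_memLp_both hf h.state h.adjoint
  have hd := hv.sub hf
  rw [F.cost_eq_add hf hv h.state hx h.adjoint,
    F.firstVariation_eq_of_condExp hf hd hw.1 hw.2 h.p_mem h.condExp]
  have : firstVariation D P (feedback D p) p (fun t ω => v t ω - feedback D p t ω) = 0 := by
    refine integral_eq_zero_of_ae ?_
    filter_upwards [ae_timeProd_fst_mem (T := D.T) (P := P)] with q hq
    rw [F.standing.controlGradient_feedback p hq, dotProduct_zero, Pi.zero_apply]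
  rw [this, add_zero]

/-- The maximum principle is sufficient for optimality. -/
lemma isOptimal_feedback (F : IsFrame D x₀ W P Φ Ψ M) (h : IsMaxPrinciple D x₀ W P y w p) :
    IsOptimal D x₀ W P (feedback D p) := by
  have hf := MemL2F.feedback F.standing h.p_mem
  refine ⟨hf, y, h.state, fun v x hv hx => ?_⟩
  rw [F.cost_eq_add_costQuad h hv hx]
  linarith [F.costQuad_nonneg (hv.sub hf)]

/-- Every optimal control agrees with the one given by the maximum principle. -/
lemma ae_eq_feedback (F : IsFrame D x₀ W P Φ Ψ M) (h : IsMaxPrinciple D x₀ W P y w p)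
    (hu : IsOptimal D x₀ W P u) :
    Function.uncurry u =ᵐ[timeProd D.T P] Function.uncurry (feedback D p) := by
  have hf := MemL2F.feedback F.standing h.p_mem
  obtain ⟨hum, x, hx, hmin⟩ := hu
  obtain ⟨δ, hδ, hq⟩ := F.exists_le_costQuad
  have hd := hum.sub hf
  have h1 := F.cost_eq_add_costQuad h hum hx
  have h2 := hmin _ y hf h.state
  have h3 := hq _ hd
  have h4 : ∫ q, (u q.1 q.2 - feedback D p q.1 q.2) ⬝ᵥ (u q.1 q.2 - feedback D p q.1 q.2)
      ∂(timeProd D.T P) ≤ 0 := by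
    refine le_of_mul_le_mul_left (a := δ) ?_ hδ
    rw [mul_zero]
    linarith
  filter_upwards [ae_eq_zero_of_integral_dotProduct_self_le_zero hd.memLp h4] with q hq
  exact sub_eq_zero.1 hq

/-- The maximum principle is necessary for optimality: the projected gradient at a minimizer is an
admissible direction, so it vanishes. -/
lemma exists_isMaxPrinciple (F : IsFrame D x₀ W P Φ Ψ M) :
    ∃ y w p, IsMaxPrinciple D x₀ W P y w p := by
  obtain ⟨u, hu, hmin⟩ := F.exists_minimizer
  have hy := F.isState_stateMap hu
  have hadj := F.isAdjoint_adjointMap hu hy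
  have hw := F.adjoint_memLp_both hu hy hadj
  obtain ⟨p, hp, hpw⟩ := F.exists_condExp_adjointMap hu hy
  have hG := F.controlGradient_memL2F hu hp
  have h1 := F.firstVariation_eq_zero hu hmin hG
  rw [F.firstVariation_eq_of_condExp hu hG hw.1 hw.2 hp hpw] at h1
  have hzero := ae_eq_zero_of_integral_dotProduct_self_le_zero hG.memLp (le_of_eq h1)
  have hfb : Function.uncurry u =ᵐ[timeProd D.T P] Function.uncurry (feedback D p) := by
    filter_upwards [hzero, ae_timeProd_fst_mem (T := D.T) (P := P)] with q h2 hq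
    exact F.standing.eq_feedback_of_controlGradient_eq_zero hq h2
  exact ⟨_, _, p, hp, hy.congr hfb, hadj,
    fun t ht => (hw.2 t ht).integrable (by norm_num), hpw⟩

end IsFrame

end LQ

theorem theorem3p2 {n m : ℕ} {Ω : Type*} [MeasurableSpace Ω] (P : Measure Ω)
    [IsProbabilityMeasure P] [P.IsComplete]
    (D : LQ.Data n m) (hD : D.Standing)
    (W : ℝ≥0 → Ω → Fin n → ℝ) (hW : LQ.IsWienerProcess W P)
    (x₀ : Ω → Fin n → ℝ) (hx₀ : Measurable x₀) (hx₀_sq : MemLp x₀ 2 P)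
    (hindep : IndepFun x₀ (fun (ω : Ω) (t : ℝ≥0) => W t ω) P) :
    -- every admissible control has exactly one state process, and its cost is finite
    (∀ v, LQ.MemL2F D.T x₀ W P v →
      (∃ x, LQ.IsState D x₀ W P v x) ∧
      (∀ x, LQ.IsState D x₀ W P v x → LQ.CostFinite D P v x) ∧
      ∀ x x', LQ.IsState D x₀ W P v x → LQ.IsState D x₀ W P v x' →
        ∀ᵐ ω ∂P, ∀ t ∈ Icc 0 D.T, x t ω = x' t ω) ∧
    -- there is exactly one optimal control, and it is `-R⁻¹ B* p`
    ∃ u, LQ.IsOptimal D x₀ W P u ∧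
      (∀ u', LQ.IsOptimal D x₀ W P u' →
        Function.uncurry u' =ᵐ[(volume.restrict (Icc 0 D.T)).prod P] Function.uncurry u) ∧
      (∃ y w p, LQ.IsMaxPrinciple D x₀ W P y w p) ∧
      ∀ y w p, LQ.IsMaxPrinciple D x₀ W P y w p →
        LQ.IsState D x₀ W P u y ∧
        Function.uncurry u =ᵐ[(volume.restrict (Icc 0 D.T)).prod P]
          Function.uncurry (LQ.feedback D p) := by
  obtain ⟨Φ, Ψ, M, F⟩ := LQ.exists_isFrame hD hW hx₀ hx₀_sq
  refine ⟨fun v hv => ⟨⟨_, F.isState_stateMap hv⟩, fun x hx => F.costFinite hv hx,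
    fun x x' hx hx' => F.state_ae_unique hv hx hx'⟩, ?_⟩
  obtain ⟨y, w, p, h⟩ := F.exists_isMaxPrinciple
  have hopt := F.isOptimal_feedback h
  refine ⟨LQ.feedback D p, hopt, fun u' hu' => F.ae_eq_feedback h hu', ⟨y, w, p, h⟩,
    fun y' w' p' h' => ?_⟩
  have he := F.ae_eq_feedback h' hopt
  exact ⟨h'.state.congr he.symm, he⟩
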